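/- Let $S$ be a scheme, let $(E,\phi)$ be a symplectic bundle of rank $2n$ over $S$ (a vector bundle with an alternating bilinear form that is nondegenerate at every point), and let $r\ge 0$. Let $(F,\psi)$ be the symplectic bundle of rank $2n+2$ with $$F=\mathcal O_S\oplus E\oplus\mathcal O_S,\qquad \psi=\begin{pmatrix}0&0&1\\0&\phi&0\\-1&0&0\end{pmatrix}.$$ For a vector bundle $V$ on $S$ let $\mathrm{Gr}_S(k;V)$ be the Grassmannian bundle of rank $k$ subbundles of $V$, and let $\mathrm{HGr}(E)=\mathrm{HGr}_S(r;E,\phi)$ and $\mathrm{HGr}(F)=\mathrm{HGr}_S(r;F,\psi)$ be the quaternionic Grassmannian bundles, which parametrize the subbundles of rank $2r$ of $E$ and $F$ on which $\phi$ and $\psi$, respectively, are nondegenerate; let $\mathcal U_E$ and $\mathcal U_F$ be their tautological subbundles. These schemes exist, $\mathrm{HGr}(F)$ is an open subscheme of $\mathrm{Gr}_S(2r;F)$, and $U\mapsto 0\oplus U\oplus 0$ is a closed embedding $\mathrm{HGr}(E)\to\mathrm{HGr}(F)$. (Open immersions here are quasi-compact, and the closed subschemes in (b) have retrocompact complements.)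 (a) The normal bundle $N$ of $\mathrm{HGr}(E)$ in $\mathrm{HGr}(F)$ is a vector bundle of rank $4r$ over $\mathrm{HGr}(E)$, and it has a canonical embedding $j$ as an open subscheme of $\mathrm{Gr}_S(2r;F)$ which on the zero section is the embedding $\mathrm{HGr}(E)\to\mathrm{HGr}(F)\subset\mathrm{Gr}_S(2r;F)$, and which induces the identity on the normal bundles of $\mathrm{HGr}(E)$. (b) The subschemes $N^+=\mathrm{HGr}(F)\cap\mathrm{Gr}_S(2r;\mathcal O_S\oplus E)$ and $N^-=\mathrm{HGr}(F)\cap\mathrm{Gr}_S(2r;E\oplus\mathcal O_S)$ of $\mathrm{Gr}_S(2r;F)$ are closed in $\mathrm{HGr}(F)$, are contained in $j(N)$, and are, through $j$, subbundles of rank $2r$ of $N$ with $N=N^+\oplus N^-$. We have $N^+\cap N^-=\mathrm{HGr}(E)$ as schemes. (c) There are natural isomorphisms of vector bundles $c_\pm\colon N^\pm\cong\mathcal U_E$ over $\mathrm{HGr}(E)$. Explicitly, for $x_\pm$ in $N^\pm$ over the same point $U\subset E$ of $\mathrm{HGr}(E)$ (with values in any scheme), $j(x_++x_-)$ is the subbundle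 $\{(\phi(c_+x_+,w),\,w,\,\phi(c_-x_-,w)) : w\in U\}$ of $F$. (d) There is a section $s_+$ of $\mathcal U_F$, determined by the condition that $\psi(s_+,u)$ is the last coordinate of $u$ for every $u\in\mathcal U_F\subset\mathcal O\oplus E\oplus\mathcal O$, whose scheme of zeros is $N^+$ and which meets the zero section transversally there: $\mathrm{HGr}(F)$ is smooth over $S$, and at every zero the differential of $s_+$, from the relative tangent space of $\mathrm{HGr}(F)$ over $S$ to the fibre of $\mathcal U_F$, is surjective. The section $s_-$ defined in the same way with the first coordinate meets the zero section transversally in $N^-$. (e) Let $\pi_\pm\colon N^\pm\to\mathrm{HGr}(E)$ be the structural maps. Then $\pi_\pm^*(\mathcal U_E,\phi|_{\mathcal U_E})$ is isometric to $(\mathcal U_F,\psi|_{\mathcal U_F})|_{N^\pm}$. -/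

import Mathlib

open CategoryTheory AlgebraicGeometry Limits Opposite

universe u

noncomputable section

namespace SymplecticGrassmannian

/-! ### Vector bundles

Everything lives over a base scheme `S`; an `S`-scheme is an object of `Over S`. -/

/-- The ring of global functions of an `S`-scheme `T`. -/
abbrev Fn {S : Scheme.{u}} (T : Over S) : Type u := Γ(T.left, ⊤)

/-- Pullback of functions along a morphism of `S`-schemes. -/
def Fn.pull {S : Scheme.{u}} {T' T : Over S} (f : T' ⟶ T) : Fn T →+* Fn T' :=
  f.left.appTop.hom

/-- The open subscheme `U` of an `S`-scheme `T`, as an `S`-scheme. -/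
abbrev restr {S : Scheme.{u}} (T : Over S) (U : T.left.Opens) : Over S :=
  Over.mk (U.ι ≫ T.hom)

/-- The inclusion of the open subscheme `U` of `T`. -/
abbrev restrι {S : Scheme.{u}} (T : Over S) (U : T.left.Opens) : restr T U ⟶ T :=
  Over.homMk U.ι rfl

/-- `e` is a basis of the submodule `W`. -/
def IsBasisOf {R M : Type u} [CommRing R] [AddCommGroup M] [Module R M] {n : ℕ}
    (e : Fin n → M) (W : Submodule R M) : Prop :=
  LinearIndependent R e ∧ Submodule.span R (Set.range e) = W

/-- A vector bundle of rank `n` over `S`: an `S`-scheme `tot` (the total space) with a structure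
of `𝒪(T)`-module on its `T`-points, functorial in the `S`-scheme `T`, which is Zariski locally on
`S` linearly isomorphic to affine `n`-space: locally there are `n` sections which form a basis of
the module of `T`-points for every `T`.
The set `T ⟶ tot` is the set of global sections of the pullback of the bundle to `T`. -/
structure VectorBundle (S : Scheme.{u}) (n : ℕ) where
  tot : Over S
  [addCommGroup : ∀ T : Over S, AddCommGroup (T ⟶ tot)]
  [module : ∀ T : Over S, Module (Fn T) (T ⟶ tot)]
  comp_add : ∀ {T' T : Over S} (f : T' ⟶ T) (x y : T ⟶ tot), f ≫ (x + y) = f ≫ x + f ≫ y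
  comp_smul : ∀ {T' T : Over S} (f : T' ⟶ T) (a : Fn T) (x : T ⟶ tot),
    f ≫ (a • x) = Fn.pull f a • (f ≫ x)
  exists_frame : ∀ s : S, ∃ U : S.Opens, s ∈ U ∧ ∃ e : Fin n → (Over.mk U.ι ⟶ tot),
    ∀ (T : Over S) (f : T ⟶ Over.mk U.ι), IsBasisOf (R := Fn T) (fun i => f ≫ e i) ⊤

attribute [instance] VectorBundle.addCommGroup VectorBundle.module

/-- A linear morphism of vector bundles. -/
structure BundleHom {S : Scheme.{u}} {n n' : ℕ} (V : VectorBundle S n) (V' : VectorBundle S n') where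
  hom : V.tot ⟶ V'.tot
  map_add : ∀ (T : Over S) (x y : T ⟶ V.tot), (x + y) ≫ hom = x ≫ hom + y ≫ hom
  map_smul : ∀ (T : Over S) (a : Fn T) (x : T ⟶ V.tot), (a • x) ≫ hom = a • (x ≫ hom)

/-- The linear map induced by a morphism of bundles on sections over `T`. -/
def BundleHom.lin {S : Scheme.{u}} {n n' : ℕ} {V : VectorBundle S n} {V' : VectorBundle S n'}
    (g : BundleHom V V') (T : Over S) : (T ⟶ V.tot) →ₗ[Fn T] (T ⟶ V'.tot) where
  toFun x := x ≫ g.hom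
  map_add' := g.map_add T
  map_smul' := g.map_smul T

lemma BundleHom.lin_comp {S : Scheme.{u}} {n n' : ℕ} {V : VectorBundle S n}
    {V' : VectorBundle S n'} (g : BundleHom V V') {T' T : Over S} (f : T' ⟶ T) (x : T ⟶ V.tot) :
    g.lin T' (f ≫ x) = f ≫ g.lin T x :=
  Category.assoc f x g.hom

/-- Points of the affine line over `S` are functions. -/
def lineEquiv {S : Scheme.{u}} (T : Over S) :
    (T ⟶ Over.mk (𝔸(PUnit.{u+1}; S) ↘ S)) ≃ Fn T where
  toFun x := x.left.appTop.hom (AffineSpace.coord S PUnit.unit)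
  invFun a := Over.homMk (AffineSpace.homOfVector T.hom fun _ => a)
    (AffineSpace.homOfVector_over _ _)
  left_inv x := by
    ext1
    refine AffineSpace.hom_ext ?_ fun i => ?_
    · simpa using (Over.w x).symm
    · exact AffineSpace.homOfVector_appTop_coord _ _ _
  right_inv a := AffineSpace.homOfVector_appTop_coord _ _ _

lemma lineEquiv_comp {S : Scheme.{u}} {T' T : Over S} (f : T' ⟶ T)
    (x : T ⟶ Over.mk (𝔸(PUnit.{u+1}; S) ↘ S)) :
    lineEquiv T' (f ≫ x) = Fn.pull f (lineEquiv T x) := by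
  change (f.left ≫ x.left).appTop.hom _ = f.left.appTop.hom (x.left.appTop.hom _)
  rw [Scheme.Hom.comp_appTop]
  rfl

/-- The trivial line bundle `𝒪_S`, with total space the affine line over `S`. -/
def trivialLine (S : Scheme.{u}) : VectorBundle S 1 where
  tot := Over.mk (𝔸(PUnit.{u+1}; S) ↘ S)
  addCommGroup T := (lineEquiv T).addCommGroup
  module T := letI := (lineEquiv T).addCommGroup; (lineEquiv T).module (Fn T)
  comp_add {T' T} f x y := by
    apply (lineEquiv T').injective
    refine Eq.trans ?_ ((lineEquiv T').apply_symm_apply _).symm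
    rw [lineEquiv_comp]
    refine (congrArg (Fn.pull f) ((lineEquiv T).apply_symm_apply _)).trans ?_
    exact (map_add (Fn.pull f) _ _).trans
      (congrArg₂ (· + ·) (lineEquiv_comp f x).symm (lineEquiv_comp f y).symm)
  comp_smul {T' T} f a x := by
    apply (lineEquiv T').injective
    refine Eq.trans ?_ ((lineEquiv T').apply_symm_apply _).symm
    rw [lineEquiv_comp]
    refine (congrArg (Fn.pull f) ((lineEquiv T).apply_symm_apply _)).trans ?_
    exact (map_mul (Fn.pull f) _ _).trans
      (congrArg (Fn.pull f a * ·) (lineEquiv_comp f x).symm)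
  exists_frame s := by
    refine ⟨⊤, trivial, fun _ => (lineEquiv _).symm 1, fun T f => ?_⟩
    let _ := (lineEquiv T).addCommGroup
    let _ := (lineEquiv T).module (Fn T)
    have h : ∀ i : Fin 1, f ≫ (lineEquiv (Over.mk (⊤ : S.Opens).ι)).symm 1 =
        ((Module.Basis.singleton (Fin 1) (Fn T)).map ((lineEquiv T).linearEquiv (Fn T)).symm) i := by
      intro i
      apply (lineEquiv T).injective
      rw [lineEquiv_comp, Equiv.apply_symm_apply, map_one, Module.Basis.map_apply,
        Module.Basis.singleton_apply]
      exact ((lineEquiv T).apply_symm_apply 1).symm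
    have h' := funext h
    refine ⟨?_, ?_⟩
    · rw [h']; exact Module.Basis.linearIndependent _
    · rw [h']; exact Module.Basis.span_eq _

/-- Points of a fibre product over `S`. -/
def prodEquiv {S : Scheme.{u}} (A B T : Over S) :
    (T ⟶ A ⨯ B) ≃ (T ⟶ A) × (T ⟶ B) where
  toFun x := (x ≫ prod.fst, x ≫ prod.snd)
  invFun x := prod.lift x.1 x.2
  left_inv _ := Limits.prod.hom_ext (prod.lift_fst _ _) (prod.lift_snd _ _)
  right_inv _ := Prod.ext (prod.lift_fst _ _) (prod.lift_snd _ _)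

lemma VectorBundle.comp_zero {S : Scheme.{u}} {n : ℕ} (V : VectorBundle S n) {T' T : Over S}
    (f : T' ⟶ T) : f ≫ (0 : T ⟶ V.tot) = 0 := by
  have h := V.comp_add f 0 0
  rw [add_zero] at h
  exact left_eq_add.mp h

/-- The direct sum `V ⊕ V'`; its total space is the fibre product of the total spaces over `S`. -/
def oplus {S : Scheme.{u}} {n n' : ℕ} (V : VectorBundle S n) (V' : VectorBundle S n') :
    VectorBundle S (n + n') where
  tot := V.tot ⨯ V'.tot
  addCommGroup T := (prodEquiv V.tot V'.tot T).addCommGroup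
  module T := letI := (prodEquiv V.tot V'.tot T).addCommGroup
    (prodEquiv V.tot V'.tot T).module (Fn T)
  comp_add {T' T} f x y := by
    apply (prodEquiv V.tot V'.tot T').injective
    change _ = prodEquiv _ _ T' ((prodEquiv _ _ T').symm (_ + _))
    rw [Equiv.apply_symm_apply]
    change prodEquiv _ _ T' (f ≫ (prodEquiv _ _ T).symm (_ + _)) = _
    simp [prodEquiv, VectorBundle.comp_add, prod.lift_fst, prod.lift_snd]
  comp_smul {T' T} f a x := by
    apply (prodEquiv V.tot V'.tot T').injective
    change _ = prodEquiv _ _ T' ((prodEquiv _ _ T').symm (_ • _))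
    rw [Equiv.apply_symm_apply]
    change prodEquiv _ _ T' (f ≫ (prodEquiv _ _ T).symm (_ • _)) = _
    simp [prodEquiv, VectorBundle.comp_smul, prod.lift_fst, prod.lift_snd]
  exists_frame s := by
    obtain ⟨U, hU, e, he⟩ := V.exists_frame s
    obtain ⟨U', hU', e', he'⟩ := V'.exists_frame s
    let r : Over.mk (U ⊓ U').ι ⟶ Over.mk U.ι := Over.homMk (S.homOfLE inf_le_left) (by simp)
    let r' : Over.mk (U ⊓ U').ι ⟶ Over.mk U'.ι := Over.homMk (S.homOfLE inf_le_right) (by simp)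
    let b : Fin n ⊕ Fin n' → (Over.mk (U ⊓ U').ι ⟶ V.tot ⨯ V'.tot) :=
      Sum.elim (fun i => prod.lift (r ≫ e i) 0) (fun j => prod.lift 0 (r' ≫ e' j))
    refine ⟨U ⊓ U', ⟨hU, hU'⟩, fun i => b (finSumFinEquiv.symm i), fun T f => ?_⟩
    let _ := (prodEquiv V.tot V'.tot T).addCommGroup
    let _ := (prodEquiv V.tot V'.tot T).module (Fn T)
    let B := Module.Basis.mk (he T (f ≫ r)).1 (he T (f ≫ r)).2.ge
    let B' := Module.Basis.mk (he' T (f ≫ r')).1 (he' T (f ≫ r')).2.ge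
    have h : ∀ i, f ≫ b (finSumFinEquiv.symm i) =
        (((B.prod B').map ((prodEquiv V.tot V'.tot T).linearEquiv (Fn T)).symm).reindex
          finSumFinEquiv) i := by
      intro i
      rw [Module.Basis.reindex_apply, Module.Basis.map_apply]
      apply (prodEquiv V.tot V'.tot T).injective
      refine Eq.trans ?_ ((prodEquiv V.tot V'.tot T).apply_symm_apply _).symm
      generalize finSumFinEquiv.symm i = k
      rcases k with k | k <;> simp [b, B, B', prodEquiv, VectorBundle.comp_zero,
        prod.lift_fst, prod.lift_snd]
    have h' := funext h
    refine ⟨?_, ?_⟩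
    · rw [h']; exact Module.Basis.linearIndependent _
    · rw [h']; exact Module.Basis.span_eq _

lemma comp_lift_id_zero {S : Scheme.{u}} {n n' : ℕ} (V : VectorBundle S n)
    (V' : VectorBundle S n') {T : Over S} (x : T ⟶ V.tot) :
    prodEquiv V.tot V'.tot T (x ≫ prod.lift (𝟙 _) 0) = (x, 0) := by
  simp [prodEquiv, prod.lift_fst, prod.lift_snd, VectorBundle.comp_zero]

lemma comp_lift_zero_id {S : Scheme.{u}} {n n' : ℕ} (V : VectorBundle S n)
    (V' : VectorBundle S n') {T : Over S} (x : T ⟶ V'.tot) :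
    prodEquiv V.tot V'.tot T (x ≫ prod.lift 0 (𝟙 _)) = (0, x) := by
  simp [prodEquiv, prod.lift_fst, prod.lift_snd, VectorBundle.comp_zero]

/-- The first projection of a direct sum. -/
def oplus.fst {S : Scheme.{u}} {n n' : ℕ} (V : VectorBundle S n) (V' : VectorBundle S n') :
    BundleHom (oplus V V') V where
  hom := (prod.fst : V.tot ⨯ V'.tot ⟶ V.tot)
  map_add _ _ _ := prod.lift_fst _ _
  map_smul _ _ _ := prod.lift_fst _ _

/-- The second projection of a direct sum. -/
def oplus.snd {S : Scheme.{u}} {n n' : ℕ} (V : VectorBundle S n) (V' : VectorBundle S n') :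
    BundleHom (oplus V V') V' where
  hom := (prod.snd : V.tot ⨯ V'.tot ⟶ V'.tot)
  map_add _ _ _ := prod.lift_snd _ _
  map_smul _ _ _ := prod.lift_snd _ _

/-- The first injection of a direct sum. -/
def oplus.inl {S : Scheme.{u}} {n n' : ℕ} (V : VectorBundle S n) (V' : VectorBundle S n') :
    BundleHom V (oplus V V') where
  hom := (prod.lift (𝟙 _) 0 : V.tot ⟶ V.tot ⨯ V'.tot)
  map_add T x y := by
    apply (prodEquiv V.tot V'.tot T).injective
    refine Eq.trans ?_ ((prodEquiv V.tot V'.tot T).apply_symm_apply _).symm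
    refine (comp_lift_id_zero V V' (x + y)).trans ?_
    refine Eq.trans ?_ (congrArg₂ (· + ·) (comp_lift_id_zero V V' x) (comp_lift_id_zero V V' y)).symm
    simp
  map_smul T a x := by
    apply (prodEquiv V.tot V'.tot T).injective
    refine Eq.trans ?_ ((prodEquiv V.tot V'.tot T).apply_symm_apply _).symm
    refine (comp_lift_id_zero V V' (a • x)).trans ?_
    refine Eq.trans ?_ (congrArg (a • ·) (comp_lift_id_zero V V' x)).symm
    simp

/-- The second injection of a direct sum. -/
def oplus.inr {S : Scheme.{u}} {n n' : ℕ} (V : VectorBundle S n) (V' : VectorBundle S n') :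
    BundleHom V' (oplus V V') where
  hom := (prod.lift 0 (𝟙 _) : V'.tot ⟶ V.tot ⨯ V'.tot)
  map_add T x y := by
    apply (prodEquiv V.tot V'.tot T).injective
    refine Eq.trans ?_ ((prodEquiv V.tot V'.tot T).apply_symm_apply _).symm
    refine (comp_lift_zero_id V V' (x + y)).trans ?_
    refine Eq.trans ?_ (congrArg₂ (· + ·) (comp_lift_zero_id V V' x) (comp_lift_zero_id V V' y)).symm
    simp
  map_smul T a x := by
    apply (prodEquiv V.tot V'.tot T).injective
    refine Eq.trans ?_ ((prodEquiv V.tot V'.tot T).apply_symm_apply _).symm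
    refine (comp_lift_zero_id V V' (a • x)).trans ?_
    refine Eq.trans ?_ (congrArg (a • ·) (comp_lift_zero_id V V' x)).symm
    simp

/-- Composition of morphisms of bundles. -/
def BundleHom.comp {S : Scheme.{u}} {n n' n'' : ℕ} {V : VectorBundle S n} {V' : VectorBundle S n'}
    {V'' : VectorBundle S n''} (g : BundleHom V V') (g' : BundleHom V' V'') : BundleHom V V'' where
  hom := g.hom ≫ g'.hom
  map_add T x y := by
    rw [← Category.assoc, g.map_add, g'.map_add, Category.assoc, Category.assoc]
  map_smul T a x := by
    rw [← Category.assoc, g.map_smul, g'.map_smul, Category.assoc]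

/-- An inclusion of `V` as a direct summand of `V'`: a linear morphism together with a linear
retraction. -/
structure SplitInclusion {S : Scheme.{u}} {n n' : ℕ} (V : VectorBundle S n)
    (V' : VectorBundle S n') where
  ι : BundleHom V V'
  ρ : BundleHom V' V
  ι_ρ : ι.hom ≫ ρ.hom = 𝟙 _

/-- `V` as a direct summand of `V ⊕ V'`. -/
def SplitInclusion.inl {S : Scheme.{u}} {n n' : ℕ} (V : VectorBundle S n)
    (V' : VectorBundle S n') : SplitInclusion V (oplus V V') where
  ι := oplus.inl V V'
  ρ := oplus.fst V V'
  ι_ρ := prod.lift_fst _ _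

/-- `V'` as a direct summand of `V ⊕ V'`. -/
def SplitInclusion.inr {S : Scheme.{u}} {n n' : ℕ} (V : VectorBundle S n)
    (V' : VectorBundle S n') : SplitInclusion V' (oplus V V') where
  ι := oplus.inr V V'
  ρ := oplus.snd V V'
  ι_ρ := prod.lift_snd _ _

/-- Composition of inclusions of direct summands. -/
def SplitInclusion.comp {S : Scheme.{u}} {n n' n'' : ℕ} {V : VectorBundle S n}
    {V' : VectorBundle S n'} {V'' : VectorBundle S n''} (j : SplitInclusion V V')
    (j' : SplitInclusion V' V'') : SplitInclusion V V'' where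
  ι := j.ι.comp j'.ι
  ρ := j'.ρ.comp j.ρ
  ι_ρ := by
    change (j.ι.hom ≫ j'.ι.hom) ≫ j'.ρ.hom ≫ j.ρ.hom = _
    rw [Category.assoc, ← Category.assoc j'.ι.hom, j'.ι_ρ, Category.id_comp, j.ι_ρ]

lemma prodEquiv_comp_map {S : Scheme.{u}} {A B B' T : Over S} (g : B ⟶ B') (x : T ⟶ A ⨯ B) :
    prodEquiv A B' T (x ≫ prod.map (𝟙 A) g) =
      ((prodEquiv A B T x).1, (prodEquiv A B T x).2 ≫ g) := by
  simp [prodEquiv]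

/-- The morphism `A ⊕ V ⟶ A ⊕ V'` induced by a morphism `V ⟶ V'`. -/
def oplus.mapRight {S : Scheme.{u}} {m n n' : ℕ} (A : VectorBundle S m) {V : VectorBundle S n}
    {V' : VectorBundle S n'} (g : BundleHom V V') : BundleHom (oplus A V) (oplus A V') where
  hom := (prod.map (𝟙 _) g.hom : A.tot ⨯ V.tot ⟶ A.tot ⨯ V'.tot)
  map_add T x y := by
    apply (prodEquiv A.tot V'.tot T).injective
    refine Eq.trans ?_ ((prodEquiv A.tot V'.tot T).apply_symm_apply _).symm
    refine (prodEquiv_comp_map g.hom _).trans ?_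
    refine Eq.trans ?_ (congrArg₂ (· + ·) (prodEquiv_comp_map g.hom _)
      (prodEquiv_comp_map g.hom _)).symm
    have h : prodEquiv A.tot V.tot T (x + y) = _ + _ :=
      (prodEquiv A.tot V.tot T).apply_symm_apply _
    rw [h, Prod.snd_add, g.map_add]
    rfl
  map_smul T a x := by
    apply (prodEquiv A.tot V'.tot T).injective
    refine Eq.trans ?_ ((prodEquiv A.tot V'.tot T).apply_symm_apply _).symm
    refine (prodEquiv_comp_map g.hom _).trans ?_
    refine Eq.trans ?_ (congrArg (a • ·) (prodEquiv_comp_map g.hom _)).symm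
    have h : prodEquiv A.tot V.tot T (a • x) = a • _ :=
      (prodEquiv A.tot V.tot T).apply_symm_apply _
    rw [h, Prod.smul_snd, g.map_smul]
    rfl

/-- `A ⊕ V` as a direct summand of `A ⊕ V'`, if `V` is a direct summand of `V'`. -/
def SplitInclusion.mapRight {S : Scheme.{u}} {m n n' : ℕ} (A : VectorBundle S m)
    {V : VectorBundle S n} {V' : VectorBundle S n'} (j : SplitInclusion V V') :
    SplitInclusion (oplus A V) (oplus A V') where
  ι := oplus.mapRight A j.ι
  ρ := oplus.mapRight A j.ρ
  ι_ρ := by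
    change prod.map (𝟙 _) j.ι.hom ≫ prod.map (𝟙 _) j.ρ.hom = 𝟙 (A.tot ⨯ V.tot)
    simp [j.ι_ρ]

/-! ### Subbundles and Grassmannian bundles -/

/-- A subbundle `W` of rank `k` of the pullback of `V` to the `S`-scheme `T`: for every `T' ⟶ T`
a submodule of the sections of `V` over `T'`, compatible with pullback, of local nature, and
locally free of rank `k` with local bases that remain bases after every base change. (So, locally,
`W` is the image of a morphism `𝒪ᵏ → V` which is injective after every base change.) -/
@[ext]
structure Subbundle {S : Scheme.{u}} {n : ℕ} (V : VectorBundle S n) (k : ℕ) (T : Over S) where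
  sec : ∀ {T' : Over S} (_ : T' ⟶ T), Submodule (Fn T') (T' ⟶ V.tot)
  comp_mem : ∀ {T'' T' : Over S} (g : T'' ⟶ T') (f : T' ⟶ T) (x : T' ⟶ V.tot),
    x ∈ sec f → g ≫ x ∈ sec (g ≫ f)
  mem_of_locally : ∀ {T' : Over S} (f : T' ⟶ T) (x : T' ⟶ V.tot),
    (∀ p : T'.left, ∃ U : T'.left.Opens, p ∈ U ∧ restrι T' U ≫ x ∈ sec (restrι T' U ≫ f)) →
      x ∈ sec f
  exists_frame : ∀ p : T.left, ∃ U : T.left.Opens, p ∈ U ∧ ∃ e : Fin k → (restr T U ⟶ V.tot),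
    ∀ (T' : Over S) (f : T' ⟶ restr T U), IsBasisOf (fun i => f ≫ e i) (sec (f ≫ restrι T U))

/-- The pullback of a subbundle along `g : T₁ ⟶ T`. -/
def Subbundle.pull {S : Scheme.{u}} {n : ℕ} {V : VectorBundle S n} {k : ℕ} {T T₁ : Over S}
    (W : Subbundle V k T) (g : T₁ ⟶ T) : Subbundle V k T₁ where
  sec f := W.sec (f ≫ g)
  comp_mem h f x hx := by
    rw [Category.assoc]
    exact W.comp_mem h (f ≫ g) x hx
  mem_of_locally f x h := W.mem_of_locally (f ≫ g) x (by simpa only [Category.assoc] using h)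
  exists_frame p := by
    obtain ⟨U, hU, e, he⟩ := W.exists_frame (g.left p)
    let r : restr T₁ (g.left ⁻¹ᵁ U) ⟶ restr T U := Over.homMk (g.left ∣_ U) (by simp)
    have hr : r ≫ restrι T U = restrι T₁ (g.left ⁻¹ᵁ U) ≫ g := by
      ext1
      simp [r]
    refine ⟨g.left ⁻¹ᵁ U, hU, fun i => r ≫ e i, fun T' f => ?_⟩
    have := he T' (f ≫ r)
    simp only [Category.assoc, hr] at this
    simpa only [Category.assoc] using this

/-- The image of a subbundle under the inclusion of a direct summand. -/
def Subbundle.map {S : Scheme.{u}} {n n' : ℕ} {V : VectorBundle S n} {V' : VectorBundle S n'}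
    {k : ℕ} {T : Over S} (W : Subbundle V k T) (j : SplitInclusion V V') : Subbundle V' k T where
  sec {T'} f := (W.sec f).map (j.ι.lin T')
  comp_mem g f x hx := by
    obtain ⟨w, hw, rfl⟩ := hx
    exact ⟨g ≫ w, W.comp_mem g f w hw, Category.assoc g w j.ι.hom⟩
  mem_of_locally {T'} f x h := by
    refine ⟨x ≫ j.ρ.hom, W.mem_of_locally f _ fun p => ?_, ?_⟩
    · obtain ⟨U, hU, w, hw, hwx⟩ := h p
      refine ⟨U, hU, ?_⟩
      have : restrι T' U ≫ x ≫ j.ρ.hom = w := by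
        rw [← Category.assoc, ← hwx]
        change (w ≫ j.ι.hom) ≫ j.ρ.hom = w
        rw [Category.assoc, j.ι_ρ, Category.comp_id]
      rw [this]
      exact hw
    · change (x ≫ j.ρ.hom) ≫ j.ι.hom = x
      choose U hU w hw hwx using h
      have hc : ∀ p, (U p).ι ≫ ((x ≫ j.ρ.hom) ≫ j.ι.hom).left = (U p).ι ≫ x.left := by
        intro p
        have h1 : w p ≫ j.ι.hom = restrι T' (U p) ≫ x := hwx p
        have h2 : restrι T' (U p) ≫ ((x ≫ j.ρ.hom) ≫ j.ι.hom) = restrι T' (U p) ≫ x := by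
          rw [Category.assoc, ← Category.assoc, ← h1, Category.assoc, ← Category.assoc j.ι.hom,
            j.ι_ρ, Category.id_comp]
        exact congrArg (fun z => z.left) h2
      ext1
      refine Scheme.Cover.hom_ext (T'.left.openCoverOfIsOpenCover U ?_) _ _ hc
      rw [TopologicalSpace.IsOpenCover, eq_top_iff]
      exact fun p _ => TopologicalSpace.Opens.mem_iSup.mpr ⟨p, hU p⟩
  exists_frame p := by
    obtain ⟨U, hU, e, he⟩ := W.exists_frame p
    refine ⟨U, hU, fun i => e i ≫ j.ι.hom, fun T' f => ?_⟩
    have h := he T' f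
    have hfun : (fun i => f ≫ e i ≫ j.ι.hom) = j.ι.lin T' ∘ fun i => f ≫ e i := by
      funext i
      exact (Category.assoc _ _ _).symm
    rw [hfun]
    refine ⟨h.1.map' _ (LinearMap.ker_eq_bot.mpr fun x y hxy => ?_), ?_⟩
    · have h' : (x ≫ j.ι.hom) ≫ j.ρ.hom = (y ≫ j.ι.hom) ≫ j.ρ.hom := congrArg (· ≫ j.ρ.hom) hxy
      simpa only [Category.assoc, j.ι_ρ, Category.comp_id] using h'
    · rw [Set.range_comp, ← Submodule.map_span, h.2]

/-- The functor of points of the Grassmannian bundle `Gr_S(k; V)` of rank `k` subbundles of `V`. -/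
def grFunctor {S : Scheme.{u}} {n : ℕ} (V : VectorBundle S n) (k : ℕ) :
    (Over S)ᵒᵖ ⥤ Type (u + 1) where
  obj T := Subbundle V k T.unop
  map g := ↾fun W => W.pull g.unop
  map_id T := by
    refine ConcreteCategory.hom_ext _ _ fun W => ?_
    apply Subbundle.ext
    funext T' f
    exact congrArg _ (Category.comp_id f)
  map_comp g h := by
    refine ConcreteCategory.hom_ext _ _ fun W => ?_
    apply Subbundle.ext
    funext T' f
    exact congrArg (fun q => W.sec q) (Category.assoc f h.unop g.unop).symm

/-- A Grassmannian bundle `Gr_S(k; V)`: an `S`-scheme representing the functor of rank `k`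
subbundles of `V`. -/
structure Gr {S : Scheme.{u}} {n : ℕ} (V : VectorBundle S n) (k : ℕ) where
  scheme : Over S
  rep : (grFunctor V k).RepresentableBy scheme

/-- The tautological subbundle on a Grassmannian bundle. -/
def Gr.taut {S : Scheme.{u}} {n : ℕ} {V : VectorBundle S n} {k : ℕ} (G : Gr V k) :
    Subbundle V k G.scheme :=
  G.rep.homEquiv (𝟙 _)

/-- The morphism `Gr_S(k; V) ⟶ Gr_S(k; V')` given by the inclusion of a direct summand `V ⊂ V'`. -/
def Gr.map {S : Scheme.{u}} {n n' : ℕ} {V : VectorBundle S n} {V' : VectorBundle S n'} {k : ℕ}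
    (G : Gr V k) (G' : Gr V' k) (j : SplitInclusion V V') : G.scheme ⟶ G'.scheme :=
  G'.rep.homEquiv.symm (G.taut.map j)

/-! ### Symplectic bundles and quaternionic Grassmannian bundles -/

/-- A symplectic form on a vector bundle: a bilinear alternating form, given on sections over all
`S`-schemes compatibly with pullback, which is nondegenerate at all field-valued points. -/
structure SymplecticForm {S : Scheme.{u}} {n : ℕ} (V : VectorBundle S n) where
  form : ∀ T : Over S, (T ⟶ V.tot) →ₗ[Fn T] (T ⟶ V.tot) →ₗ[Fn T] Fn T
  alt : ∀ (T : Over S) (x : T ⟶ V.tot), form T x x = 0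
  form_comp : ∀ {T' T : Over S} (f : T' ⟶ T) (x y : T ⟶ V.tot),
    form T' (f ≫ x) (f ≫ y) = Fn.pull f (form T x y)
  nondeg : ∀ (K : Type u) [Field K] (σ : Spec (.of K) ⟶ S) (x : Over.mk σ ⟶ V.tot),
    (∀ y, form _ x y = 0) → x = 0

/-- The form is nondegenerate on the subbundle `W`, i.e. at all field-valued points:
`W` is a symplectic subbundle. -/
def SymplecticForm.NondegOn {S : Scheme.{u}} {n : ℕ} {V : VectorBundle S n} (ω : SymplecticForm V)
    {k : ℕ} {T : Over S} (W : Subbundle V k T) : Prop :=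
  ∀ (K : Type u) [Field K] (σ : Spec (.of K) ⟶ S) (f : Over.mk σ ⟶ T), ∀ x ∈ W.sec f,
    (∀ y ∈ W.sec f, ω.form _ x y = 0) → x = 0

/-- The functor of points of the quaternionic Grassmannian bundle `HGr_S(r; V, ω)` of symplectic
subbundles of rank `2r`. -/
def hgrFunctor {S : Scheme.{u}} {n : ℕ} {V : VectorBundle S n} (ω : SymplecticForm V) (r : ℕ) :
    (Over S)ᵒᵖ ⥤ Type (u + 1) where
  obj T := {W : Subbundle V (2 * r) T.unop // ω.NondegOn W}
  map g := ↾fun W => ⟨W.1.pull g.unop, fun K _ σ f => W.2 K σ (f ≫ g.unop)⟩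
  map_id T := by
    refine ConcreteCategory.hom_ext _ _ fun W => ?_
    apply Subtype.ext
    apply Subbundle.ext
    funext T' f
    exact congrArg _ (Category.comp_id f)
  map_comp g h := by
    refine ConcreteCategory.hom_ext _ _ fun W => ?_
    apply Subtype.ext
    apply Subbundle.ext
    funext T' f
    exact congrArg (fun q => W.1.sec q) (Category.assoc f h.unop g.unop).symm

/-- A quaternionic Grassmannian bundle `HGr_S(r; V, ω)`: an `S`-scheme representing the functor of
symplectic subbundles of rank `2r`. -/
structure HGr {S : Scheme.{u}} {n : ℕ} {V : VectorBundle S n} (ω : SymplecticForm V) (r : ℕ) where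
  scheme : Over S
  rep : (hgrFunctor ω r).RepresentableBy scheme

/-- The tautological symplectic subbundle of rank `2r` on a quaternionic Grassmannian bundle. -/
def HGr.taut {S : Scheme.{u}} {n : ℕ} {V : VectorBundle S n} {ω : SymplecticForm V} {r : ℕ}
    (H : HGr ω r) : Subbundle V (2 * r) H.scheme :=
  (H.rep.homEquiv (𝟙 _)).1

/-- The canonical morphism `HGr_S(r; V, ω) ⟶ Gr_S(2r; V)`. -/
def HGr.toGr {S : Scheme.{u}} {n : ℕ} {V : VectorBundle S n} {ω : SymplecticForm V} {r : ℕ}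
    (H : HGr ω r) (G : Gr V (2 * r)) : H.scheme ⟶ G.scheme :=
  G.rep.homEquiv.symm H.taut

/-! ### The symplectic bundle `F = 𝒪 ⊕ E ⊕ 𝒪` -/

/-- The bundle `F = 𝒪 ⊕ E ⊕ 𝒪`. -/
abbrev extBundle {S : Scheme.{u}} {n : ℕ} (E : VectorBundle S n) : VectorBundle S (1 + (n + 1)) :=
  oplus (trivialLine S) (oplus E (trivialLine S))

/-- Sections of the trivial line bundle are functions. -/
def lineLin {S : Scheme.{u}} (T : Over S) : (T ⟶ (trivialLine S).tot) ≃ₗ[Fn T] Fn T :=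
  letI := (lineEquiv T).addCommGroup
  letI := (lineEquiv T).module (Fn T)
  (lineEquiv T).linearEquiv (Fn T)


/-- The inclusion of `E` as the middle summand of `F`. -/
def inclE {S : Scheme.{u}} {n : ℕ} (E : VectorBundle S n) : SplitInclusion E (extBundle E) :=
  (SplitInclusion.inl E (trivialLine S)).comp (SplitInclusion.inr (trivialLine S) _)

/-- The inclusion `𝒪 ⊕ E ⊂ F`. -/
def inclPlus {S : Scheme.{u}} {n : ℕ} (E : VectorBundle S n) :
    SplitInclusion (oplus (trivialLine S) E) (extBundle E) :=
  SplitInclusion.mapRight (trivialLine S) (SplitInclusion.inl E (trivialLine S))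

/-- The inclusion `E ⊕ 𝒪 ⊂ F`. -/
def inclMinus {S : Scheme.{u}} {n : ℕ} (E : VectorBundle S n) :
    SplitInclusion (oplus E (trivialLine S)) (extBundle E) :=
  SplitInclusion.inr (trivialLine S) _

/-- The first coordinate of a section of `F = 𝒪 ⊕ E ⊕ 𝒪`. -/
def coordL {S : Scheme.{u}} {n : ℕ} (E : VectorBundle S n) (T : Over S) :
    (T ⟶ (extBundle E).tot) →ₗ[Fn T] Fn T :=
  (lineLin T).toLinearMap ∘ₗ (oplus.fst (trivialLine S) (oplus E (trivialLine S))).lin T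

/-- The component in `E` of a section of `F = 𝒪 ⊕ E ⊕ 𝒪`. -/
def coordE {S : Scheme.{u}} {n : ℕ} (E : VectorBundle S n) (T : Over S) :
    (T ⟶ (extBundle E).tot) →ₗ[Fn T] (T ⟶ E.tot) :=
  (oplus.fst E (trivialLine S)).lin T ∘ₗ
    (oplus.snd (trivialLine S) (oplus E (trivialLine S))).lin T

/-- The last coordinate of a section of `F = 𝒪 ⊕ E ⊕ 𝒪`. -/
def coordR {S : Scheme.{u}} {n : ℕ} (E : VectorBundle S n) (T : Over S) :
    (T ⟶ (extBundle E).tot) →ₗ[Fn T] Fn T :=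
  (lineLin T).toLinearMap ∘ₗ (oplus.snd E (trivialLine S)).lin T ∘ₗ
    (oplus.snd (trivialLine S) (oplus E (trivialLine S))).lin T

/-- The section of `F = 𝒪 ⊕ E ⊕ 𝒪` with given components. -/
def vec {S : Scheme.{u}} {n : ℕ} {E : VectorBundle S n} {T : Over S} (a : Fn T) (x : T ⟶ E.tot)
    (b : Fn T) : T ⟶ (extBundle E).tot :=
  (prod.lift ((lineLin T).symm a) (prod.lift x ((lineLin T).symm b)) :
    T ⟶ (trivialLine S).tot ⨯ (E.tot ⨯ (trivialLine S).tot))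

@[simp]
lemma coordL_vec {S : Scheme.{u}} {n : ℕ} {E : VectorBundle S n} {T : Over S} (a : Fn T)
    (x : T ⟶ E.tot) (b : Fn T) : coordL E T (vec a x b) = a := by
  have h := prod.lift_fst ((lineLin T).symm a) (prod.lift x ((lineLin T).symm b))
  exact (congrArg (lineLin T) h).trans ((lineLin T).apply_symm_apply a)

@[simp]
lemma coordE_vec {S : Scheme.{u}} {n : ℕ} {E : VectorBundle S n} {T : Over S} (a : Fn T)
    (x : T ⟶ E.tot) (b : Fn T) : coordE E T (vec a x b) = x := by
  have h := prod.lift_snd ((lineLin T).symm a) (prod.lift x ((lineLin T).symm b))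
  exact (congrArg (· ≫ prod.fst) h).trans (prod.lift_fst _ _)

@[simp]
lemma coordR_vec {S : Scheme.{u}} {n : ℕ} {E : VectorBundle S n} {T : Over S} (a : Fn T)
    (x : T ⟶ E.tot) (b : Fn T) : coordR E T (vec a x b) = b := by
  have h := prod.lift_snd ((lineLin T).symm a) (prod.lift x ((lineLin T).symm b))
  exact (congrArg (lineLin T) ((congrArg (· ≫ prod.snd) h).trans (prod.lift_snd _ _))).trans
    ((lineLin T).apply_symm_apply b)

lemma vec_ext {S : Scheme.{u}} {n : ℕ} {E : VectorBundle S n} {T : Over S}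
    {y y' : T ⟶ (extBundle E).tot} (hL : coordL E T y = coordL E T y')
    (hE : coordE E T y = coordE E T y') (hR : coordR E T y = coordR E T y') : y = y' := by
  refine Limits.prod.hom_ext ((lineLin T).injective hL) ?_
  exact Limits.prod.hom_ext hE ((lineLin T).injective hR)

lemma coordL_comp {S : Scheme.{u}} {n : ℕ} (E : VectorBundle S n) {T' T : Over S} (f : T' ⟶ T)
    (y : T ⟶ (extBundle E).tot) : coordL E T' (f ≫ y) = Fn.pull f (coordL E T y) :=
  (congrArg (lineEquiv T') (Category.assoc _ _ _)).trans (lineEquiv_comp f _)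

lemma coordE_comp {S : Scheme.{u}} {n : ℕ} (E : VectorBundle S n) {T' T : Over S} (f : T' ⟶ T)
    (y : T ⟶ (extBundle E).tot) : coordE E T' (f ≫ y) = f ≫ coordE E T y :=
  (congrArg ((oplus.fst E (trivialLine S)).lin T') (BundleHom.lin_comp _ f y)).trans
    (BundleHom.lin_comp _ f _)

lemma coordR_comp {S : Scheme.{u}} {n : ℕ} (E : VectorBundle S n) {T' T : Over S} (f : T' ⟶ T)
    (y : T ⟶ (extBundle E).tot) : coordR E T' (f ≫ y) = Fn.pull f (coordR E T y) :=
  (congrArg (lineEquiv T') ((congrArg (· ≫ prod.snd) (Category.assoc _ _ _)).trans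
    (Category.assoc _ _ _))).trans (lineEquiv_comp f _)

/-- The symplectic form `ψ` on `F = 𝒪 ⊕ E ⊕ 𝒪` with matrix `(0 0 1; 0 φ 0; -1 0 0)`. -/
def extForm {S : Scheme.{u}} {n : ℕ} {E : VectorBundle S n} (φ : SymplecticForm E) :
    SymplecticForm (extBundle E) where
  form T := LinearMap.mk₂ (Fn T)
    (fun y z => coordL E T y * coordR E T z + φ.form T (coordE E T y) (coordE E T z)
      - coordR E T y * coordL E T z)
    (fun y y' z => by simp only [map_add, LinearMap.add_apply]; ring)
    (fun a y z => by simp only [map_smul, LinearMap.smul_apply, smul_eq_mul]; ring)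
    (fun y z z' => by simp only [map_add]; ring)
    (fun a y z => by simp only [map_smul, smul_eq_mul]; ring)
  alt T y := by
    rw [LinearMap.mk₂_apply, φ.alt]
    ring
  form_comp f y z := by
    simp only [LinearMap.mk₂_apply, coordL_comp, coordE_comp, coordR_comp, φ.form_comp, map_sub,
      map_add, map_mul]
  nondeg K _ σ y h := by
    simp only [LinearMap.mk₂_apply] at h
    refine vec_ext ?_ ?_ ?_
    · simpa using h (vec 0 0 1)
    · rw [map_zero]
      refine φ.nondeg K σ _ fun x => ?_
      simpa using h (vec 0 x 0)
    · simpa using h (vec 1 0 0)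

lemma nondegOn_map_inclE {S : Scheme.{u}} {n : ℕ} {E : VectorBundle S n} (φ : SymplecticForm E)
    {k : ℕ} {T : Over S} (W : Subbundle E k T) (h : φ.NondegOn W) :
    (extForm φ).NondegOn (W.map (inclE E)) := by
  have key : ∀ (T' : Over S) (x : T' ⟶ E.tot), (inclE E).ι.lin T' x = vec 0 x 0 := by
    intro T' x
    have h₁ : (inclE E).ι.lin T' x = (oplus.inr (trivialLine S) (oplus E (trivialLine S))).lin T'
        ((oplus.inl E (trivialLine S)).lin T' x) := (Category.assoc x _ _).symm
    have h₂ := comp_lift_zero_id (trivialLine S) (oplus E (trivialLine S))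
      ((oplus.inl E (trivialLine S)).lin T' x)
    have h₃ := comp_lift_id_zero E (trivialLine S) x
    rw [h₁]
    refine Limits.prod.hom_ext ?_ (Limits.prod.hom_ext ?_ ?_)
    · refine (congrArg Prod.fst h₂).trans (Eq.trans ?_ (prod.lift_fst _ _).symm)
      exact (map_zero (lineLin T').symm).symm
    · refine (congrArg (· ≫ prod.fst) (congrArg Prod.snd h₂)).trans ?_
      refine (congrArg Prod.fst h₃).trans ?_
      refine Eq.trans ?_ (congrArg (· ≫ prod.fst) (prod.lift_snd _ _)).symm
      exact (prod.lift_fst _ _).symm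
    · refine (congrArg (· ≫ prod.snd) (congrArg Prod.snd h₂)).trans ?_
      refine (congrArg Prod.snd h₃).trans ?_
      refine Eq.trans ?_ (congrArg (· ≫ prod.snd) (prod.lift_snd _ _)).symm
      refine Eq.trans ?_ (prod.lift_snd _ _).symm
      exact (map_zero (lineLin T').symm).symm
  rintro K _ σ f _ ⟨x, hx, rfl⟩ hy
  rw [key] at hy ⊢
  have hx0 : x = 0 := by
    refine h K σ f x hx fun y hy' => ?_
    have := hy (vec 0 y 0) ⟨y, hy', key _ y⟩
    simpa [extForm] using this
  rw [← key, hx0, map_zero]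

/-- The embedding `HGr_S(r; E, φ) ⟶ HGr_S(r; F, ψ)`, which sends a symplectic subbundle of `E` to
the same subbundle regarded as a subbundle of `F = 𝒪 ⊕ E ⊕ 𝒪`. -/
def HGr.emb {S : Scheme.{u}} {n : ℕ} {E : VectorBundle S n} {φ : SymplecticForm E} {r : ℕ}
    (H : HGr φ r) (H' : HGr (extForm φ) r) : H.scheme ⟶ H'.scheme :=
  H'.rep.homEquiv.symm
    ⟨H.taut.map (inclE E), nondegOn_map_inclE φ H.taut (H.rep.homEquiv (𝟙 _)).2⟩

/-! ### Normal bundles -/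

/-- A section over the `Z`-scheme `g : T ⟶ Z` of the normal sheaf of a closed immersion `i : Z ⟶ X`
with ideal sheaf `I`: an `𝒪_X`-linear morphism `I ⟶ (g ≫ i)_* 𝒪_T`, given on the affine open
subschemes of `X`. These are the `𝒪_T`-linear morphisms `g^*(I / I²) ⟶ 𝒪_T`. -/
@[ext]
structure NormalVector {Z X : Scheme.{u}} (i : Z ⟶ X) (T : Over Z) where
  app : ∀ U : X.affineOpens, i.ker.ideal U → Γ(T.left, (T.hom ≫ i) ⁻¹ᵁ U.1)
  map_add : ∀ (U : X.affineOpens) (x y : i.ker.ideal U), app U (x + y) = app U x + app U y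
  map_smul : ∀ (U : X.affineOpens) (a : Γ(X, U.1)) (x : i.ker.ideal U),
    app U (a • x) = (T.hom ≫ i).app U.1 a * app U x
  map_res : ∀ (U V : X.affineOpens) (h : V.1 ≤ U.1) (x : i.ker.ideal U) (y : i.ker.ideal V),
    X.presheaf.map (homOfLE h).op x.1 = y.1 →
      app V y = T.left.presheaf.map (homOfLE ((T.hom ≫ i).preimage_mono h)).op (app U x)

lemma preimage_le_of_over {Z X : Scheme.{u}} (i : Z ⟶ X) {T' T : Over Z} (f : T' ⟶ T)
    (U : X.Opens) : (T'.hom ≫ i) ⁻¹ᵁ U ≤ f.left ⁻¹ᵁ ((T.hom ≫ i) ⁻¹ᵁ U) := by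
  rw [← Over.w f, Category.assoc]
  exact le_rfl

/-- An identification of the vector bundle `N` over `Z` with the normal bundle of the closed
immersion `i : Z ⟶ X`: linear isomorphisms, compatible with pullback, of the sections of `N` with
the sections of the normal sheaf `Hom(I / I², 𝒪)` over all `Z`-schemes. -/
structure NormalBundleIso {Z X : Scheme.{u}} (i : Z ⟶ X) {k : ℕ} (N : VectorBundle Z k) where
  equiv : ∀ T : Over Z, (T ⟶ N.tot) ≃ NormalVector i T
  map_add : ∀ (T : Over Z) (x y : T ⟶ N.tot) (U : X.affineOpens) (a : i.ker.ideal U),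
    (equiv T (x + y)).app U a = (equiv T x).app U a + (equiv T y).app U a
  map_smul : ∀ (T : Over Z) (c : Fn T) (x : T ⟶ N.tot) (U : X.affineOpens) (a : i.ker.ideal U),
    (equiv T (c • x)).app U a =
      T.left.presheaf.map (homOfLE le_top).op c * (equiv T x).app U a
  naturality : ∀ {T' T : Over Z} (f : T' ⟶ T) (x : T ⟶ N.tot) (U : X.affineOpens)
    (a : i.ker.ideal U), (equiv T' (f ≫ x)).app U a =
      f.left.appLE _ _ (preimage_le_of_over i f U.1) ((equiv T x).app U a)

/-! ### Dual numbers, tangent vectors and transversality -/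

/-- The ring `A[ε]` of dual numbers. -/
abbrev dualRing (A : CommRingCat.{u}) : CommRingCat.{u} := .of (DualNumber A)

/-- The `S`-scheme `Spec A[ε]`, for an `S`-scheme `Spec A`. -/
abbrev dualOver {S : Scheme.{u}} {A : CommRingCat.{u}} (σ : Spec A ⟶ S) : Over S :=
  Over.mk (Spec.map (CommRingCat.ofHom (TrivSqZeroExt.inlHom A A) : A ⟶ dualRing A) ≫ σ)

/-- The projection `Spec A[ε] ⟶ Spec A`. -/
def dualProj {S : Scheme.{u}} {A : CommRingCat.{u}} (σ : Spec A ⟶ S) :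
    dualOver σ ⟶ Over.mk σ :=
  Over.homMk (Spec.map (CommRingCat.ofHom (TrivSqZeroExt.inlHom A A) : A ⟶ dualRing A)) rfl

/-- The closed immersion `Spec A ⟶ Spec A[ε]` with equation `ε = 0`. -/
def dualZero {S : Scheme.{u}} {A : CommRingCat.{u}} (σ : Spec A ⟶ S) :
    Over.mk σ ⟶ dualOver σ :=
  Over.homMk (Spec.map (CommRingCat.ofHom (TrivSqZeroExt.fstHom A A A).toRingHom : dualRing A ⟶ A))
    (by
      change Spec.map _ ≫ Spec.map _ ≫ σ = σ
      rw [← Category.assoc, ← Spec.map_comp, ← CommRingCat.ofHom_comp]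
      have : (TrivSqZeroExt.fstHom A A A).toRingHom.comp (TrivSqZeroExt.inlHom A A) =
          RingHom.id A := by ext; rfl
      rw [this, CommRingCat.ofHom_id, Spec.map_id, Category.id_comp])

/-- The function `ε` on `Spec A[ε]`. -/
def dualEps {S : Scheme.{u}} {A : CommRingCat.{u}} (σ : Spec A ⟶ S) : Fn (dualOver σ) :=
  (Scheme.ΓSpecIso (dualRing A)).inv (DualNumber.eps : DualNumber A)

/-- The section `s` of the subbundle `W` over the `S`-scheme `X` meets the zero section
transversally in `z : Z ⟶ X`: the scheme `X` is smooth over `S`, `Z` is the closed subscheme of zeros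
of `s` (a morphism to `X` factors through `Z` iff it pulls `s` back to `0`), and at every
field-valued zero `x` of `s` the differential of `s`, from the tangent space of `X` over `S` at `x`
to the fibre of `W` at `x`, is surjective. A tangent vector at `x` is a lift of `x` to the dual
numbers, along which `s` takes a value `ε v` with `v` the value of the differential. -/
structure MeetsZeroTransversally {S : Scheme.{u}} {n : ℕ} {V : VectorBundle S n} {k : ℕ}
    {X : Over S} (W : Subbundle V k X) (s : X ⟶ V.tot) {Z : Over S} (z : Z ⟶ X) : Prop where
  mem : s ∈ W.sec (𝟙 X)
  smooth : Smooth X.hom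
  isClosedImmersion : IsClosedImmersion z.left
  zero_iff : ∀ {T : Over S} (f : T ⟶ X), f ≫ s = 0 ↔ ∃ g : T ⟶ Z, g ≫ z = f
  differential_surjective : ∀ (K : Type u) [Field K] (σ : Spec (.of K) ⟶ S) (x : Over.mk σ ⟶ X),
    x ≫ s = 0 → ∀ v ∈ W.sec x, ∃ x' : dualOver σ ⟶ X,
      dualZero σ ≫ x' = x ∧ x' ≫ s = dualEps σ • (dualProj σ ≫ v)

/-! ### Comparison of bundles -/

/-- A linear isomorphism of subbundles over the same `S`-scheme `T`. -/
structure SubbundleIso {S : Scheme.{u}} {n n' : ℕ} {V : VectorBundle S n} {V' : VectorBundle S n'}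
    {k k' : ℕ} {T : Over S} (W : Subbundle V k T) (W' : Subbundle V' k' T) where
  equiv : ∀ {T' : Over S} (f : T' ⟶ T), W.sec f ≃ₗ[Fn T'] W'.sec f
  naturality : ∀ {T'' T' : Over S} (g : T'' ⟶ T') (f : T' ⟶ T) (x : W.sec f),
    (equiv (g ≫ f) ⟨g ≫ x.1, W.comp_mem g f x.1 x.2⟩).1 = g ≫ (equiv f x).1

/-- A `Z`-scheme, regarded as an `S`-scheme, for an `S`-scheme `Z`. -/
abbrev toBase {S : Scheme.{u}} (Z : Over S) (T : Over Z.left) : Over S :=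
  Over.mk (T.hom ≫ Z.hom)

/-- A morphism of `Z`-schemes, regarded as a morphism of `S`-schemes. -/
abbrev toBaseMap {S : Scheme.{u}} (Z : Over S) {T' T : Over Z.left} (f : T' ⟶ T) :
    toBase Z T' ⟶ toBase Z T :=
  Over.homMk f.left (by simp)

/-- The structural morphism of a `Z`-scheme, as a morphism of `S`-schemes. -/
abbrev toBaseStr {S : Scheme.{u}} (Z : Over S) (T : Over Z.left) : toBase Z T ⟶ Z :=
  Over.homMk T.hom rfl

/-- A linear isomorphism between a subbundle `P` of a bundle `N` over `Z` and a subbundle `W` over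
`Z` of (the pullback to `Z` of) a bundle over `S`. -/
structure BaseIso {S : Scheme.{u}} {Z : Over S} {m n : ℕ} {N : VectorBundle Z.left m}
    {V : VectorBundle S n} {k k' : ℕ} (P : Subbundle N k (Over.mk (𝟙 Z.left)))
    (W : Subbundle V k' Z) where
  equiv : ∀ T : Over Z.left, P.sec (Over.mkIdTerminal.from T) ≃ₗ[Γ(T.left, ⊤)]
    W.sec (toBaseStr Z T)
  naturality : ∀ {T' T : Over Z.left} (f : T' ⟶ T) (x : P.sec (Over.mkIdTerminal.from T))
    (x' : P.sec (Over.mkIdTerminal.from T')), f ≫ x.1 = x'.1 →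
      (equiv T' x').1 = toBaseMap Z f ≫ (equiv T x).1

/-! ### The geometry of `HGr(E)` in `HGr(F)` -/

/-- The intersection `HGr_S(r; V, ω) ∩ Gr_S(2r; D)` in `Gr_S(2r; V)`, for a direct summand `D` of `V`:
the fibre product over `Gr_S(2r; V)`. -/
abbrev HGr.inter {S : Scheme.{u}} {n m : ℕ} {V : VectorBundle S n} {ω : SymplecticForm V} {r : ℕ}
    {D : VectorBundle S m} (H : HGr ω r) (G : Gr V (2 * r)) (G' : Gr D (2 * r))
    (d : SplitInclusion D V) : Over S :=
  pullback (H.toGr G) (G'.map G d)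

/-- The inclusion of the intersection `HGr_S(r; V, ω) ∩ Gr_S(2r; D)` in `HGr_S(r; V, ω)`. -/
abbrev HGr.interι {S : Scheme.{u}} {n m : ℕ} {V : VectorBundle S n} {ω : SymplecticForm V} {r : ℕ}
    {D : VectorBundle S m} (H : HGr ω r) (G : Gr V (2 * r)) (G' : Gr D (2 * r))
    (d : SplitInclusion D V) : H.inter G G' d ⟶ H.scheme :=
  pullback.fst (H.toGr G) (G'.map G d)

/-- Let `i : Z ⟶ X` be an embedding with normal bundle `N` (by means of `ν`), let `o : X ⟶ G` be an
open embedding and let `j : N ⟶ G` be a morphism. The morphism `j` induces the identity on normal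
bundles along the zero section: for every section `x` of `N` over an affine scheme `Spec A`, the
`A[ε]`-point `j(ε x)` of `X` is the first order deformation with normal vector `x`, i.e. a function
`a` vanishing on `Z` has there the value `ε x(a)`. -/
def InducesIdOnNormal {S : Scheme.{u}} {Z X G : Over S} {i : Z ⟶ X} {k : ℕ}
    {N : VectorBundle Z.left k} (ν : NormalBundleIso i.left N) (o : X ⟶ G)
    (j : toBase Z N.tot ⟶ G) : Prop :=
  ∀ (A : CommRingCat.{u}) (g : Spec A ⟶ Z.left) (x : Over.mk g ⟶ N.tot)
    (y : toBase Z (dualOver g) ⟶ X),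
    y ≫ o = toBaseMap Z (dualEps g • (dualProj g ≫ x) : dualOver g ⟶ N.tot) ≫ j →
    ∀ (U : X.left.affineOpens) (hy : ⊤ ≤ y.left ⁻¹ᵁ U.1) (hg : ⊤ ≤ (g ≫ i.left) ⁻¹ᵁ U.1)
      (a : i.left.ker.ideal U),
      y.left.appLE U.1 ⊤ hy a.1 = dualEps g * Fn.pull (dualProj g)
        ((Spec A).presheaf.map (homOfLE hg).op ((ν.equiv (Over.mk g) x).app U a))

end SymplecticGrassmannian
end

open SymplecticGrassmannian

noncomputable section

namespace SymplecticGrassmannian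

/-! ### Morphisms of `S`-schemes are local on the source -/

section Local

variable {S : Scheme.{u}}

/-! Everything is read off the functors of points. Let `U ⊂ F` be a subbundle of rank `2r` on which
the form `(u, u') ↦ φ(u_E, u'_E)` (`midForm`) is nondegenerate. Then `U` projects isomorphically
onto a symplectic subbundle `W` of `E`, the two outer coordinates of `U` are functionals on `W`, and
nondegeneracy of `φ` writes them uniquely as `φ(a, ·)` and `φ(b, ·)` with `a`, `b` in `W`. So `U` is
the graph of `w ↦ (φ(a, w), w, φ(b, w))`, and it determines `W`, `a`, `b` (`exists_graph_eq`,
`eq_of_graph_eq`). The condition on `U` is open, so an open subscheme of `Gr(2r; F)` represents the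
triples `(W, a, b)`: it is the total space of `𝒰_E ⊕ 𝒰_E` over `HGr(E)` (`normalEquiv`,
`normalBundle`). Its inclusion is `j`, and `a = b = 0` is the zero section.

If an outer coordinate vanishes on `U`, then `ψ` and `midForm` agree on `U`
(`EdgeCoordinate.VanishesOn.nondegOn_iff`). Hence `N⁺` and `N⁻` lie in the graph locus, where they
are given by `b = 0` and `a = 0`; they are two copies of `𝒰_E`, and the projection of the graph to
`W` is an isometry. They meet where `a = b = 0`.

For transversality, `ψ` represents an outer coordinate `c` on `𝒰_F` by a section `s`
(`BilForm.NondegOn.exists_dual`), which vanishes exactly where `c` vanishes on `𝒰_F`. At a zero, the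
deformation of the subspace by `u ↦ u + ε ψ(v, u) t`, with `c(t) = 1`, moves `s` to `ε v`
(`exists_deformation`).

That `N` is the normal bundle is checked on generators. Locally the ideal of `HGr(E)` in `HGr(F)` is
generated by the outer coordinates of a frame `e` of `𝒰_F` (`OuterChart.span_fn`). The first order
deformation `j(ε x)`, with `x = (a, b)`, gives these generators the values `ε φ(a, e_k)` and `ε φ(b,
e_k)` (`OuterChart.val_toNormalVector`), and by nondegeneracy every system of values comes from
exactly one pair (`OuterChart.existsUnique_section`).

Existence of the Grassmannians is Zariski gluing: the functor of subbundles is a sheaf covered by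
affine spaces (`exists_representableBy`, `exists_chart_mem`), and nondegeneracy is locally the
nonvanishing of a determinant, so `HGr` is open in `Gr`. -/

lemma range_subset_of_mem {X Y : Scheme.{u}} (f : X ⟶ Y) (U : Y.Opens) (h : ∀ p, f p ∈ U) :
    Set.range f ⊆ Set.range U.ι := by
  rintro _ ⟨p, rfl⟩
  rw [Scheme.Opens.range_ι]
  exact h p

/-- The factorization of a morphism through an open subscheme containing its image. -/
def liftRestr {T' T : Over S} (f : T' ⟶ T) (U : T.left.Opens) (h : ∀ p, f.left p ∈ U) :
    T' ⟶ restr T U :=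
  Over.homMk (IsOpenImmersion.lift U.ι f.left (range_subset_of_mem f.left U h))
    ((Category.assoc _ _ _).symm.trans
      ((congrArg (· ≫ T.hom) (IsOpenImmersion.lift_fac _ _ _)).trans (Over.w f)))

@[simp]
lemma liftRestr_restrι {T' T : Over S} (f : T' ⟶ T) (U : T.left.Opens) (h : ∀ p, f.left p ∈ U) :
    liftRestr f U h ≫ restrι T U = f := by
  ext1
  exact IsOpenImmersion.lift_fac _ _ _

lemma restrι_cancel {T' T : Over S} {U : T.left.Opens} {a b : T' ⟶ restr T U}
    (h : a ≫ restrι T U = b ≫ restrι T U) : a = b := by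
  ext1
  rw [← cancel_mono U.ι]
  exact congrArg (fun z => z.left) h

lemma comp_restrι_mem {T' T : Over S} {U : T.left.Opens} (a : T' ⟶ restr T U) (p : T'.left) :
    (a ≫ restrι T U).left p ∈ U := by
  change U.ι (a.left p) ∈ U
  exact (a.left p).2

lemma openCover_of_nhds {X : Scheme.{u}} (U : X → X.Opens) (hU : ∀ p, p ∈ U p) :
    TopologicalSpace.IsOpenCover U := by
  rw [TopologicalSpace.IsOpenCover, eq_top_iff]
  exact fun p _ => TopologicalSpace.Opens.mem_iSup.mpr ⟨p, hU p⟩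

lemma hom_ext_of_locally {T X : Over S} {x y : T ⟶ X}
    (h : ∀ p : T.left, ∃ U : T.left.Opens, p ∈ U ∧ restrι T U ≫ x = restrι T U ≫ y) : x = y := by
  choose U hU hx using h
  ext1
  refine Scheme.Cover.hom_ext (T.left.openCoverOfIsOpenCover U (openCover_of_nhds U hU)) _ _ ?_
  exact fun p => congrArg (fun z => z.left) (hx p)

/-- Compatibility is assumed on every common test object `T'`, the form in which uniqueness of a
locally characterized morphism provides it. Only the fibre products of members of the cover are
used. -/
lemma exists_glue {T X : Over S} (U : T.left → T.left.Opens) (hU : ∀ p, p ∈ U p)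
    (x : ∀ p, restr T (U p) ⟶ X)
    (hx : ∀ (p q) (T' : Over S) (a : T' ⟶ restr T (U p)) (b : T' ⟶ restr T (U q)),
      a ≫ restrι T (U p) = b ≫ restrι T (U q) → a ≫ x p = b ≫ x q) :
    ∃ y : T ⟶ X, ∀ p, restrι T (U p) ≫ y = x p := by
  let 𝒰 := T.left.openCoverOfIsOpenCover U (openCover_of_nhds U hU)
  have hc : ∀ p q : T.left, pullback.fst (𝒰.f p) (𝒰.f q) ≫ (x p).left =
      pullback.snd (𝒰.f p) (𝒰.f q) ≫ (x q).left := by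
    intro p q
    let a : Over.mk (pullback.fst (𝒰.f p) (𝒰.f q) ≫ (U p).ι ≫ T.hom) ⟶ restr T (U p) :=
      Over.homMk (pullback.fst (𝒰.f p) (𝒰.f q)) rfl
    let b : Over.mk (pullback.fst (𝒰.f p) (𝒰.f q) ≫ (U p).ι ≫ T.hom) ⟶ restr T (U q) :=
      Over.homMk (pullback.snd (𝒰.f p) (𝒰.f q)) (by
        change _ ≫ (U q).ι ≫ T.hom = _ ≫ (U p).ι ≫ T.hom
        have := pullback.condition (f := 𝒰.f p) (g := 𝒰.f q)
        exact (Category.assoc _ _ _).symm.trans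
          ((congrArg (· ≫ T.hom) this.symm).trans (Category.assoc _ _ _)))
    exact congrArg (fun z => z.left) (hx p q _ a b (by
      ext1
      exact pullback.condition (f := 𝒰.f p) (g := 𝒰.f q)))
  have hl : ∀ p, (U p).ι ≫ 𝒰.glueMorphisms (fun p => (x p).left) hc = (x p).left :=
    fun p => 𝒰.ι_glueMorphisms _ hc p
  refine ⟨Over.homMk (𝒰.glueMorphisms (fun p => (x p).left) hc) ?_, fun p => ?_⟩
  · refine Scheme.Cover.hom_ext 𝒰 _ _ fun p => ?_
    exact (Category.assoc _ _ _).symm.trans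
      ((congrArg (· ≫ X.hom) (hl p)).trans (Over.w (x p)))
  · ext1
    exact hl p

/-- A morphism which is locally characterized by a property exists globally. -/
lemma exists_of_locally {T X : Over S} (P : ∀ {T' : Over S}, (T' ⟶ T) → (T' ⟶ X) → Prop)
    (hP : ∀ {T'' T' : Over S} (g : T'' ⟶ T') (f : T' ⟶ T) (x : T' ⟶ X), P f x → P (g ≫ f) (g ≫ x))
    (huniq : ∀ {T' : Over S} (f : T' ⟶ T) (x y : T' ⟶ X), P f x → P f y → x = y)
    (hex : ∀ p : T.left, ∃ U : T.left.Opens, p ∈ U ∧ ∃ x, P (restrι T U) x) :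
    ∃ x : T ⟶ X, ∀ p : T.left, ∃ U : T.left.Opens, p ∈ U ∧ P (restrι T U) (restrι T U ≫ x) := by
  choose U hU x hx using hex
  -- On an overlap both restrictions satisfy `P`, which has at most one solution.
  obtain ⟨y, hy⟩ := exists_glue U hU x fun p q T' a b hab =>
    huniq (a ≫ restrι T (U p)) _ _ (hP a _ _ (hx p)) (by rw [hab]; exact hP b _ _ (hx q))
  exact ⟨y, fun p => ⟨U p, hU p, by rw [hy]; exact hx p⟩⟩

lemma Fn.pull_comp {T'' T' T : Over S} (g : T'' ⟶ T') (f : T' ⟶ T) (a : Fn T) :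
    Fn.pull (g ≫ f) a = Fn.pull g (Fn.pull f a) := by
  rw [Fn.pull, Over.comp_left, Scheme.Hom.comp_appTop]
  rfl

/-- Functions are morphisms to the affine line, so locality of morphisms applies. -/
lemma Fn.ext_of_locally {T : Over S} {a b : Fn T}
    (h : ∀ p : T.left, ∃ U : T.left.Opens, p ∈ U ∧
      Fn.pull (restrι T U) a = Fn.pull (restrι T U) b) : a = b := by
  apply (lineEquiv T).symm.injective
  refine hom_ext_of_locally fun p => ?_
  obtain ⟨U, hU, hab⟩ := h p
  refine ⟨U, hU, (lineEquiv _).injective ?_⟩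
  rw [lineEquiv_comp, lineEquiv_comp, Equiv.apply_symm_apply, Equiv.apply_symm_apply, hab]

lemma isField_fn {K : Type u} [Field K] (σ : Spec (.of K) ⟶ S) : IsField (Fn (Over.mk σ)) :=
  (Scheme.ΓSpecIso (.of K)).symm.commRingCatIsoToRingEquiv.symm.toMulEquiv.isField
    (Field.toIsField K)

/-- A field-valued point through a given point. -/
lemma exists_point {T : Over S} (p : T.left) :
    ∃ (K : Type u) (_ : Field K) (σ : Spec (.of K) ⟶ S) (x : Over.mk σ ⟶ T),
      ∀ q, x.left q = p := by
  refine ⟨T.left.residueField p, inferInstance, T.left.fromSpecResidueField p ≫ T.hom,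
    Over.homMk (T.left.fromSpecResidueField p) rfl, fun q => ?_⟩
  exact Scheme.fromSpecResidueField_apply p q

/-- Tested at residue fields, the hypothesis puts every point into the basic open set of `a`, so `a`
is invertible in every stalk. This passes from nondegeneracy at field-valued points to invertible
determinants over any base. -/
lemma isUnit_of_points {T : Over S} (a : Fn T)
    (h : ∀ (K : Type u) [Field K] (σ : Spec (.of K) ⟶ S) (x : Over.mk σ ⟶ T), Fn.pull x a ≠ 0) :
    IsUnit a := by
  have key : ∀ p : T.left, p ∈ T.left.basicOpen a := by
    intro p
    obtain ⟨K, _, σ, x, hx⟩ := exists_point p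
    have hu : IsUnit (Fn.pull x a) := by
      let _ := (isField_fn σ).toField
      exact isUnit_iff_ne_zero.mpr (h K σ x)
    let q : (Over.mk σ).left := (default : PrimeSpectrum K)
    have hq : q ∈ x.left ⁻¹ᵁ T.left.basicOpen a := by
      rw [Scheme.preimage_basicOpen]
      exact (Scheme.basicOpen_of_isUnit _ hu).ge trivial
    rw [← hx q]
    exact hq
  refine T.left.toRingedSpace.isUnit_of_isUnit_germ ⊤ a fun p hp => ?_
  exact (T.left.mem_basicOpen a p hp).mp (key p)

end Local

/-! ### Zariski sheaves on `Over S` which are locally representable are representable -/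

section Representability

variable {S : Scheme.{u}} (G : (Over S)ᵒᵖ ⥤ Type (u + 1))

/-- A morphism `X ⟶ S` together with a value of the presheaf `G` on the `S`-scheme `X`. -/
abbrev TotalPt (X : Scheme.{u}) : Type (u + 1) := Σ g : X ⟶ S, G.obj (op (Over.mk g))

namespace TotalPt

variable {G}

/-- A value of `G` on the `S`-scheme `T`. -/
def of (T : Over S) (w : G.obj (op T)) : TotalPt G T.left := ⟨T.hom, w⟩

lemma of_injective (T : Over S) : Function.Injective (of (G := G) T) := by
  intro w w' h
  exact eq_of_heq (Sigma.mk.inj h).2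

/-- Restriction along a morphism of schemes. -/
def res {X' X : Scheme.{u}} (f : X' ⟶ X) (t : TotalPt G X) : TotalPt G X' :=
  of (Over.mk (f ≫ t.1)) (G.map (Over.homMk f rfl : Over.mk (f ≫ t.1) ⟶ Over.mk t.1).op t.2)

/-- The new structure morphism is any `g'` equal to `f ≫ g`, so that values of `G` need not be
transported along equalities of structure morphisms. -/
lemma res_mk {X' X : Scheme.{u}} (f : X' ⟶ X) (g : X ⟶ S) (g' : X' ⟶ S) (h : f ≫ g = g')
    (w : G.obj (op (Over.mk g))) :
    res f (of (Over.mk g) w) =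
      of (Over.mk g') (G.map (Over.homMk f h : Over.mk g' ⟶ Over.mk g).op w) := by
  subst h
  rfl

lemma res_of {T' T : Over S} (f : T' ⟶ T) (w : G.obj (op T)) :
    res f.left (of T w) = of T' (G.map f.op w) :=
  res_mk f.left T.hom T'.hom (Over.w f) w

lemma exists_of {X : Scheme.{u}} (t : TotalPt G X) (g : X ⟶ S) (h : t.1 = g) :
    ∃ w, t = of (Over.mk g) w := by
  subst h
  exact ⟨t.2, rfl⟩

lemma res_comp {X'' X' X : Scheme.{u}} (f' : X'' ⟶ X') (f : X' ⟶ X) (t : TotalPt G X) :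
    res (f' ≫ f) t = res f' (res f t) := by
  obtain ⟨w, hw⟩ := exists_of t t.1 rfl
  rw [hw, res_mk f t.1 _ rfl, res_mk f' (f ≫ t.1) ((f' ≫ f) ≫ t.1) (Category.assoc _ _ _).symm,
    res_mk (f' ≫ f) t.1 _ rfl, ← ConcreteCategory.comp_apply, ← G.map_comp]
  rfl

lemma res_id {X : Scheme.{u}} (t : TotalPt G X) : res (𝟙 X) t = t := by
  obtain ⟨w, hw⟩ := exists_of t t.1 rfl
  rw [hw, res_mk (𝟙 X) t.1 t.1 (Category.id_comp _)]
  have h : (Over.homMk (𝟙 X) (Category.id_comp _) : Over.mk t.1 ⟶ Over.mk t.1) = 𝟙 _ := rfl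
  rw [h, op_id, G.map_id]
  rfl

end TotalPt

/-- Values of `G` agree if they agree locally. -/
def LocallySeparated : Prop :=
  ∀ (T : Over S) (w w' : G.obj (op T)),
    (∀ p : T.left, ∃ U : T.left.Opens, p ∈ U ∧
      G.map (restrι T U).op w = G.map (restrι T U).op w') → w = w'

/-- Values of `G` can be glued. -/
def LocallyGluing : Prop :=
  ∀ (T : Over S) (U : T.left → T.left.Opens) (_ : ∀ p, p ∈ U p)
    (w : ∀ p, G.obj (op (restr T (U p)))),
    (∀ (p q) (T' : Over S) (a : T' ⟶ restr T (U p)) (b : T' ⟶ restr T (U q)),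
      a ≫ restrι T (U p) = b ≫ restrι T (U q) → G.map a.op (w p) = G.map b.op (w q)) →
    ∃ w', ∀ p, G.map (restrι T (U p)).op w' = w p

variable {G}

/-- The structure morphisms agree first, because they agree locally; then both values live over the
same `S`-scheme and separatedness of `G` applies. -/
lemma LocallySeparated.ext (hsep : LocallySeparated G) {X : Scheme.{u}} (t t' : TotalPt G X)
    (h : ∀ p : X, ∃ U : X.Opens, p ∈ U ∧ t.res U.ι = t'.res U.ι) : t = t' := by
  choose U hU ht using h
  have hg : t.1 = t'.1 := by
    refine Scheme.Cover.hom_ext (X.openCoverOfIsOpenCover U (openCover_of_nhds U hU)) _ _ ?_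
    exact fun p => congrArg (fun z => z.1) (ht p)
  obtain ⟨g, w⟩ := t
  obtain ⟨g', w'⟩ := t'
  obtain rfl : g = g' := hg
  refine congrArg (TotalPt.of (Over.mk g)) (hsep _ _ _ fun p => ⟨U p, hU p, ?_⟩)
  exact TotalPt.of_injective _ (ht p)

/-- The gluing condition on `G` concerns neighbourhoods indexed by points. An arbitrary open cover
is reduced to it by assigning to `p` the image of a member of the cover that contains `p`. -/
lemma LocallyGluing.exists_unique (hsep : LocallySeparated G) (hglue : LocallyGluing G)
    {X : Scheme.{u}} (𝒰 : X.OpenCover) (x : ∀ i, TotalPt G (𝒰.X i))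
    (hx : ∀ (i j) (Z : Scheme.{u}) (a : Z ⟶ 𝒰.X i) (b : Z ⟶ 𝒰.X j),
      a ≫ 𝒰.f i = b ≫ 𝒰.f j → (x i).res a = (x j).res b) :
    ∃! t : TotalPt G X, ∀ i, t.res (𝒰.f i) = x i := by
  let U : X → X.Opens := fun p => (𝒰.f (𝒰.idx p)).opensRange
  have hU : ∀ p, p ∈ U p := fun p => 𝒰.covers p
  let a : ∀ p, (U p).toScheme ⟶ 𝒰.X (𝒰.idx p) := fun p => (𝒰.f (𝒰.idx p)).isoOpensRange.inv
  have ha : ∀ p, a p ≫ 𝒰.f (𝒰.idx p) = (U p).ι := fun p => Scheme.Hom.isoOpensRange_inv_comp _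
  -- Agreement with the data on the chosen neighbourhoods already forces agreement on every member
  -- of the cover.
  have hloc : ∀ (t : TotalPt G X), (∀ p, t.res (U p).ι = (x (𝒰.idx p)).res (a p)) →
      ∀ i, t.res (𝒰.f i) = x i := by
    intro t ht i
    refine hsep.ext _ _ fun q => ⟨𝒰.f i ⁻¹ᵁ U (𝒰.f i q), hU _, ?_⟩
    rw [← TotalPt.res_comp, ← morphismRestrict_ι, TotalPt.res_comp, ht, ← TotalPt.res_comp]
    refine hx _ _ _ _ _ ?_
    rw [Category.assoc, ha, morphismRestrict_ι]
  -- The structure morphisms are glued before the values, which only make sense over them.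
  let g : X ⟶ S := 𝒰.glueMorphisms (fun i => (x i).1) fun i j =>
    congrArg (fun z => z.1) (hx i j _ _ _ pullback.condition)
  have hg : ∀ i, 𝒰.f i ≫ g = (x i).1 := fun i => 𝒰.ι_glueMorphisms _ _ i
  have hg' : ∀ p, ((x (𝒰.idx p)).res (a p)).1 = (U p).ι ≫ g := by
    intro p
    change a p ≫ (x _).1 = _
    rw [← hg, ← Category.assoc, ha]
  choose w hw using fun p => TotalPt.exists_of _ _ (hg' p)
  obtain ⟨w', hw'⟩ := hglue (Over.mk g) U hU w fun p q T' b c hbc => by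
    apply TotalPt.of_injective
    refine (TotalPt.res_of b (w p)).symm.trans (Eq.trans ?_ (TotalPt.res_of c (w q)))
    refine (congrArg (TotalPt.res b.left) (hw p)).symm.trans (Eq.trans ?_
      (congrArg (TotalPt.res c.left) (hw q)))
    rw [← TotalPt.res_comp, ← TotalPt.res_comp]
    refine hx _ _ _ _ _ ?_
    rw [Category.assoc, Category.assoc, ha, ha]
    exact congrArg (fun z => z.left) hbc
  have ht : ∀ p, (TotalPt.of (Over.mk g) w').res (U p).ι = (x (𝒰.idx p)).res (a p) := by
    intro p
    refine (TotalPt.res_of (restrι (Over.mk g) (U p)) w').trans ?_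
    rw [hw']
    exact (hw p).symm
  refine ⟨_, hloc _ ht, fun t' ht' => hsep.ext _ _ fun p => ⟨U p, hU p, ?_⟩⟩
  rw [ht, ← ht', ← TotalPt.res_comp, ha]

variable (G) in
/-- The presheaf on schemes whose value at `X` is the set of pairs of a morphism `X ⟶ S` and a value
of `G` on the resulting `S`-scheme. -/
def totalPresheaf [∀ T, Small.{u} (TotalPt G T)] : Scheme.{u}ᵒᵖ ⥤ Type u where
  obj X := Shrink.{u} (TotalPt G X.unop)
  map f := ↾fun t => equivShrink _ (((equivShrink _).symm t).res f.unop)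
  map_id X := by
    refine ConcreteCategory.hom_ext _ _ fun t => ?_
    exact (congrArg (equivShrink _) (TotalPt.res_id _)).trans (Equiv.apply_symm_apply _ _)
  map_comp f f' := by
    refine ConcreteCategory.hom_ext _ _ fun t => ?_
    refine congrArg (equivShrink _) ?_
    refine (TotalPt.res_comp _ _ _).trans (congrArg (TotalPt.res _) ?_)
    exact (Equiv.symm_apply_apply _ _).symm

lemma totalPresheaf_map [∀ T, Small.{u} (TotalPt G T)] {X' X : Scheme.{u}} (f : X' ⟶ X)
    (t : TotalPt G X) :
    (totalPresheaf G).map f.op (equivShrink _ t) = equivShrink _ (t.res f) :=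
  congrArg (fun z => equivShrink _ (TotalPt.res f z)) (Equiv.symm_apply_apply _ _)

lemma totalPresheaf_isSheaf [∀ T, Small.{u} (TotalPt G T)] (hsep : LocallySeparated G)
    (hglue : LocallyGluing G) :
    Presieve.IsSheaf Scheme.zariskiTopology (totalPresheaf G) := by
  rw [Precoverage.isSheaf_toGrothendieck_iff_of_isStableUnderBaseChange]
  intro X R hR
  obtain ⟨(𝒰 : X.OpenCover), rfl⟩ := Scheme.exists_cover_of_mem_pretopology hR
  refine Presieve.isSheafFor_arrows_iff _ _ |>.mpr fun x hx => ?_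
  obtain ⟨t, ht, huniq⟩ := LocallyGluing.exists_unique hsep hglue 𝒰
    (fun i => (equivShrink _).symm (x i)) fun i j Z a b hab =>
      (equivShrink _).injective (hx i j Z a b hab)
  refine ⟨equivShrink _ t, fun i => ?_, fun t' ht' => ?_⟩
  · refine (totalPresheaf_map _ _).trans ?_
    rw [ht]
    exact Equiv.apply_symm_apply _ _
  · refine (Equiv.apply_symm_apply (equivShrink (TotalPt G X)) t').symm.trans ?_
    refine congrArg _ (huniq ((equivShrink _).symm t') fun i => ?_)
    refine Eq.trans ?_ (congrArg _ (ht' i))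
    exact (Equiv.symm_apply_apply _ _).symm

/-- A Zariski sheaf with small values on `Over S`, covered by representable open subfunctors, is
representable. -/
theorem exists_representableBy [∀ T, Small.{u} (TotalPt G T)] (hsep : LocallySeparated G)
    (hglue : LocallyGluing G) {ι : Type u} (C : ι → Over S) (c : ∀ i, G.obj (op (C i)))
    (hmono : ∀ i (T : Over S) (h h' : T ⟶ C i), G.map h.op (c i) = G.map h'.op (c i) → h = h')
    (hopen : ∀ i (T : Over S) (w : G.obj (op T)), ∃ D : T.left.Opens, ∀ (T' : Over S) (f : T' ⟶ T),
      (∀ p, f.left p ∈ D) ↔ ∃ h : T' ⟶ C i, G.map h.op (c i) = G.map f.op w)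
    (hcov : ∀ (T : Over S) (w : G.obj (op T)) (p : T.left), ∃ U : T.left.Opens, p ∈ U ∧
      ∃ i, ∃ h : restr T U ⟶ C i, G.map h.op (c i) = G.map (restrι T U).op w) :
    ∃ X : Over S, Nonempty (G.RepresentableBy X) := by
  let F : Sheaf Scheme.zariskiTopology.{u} (Type u) :=
    ⟨totalPresheaf G, (isSheaf_iff_isSheaf_of_type _ _).mpr (totalPresheaf_isSheaf hsep hglue)⟩
  let f : ∀ i, yoneda.obj (C i).left ⟶ F.obj := fun i =>
    yonedaEquiv.symm (equivShrink _ (TotalPt.of (C i) (c i)))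
  -- The pullback of the `i`-th chart along a value `w` over `X` is the open subscheme `D` over
  -- which `w` comes from `C i`; this is the relative open immersion condition.
  have hf : ∀ i, IsOpenImmersion.presheaf (f i) := by
    intro i
    refine MorphismProperty.relative.of_exists fun X g => ?_
    obtain ⟨t', rfl⟩ := yonedaEquiv.symm.surjective g
    obtain ⟨t, rfl⟩ := (equivShrink (TotalPt G X)).surjective t'
    obtain ⟨w, hw⟩ := t.exists_of _ rfl
    obtain ⟨D, hD⟩ := hopen i _ w
    obtain ⟨h, hh⟩ := (hD _ (restrι (Over.mk t.1) D)).mp fun p => by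
      simpa using comp_restrι_mem (𝟙 (restr (Over.mk t.1) D)) p
    refine ⟨D.toScheme, yoneda.map h.left, D.ι, ?_, inferInstance⟩
    refine IsPullback.of_forall_isPullback_app fun Y => ?_
    refine (Types.isPullback_iff _ _ _ _).mpr ⟨?_, ?_, ?_⟩
    · refine ConcreteCategory.hom_ext _ _ fun v => ?_
      refine (totalPresheaf_map (v ≫ h.left) _).trans (Eq.trans ?_
        (totalPresheaf_map (v ≫ D.ι) _).symm)
      rw [TotalPt.res_comp, TotalPt.res_comp, TotalPt.res_of, hh, ← TotalPt.res_of]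
      exact congrArg (fun z => equivShrink _ (TotalPt.res v (TotalPt.res D.ι z))) hw.symm
    · intro v v' hv
      rw [← cancel_mono D.ι]
      exact hv.2
    · intro (x₂ : Y.unop ⟶ (C i).left) (x₃ : Y.unop ⟶ X) hx
      have hx' : (TotalPt.of (C i) (c i)).res x₂ = t.res x₃ :=
        (equivShrink _).injective ((totalPresheaf_map x₂ _).symm.trans
          (hx.trans (totalPresheaf_map x₃ _)))
      have hst : x₂ ≫ (C i).hom = x₃ ≫ t.1 := congrArg (fun z => z.1) hx'
      let T' : Over S := Over.mk (x₃ ≫ t.1)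
      let u : T' ⟶ C i := Over.homMk x₂ hst
      let v : T' ⟶ Over.mk t.1 := Over.homMk x₃ rfl
      have huv : G.map u.op (c i) = G.map v.op w := by
        apply TotalPt.of_injective
        rw [← TotalPt.res_of, ← TotalPt.res_of, ← hw]
        exact hx'
      let l := liftRestr v D ((hD _ v).mpr ⟨u, huv⟩)
      have hl : l ≫ restrι _ D = v := liftRestr_restrι _ _ _
      refine ⟨l.left, ?_, congrArg (fun z => z.left) hl⟩
      refine congrArg (fun z => z.left) (hmono i _ (l ≫ h) u ?_)
      rw [huv, op_comp, G.map_comp, ConcreteCategory.comp_apply, hh, ← ConcreteCategory.comp_apply,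
        ← G.map_comp, ← op_comp, hl]
  have hsurj : Presheaf.IsLocallySurjective Scheme.zariskiTopology (Sigma.desc f) := by
    refine ⟨fun {X} s => ?_⟩
    obtain ⟨t, rfl⟩ := (equivShrink (TotalPt G X)).surjective s
    obtain ⟨g, w⟩ := t
    choose U hU i h hh using hcov _ w
    refine GrothendieckTopology.superset_covering _ ?_
      (X.openCoverOfIsOpenCover U (openCover_of_nhds U hU)).mem_grothendieckTopology
    rw [Sieve.generate_le_iff]
    rintro _ _ ⟨p⟩
    refine ⟨(Sigma.ι (fun i => yoneda.obj (C i).left) (i p)).app _ (h p).left, ?_⟩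
    have h₁ : (Sigma.ι (fun i => yoneda.obj (C i).left) (i p)) ≫ Sigma.desc f = f (i p) :=
      Sigma.ι_desc _ _
    have h₂ := congrArg (fun z => z.app (op (U p).toScheme) (h p).left) h₁
    refine Eq.trans h₂ ?_
    refine (totalPresheaf_map (h p).left _).trans (Eq.trans ?_ (totalPresheaf_map _ _).symm)
    refine congrArg (equivShrink _) ?_
    exact (TotalPt.res_of (h p) _).trans (congrArg (TotalPt.of _) (hh p))
  obtain ⟨X, ⟨e⟩⟩ := (Scheme.LocalRepresentability.isRepresentable hf).has_representation
  -- The universal element of the total presheaf is a pair: its first component makes `X` an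
  -- `S`-scheme, its second is the universal value of `G` on it.
  obtain ⟨t, ht⟩ := (equivShrink (TotalPt G X)).surjective (e.homEquiv (𝟙 X))
  obtain ⟨g, w⟩ := t
  have he : ∀ {Y : Scheme.{u}} (v : Y ⟶ X), e.homEquiv v = equivShrink _ (TotalPt.res v (TotalPt.of (Over.mk g) w)) := by
    intro Y v
    have := e.homEquiv_comp v (𝟙 X)
    rw [Category.comp_id, ← ht] at this
    exact this.trans (totalPresheaf_map _ _)
  have hbij : ∀ T : Over S, Function.Bijective
      (fun v : T ⟶ Over.mk g => (G.map v.op w : G.obj (op T))) := by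
    refine fun T => ⟨fun v v' hv => ?_, fun w' => ?_⟩
    · ext1
      apply e.homEquiv.injective
      rw [he, he]
      refine congrArg _ ((TotalPt.res_of v w).trans (Eq.trans ?_ (TotalPt.res_of v' w).symm))
      exact congrArg _ hv
    · obtain ⟨v, hv⟩ := e.homEquiv.surjective (equivShrink _ (TotalPt.of T w'))
      rw [he] at hv
      have hv' := (equivShrink _).injective hv
      refine ⟨Over.homMk v (congrArg (fun z => z.1) hv'), ?_⟩
      apply TotalPt.of_injective
      refine (TotalPt.res_of _ _).symm.trans ?_
      exact hv'
  refine ⟨Over.mk g, ⟨⟨fun {T} => Equiv.ofBijective _ (hbij T), fun v v' => ?_⟩⟩⟩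
  change G.map (v ≫ v').op w = G.map v.op (G.map v'.op w)
  rw [op_comp, G.map_comp]
  rfl

end Representability

/-! ### Linear algebra -/

section LinearAlgebra

variable {R M : Type u} [CommRing R] [AddCommGroup M] [Module R M] {k : ℕ}
  {e : Fin k → M} {W : Submodule R M}

lemma IsBasisOf.mem (h : IsBasisOf e W) (i : Fin k) : e i ∈ W := by
  rw [← h.2]
  exact Submodule.subset_span ⟨i, rfl⟩

lemma IsBasisOf.exists_eq_sum (h : IsBasisOf e W) {x : M} (hx : x ∈ W) :
    ∃ c : Fin k → R, x = ∑ i, c i • e i := by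
  rw [← h.2, Submodule.mem_span_range_iff_exists_fun] at hx
  obtain ⟨c, hc⟩ := hx
  exact ⟨c, hc.symm⟩

lemma IsBasisOf.sum_mem (h : IsBasisOf e W) (c : Fin k → R) : ∑ i, c i • e i ∈ W :=
  Submodule.sum_mem _ fun i _ => Submodule.smul_mem _ _ (h.mem i)

lemma IsBasisOf.eq_of_sum_eq (h : IsBasisOf e W) {c c' : Fin k → R}
    (hc : ∑ i, c i • e i = ∑ i, c' i • e i) : c = c' := by
  have h0 : ∑ i, (c i - c' i) • e i = 0 := by
    simp only [sub_smul, Finset.sum_sub_distrib, hc, sub_self]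
  funext i
  exact sub_eq_zero.mp (Fintype.linearIndependent_iff.mp h.1 _ h0 i)

/-- The matrix of values of the functionals `c a` on the vectors `e b`. -/
def valueMatrix (c : Fin k → M →ₗ[R] R) (e : Fin k → M) : Matrix (Fin k) (Fin k) R :=
  Matrix.of fun a b => c a (e b)

lemma apply_sum_eq_mulVec (c : Fin k → M →ₗ[R] R) (e : Fin k → M) (y : Fin k → R) (a : Fin k) :
    c a (∑ b, y b • e b) = (valueMatrix c e).mulVec y a := by
  simp [valueMatrix, Matrix.mulVec, dotProduct, mul_comm]

lemma IsBasisOf.existsUnique_of_isUnit (h : IsBasisOf e W) (c : Fin k → M →ₗ[R] R)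
    (hc : IsUnit (valueMatrix c e).det) (y : Fin k → R) : ∃! s, s ∈ W ∧ ∀ a, c a s = y a := by
  have hu := (Matrix.isUnit_iff_isUnit_det _).mpr hc
  refine ⟨∑ b, ((valueMatrix c e)⁻¹.mulVec y) b • e b, ⟨h.sum_mem _, fun a => ?_⟩, ?_⟩
  · rw [apply_sum_eq_mulVec, Matrix.mulVec_mulVec, Matrix.mul_nonsing_inv _ hc, Matrix.one_mulVec]
  · rintro s ⟨hs, hs'⟩
    obtain ⟨z, rfl⟩ := h.exists_eq_sum hs
    have : (valueMatrix c e).mulVec z = y := by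
      funext a
      rw [← apply_sum_eq_mulVec, hs']
    rw [← this, Matrix.mulVec_mulVec, Matrix.nonsing_inv_mul _ hc, Matrix.one_mulVec]

/-- A square matrix over a domain is singular exactly when it has a nonzero kernel vector. This
turns joint injectivity of functionals at a field-valued point into the nonvanishing of one
function, hence into an open condition. -/
lemma IsBasisOf.det_ne_zero_iff [IsDomain R] (h : IsBasisOf e W) (c : Fin k → M →ₗ[R] R) :
    (valueMatrix c e).det ≠ 0 ↔ ∀ x ∈ W, (∀ a, c a x = 0) → x = 0 := by
  rw [← not_iff_not, not_not, ← Matrix.exists_mulVec_eq_zero_iff]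
  constructor
  · rintro ⟨z, hz, hz'⟩ H
    refine hz (h.eq_of_sum_eq (c' := 0) ?_)
    rw [H _ (h.sum_mem z) fun a => by rw [apply_sum_eq_mulVec, hz']; rfl]
    simp
  · intro H
    push Not at H
    obtain ⟨x, hx, hcx, hx0⟩ := H
    obtain ⟨z, rfl⟩ := h.exists_eq_sum hx
    refine ⟨z, fun hz => hx0 ?_, funext fun a => ?_⟩
    · simp [hz]
    · rw [← apply_sum_eq_mulVec, hcx]
      rfl

lemma IsBasisOf.of_dual {w : Fin k → M} (c : Fin k → M →ₗ[R] R)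
    (hc : ∀ a b, c a (w b) = if a = b then 1 else 0) :
    IsBasisOf w (Submodule.span R (Set.range w)) := by
  refine ⟨Fintype.linearIndependent_iff.mpr fun z hz a => ?_, rfl⟩
  have := congrArg (c a) hz
  simpa [hc] using this

lemma eq_sum_of_mem_span {w : Fin k → M} (c : Fin k → M →ₗ[R] R)
    (hc : ∀ a b, c a (w b) = if a = b then 1 else 0) {x : M}
    (hx : x ∈ Submodule.span R (Set.range w)) : x = ∑ b, c b x • w b := by
  obtain ⟨z, rfl⟩ := (Submodule.mem_span_range_iff_exists_fun R).mp hx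
  refine Finset.sum_congr rfl fun b _ => ?_
  simp [hc]

end LinearAlgebra

/-! ### Frames of subbundles -/

section Frames

variable {S : Scheme.{u}} {n n' k : ℕ} {V : VectorBundle S n} {V' : VectorBundle S n'}
  {T : Over S}

lemma VectorBundle.comp_sum_smul (V : VectorBundle S n) {T' T : Over S} (f : T' ⟶ T) {ι : Type*}
    (s : Finset ι) (c : ι → Fn T) (x : ι → (T ⟶ V.tot)) :
    f ≫ ∑ i ∈ s, c i • x i = ∑ i ∈ s, Fn.pull f (c i) • (f ≫ x i) := by
  let g : (T ⟶ V.tot) →+ (T' ⟶ V.tot) :=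
    { toFun := fun x => f ≫ x
      map_zero' := V.comp_zero f
      map_add' := V.comp_add f }
  refine (map_sum g _ _).trans (Finset.sum_congr rfl fun i _ => V.comp_smul f _ _)

/-- The sections `e` form a frame of the subbundle `W`. -/
def Subbundle.IsFrame (W : Subbundle V k T) {T' : Over S} (f : T' ⟶ T)
    (e : Fin k → (T' ⟶ V.tot)) : Prop :=
  ∀ {T'' : Over S} (g : T'' ⟶ T'), IsBasisOf (fun i => g ≫ e i) (W.sec (g ≫ f))

lemma Subbundle.IsFrame.comp {W : Subbundle V k T} {T' : Over S} {f : T' ⟶ T}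
    {e : Fin k → (T' ⟶ V.tot)} (h : W.IsFrame f e) {T'' : Over S} (g : T'' ⟶ T') :
    W.IsFrame (g ≫ f) (fun i => g ≫ e i) := by
  intro T₃ g'
  have := h (g' ≫ g)
  simp only [Category.assoc] at this
  exact this

lemma Subbundle.IsFrame.isBasisOf {W : Subbundle V k T} {T' : Over S} {f : T' ⟶ T}
    {e : Fin k → (T' ⟶ V.tot)} (h : W.IsFrame f e) : IsBasisOf e (W.sec f) := by
  have := h (𝟙 T')
  simp only [Category.id_comp] at this
  exact this

lemma Subbundle.exists_isFrame (W : Subbundle V k T) (p : T.left) :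
    ∃ U : T.left.Opens, p ∈ U ∧ ∃ e, W.IsFrame (restrι T U) e := by
  obtain ⟨U, hU, e, he⟩ := W.exists_frame p
  exact ⟨U, hU, e, fun g => he _ g⟩

lemma exists_restr_comp {T' T : Over S} (f : T' ⟶ T) (U : T.left.Opens) :
    ∃ g : restr T' (f.left ⁻¹ᵁ U) ⟶ restr T U,
      g ≫ restrι T U = restrι T' (f.left ⁻¹ᵁ U) ≫ f := by
  refine ⟨Over.homMk (f.left ∣_ U) (by simp), ?_⟩
  ext1
  simp

lemma Subbundle.exists_isFrame_comp (W : Subbundle V k T) {T' : Over S} (f : T' ⟶ T)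
    (p : T'.left) : ∃ U : T'.left.Opens, p ∈ U ∧ ∃ e, W.IsFrame (restrι T' U ≫ f) e := by
  obtain ⟨U, hU, e, he⟩ := W.exists_isFrame (f.left p)
  obtain ⟨g, hg⟩ := exists_restr_comp f U
  exact ⟨f.left ⁻¹ᵁ U, hU, fun i => g ≫ e i, hg ▸ he.comp g⟩

/-- A local frame generates the sections over every base change, and membership in `W'` is local; so
inclusion need only be tested on local frames. -/
lemma Subbundle.sec_le_of_frames {k' : ℕ} (W : Subbundle V k T) (W' : Subbundle V k' T)
    (h : ∀ p : T.left, ∃ U : T.left.Opens, p ∈ U ∧ ∃ e, W.IsFrame (restrι T U) e ∧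
      ∀ i, e i ∈ W'.sec (restrι T U)) {T' : Over S} (f : T' ⟶ T) : W.sec f ≤ W'.sec f := by
  intro x hx
  refine W'.mem_of_locally f x fun p => ?_
  obtain ⟨U, hU, e, he, he'⟩ := h (f.left p)
  obtain ⟨g, hg⟩ := exists_restr_comp f U
  refine ⟨f.left ⁻¹ᵁ U, hU, ?_⟩
  have h1 := W.comp_mem (restrι T' (f.left ⁻¹ᵁ U)) f x hx
  rw [← hg] at h1 ⊢
  obtain ⟨c, hc⟩ := (he g).exists_eq_sum h1
  rw [hc]
  exact Submodule.sum_mem _ fun i _ => Submodule.smul_mem _ _ (W'.comp_mem g _ _ (he' i))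

/-- Sections over the open subschemes of `T` contain local frames, and frames generate after every
base change. So a small amount of data determines the subbundle, which is why its functor has small
values. -/
lemma Subbundle.ext_of_opens {W W' : Subbundle V k T}
    (h : ∀ U : T.left.Opens, W.sec (restrι T U) = W'.sec (restrι T U)) : W = W' := by
  apply Subbundle.ext
  funext T' f
  refine le_antisymm (W.sec_le_of_frames W' (fun p => ?_) f) (W'.sec_le_of_frames W (fun p => ?_) f)
  · obtain ⟨U, hU, e, he⟩ := W.exists_isFrame p
    exact ⟨U, hU, e, he, fun i => h U ▸ he.isBasisOf.mem i⟩
  · obtain ⟨U, hU, e, he⟩ := W'.exists_isFrame p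
    exact ⟨U, hU, e, he, fun i => h U ▸ he.isBasisOf.mem i⟩

lemma Subbundle.ext_of_sec_le {W W' : Subbundle V k T}
    (h : ∀ {T' : Over S} (f : T' ⟶ T), W.sec f ≤ W'.sec f)
    (h' : ∀ {T' : Over S} (f : T' ⟶ T), W'.sec f ≤ W.sec f) : W = W' :=
  Subbundle.ext_of_opens fun _ => le_antisymm (h _) (h' _)

variable (V) in
lemma subbundle_locallySeparated (k : ℕ) : LocallySeparated (grFunctor V k) := by
  intro T W W' h
  have key : ∀ (W W' : Subbundle V k T), (∀ p : T.left, ∃ U : T.left.Opens, p ∈ U ∧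
      W.pull (restrι T U) = W'.pull (restrι T U)) → ∀ {T' : Over S} (f : T' ⟶ T),
      W.sec f ≤ W'.sec f := by
    intro W W' h T' f x hx
    refine W'.mem_of_locally f x fun p => ?_
    obtain ⟨U, hU, hW⟩ := h (f.left p)
    obtain ⟨g, hg⟩ := exists_restr_comp f U
    refine ⟨f.left ⁻¹ᵁ U, hU, ?_⟩
    have h1 := W.comp_mem (restrι T' (f.left ⁻¹ᵁ U)) f x hx
    rw [← hg] at h1 ⊢
    have h2 : W.sec (g ≫ restrι T U) = W'.sec (g ≫ restrι T U) :=
      congrArg (fun Z : Subbundle V k _ => Z.sec g) hW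
    exact h2 ▸ h1
  refine Subbundle.ext_of_sec_le (key W W' h) (key W' W fun p => ?_)
  obtain ⟨U, hU, hW⟩ := h p
  exact ⟨U, hU, hW.symm⟩

/-- Frames of a glued subbundle are given over open subschemes of members of the cover; this regards
them as living over open subschemes of `T`. -/
lemma exists_restr_image (U : T.left.Opens) (A : (restr T U).left.Opens) :
    ∃ g : restr T (U.ι ''ᵁ A) ⟶ restr (restr T U) A,
      g ≫ restrι _ A ≫ restrι T U = restrι T (U.ι ''ᵁ A) := by
  have hq : ∀ q : (restr T (U.ι ''ᵁ A)).left, ∃ z ∈ A, U.ι z = (restrι T (U.ι ''ᵁ A)).left q := by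
    intro q
    obtain ⟨z, hz, hz'⟩ := comp_restrι_mem (𝟙 (restr T (U.ι ''ᵁ A))) q
    rw [Category.id_comp] at hz'
    exact ⟨z, hz, hz'⟩
  have hr : ∀ q : (restr T (U.ι ''ᵁ A)).left, (restrι T (U.ι ''ᵁ A)).left q ∈ U := by
    intro q
    obtain ⟨z, _, hz⟩ := hq q
    rw [← hz]
    exact z.2
  refine ⟨liftRestr (liftRestr (restrι T _) U hr) A fun q => ?_, by
    rw [← Category.assoc, liftRestr_restrι, liftRestr_restrι]⟩
  obtain ⟨z, hz, hz'⟩ := hq q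
  have h2 : U.ι ((liftRestr (restrι T (U.ι ''ᵁ A)) U hr).left q) = U.ι z := by
    rw [hz']
    exact congrArg (fun f => f.left q) (liftRestr_restrι (restrι T (U.ι ''ᵁ A)) U hr)
  rw [U.ι.injective h2]
  exact hz

variable (V) in
lemma subbundle_locallyGluing (k : ℕ) : LocallyGluing (grFunctor V k) := by
  intro T U hU (w : ∀ p, Subbundle V k (restr T (U p))) hw
  have hw' : ∀ (p q) (T' : Over S) (a : T' ⟶ restr T (U p)) (b : T' ⟶ restr T (U q)),
      a ≫ restrι T (U p) = b ≫ restrι T (U q) → (w p).sec a = (w q).sec b := by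
    intro p q T' a b hab
    have := congrArg (fun Z : Subbundle V k T' => Z.sec (𝟙 T')) (hw p q T' a b hab)
    change (w p).sec (𝟙 T' ≫ a) = (w q).sec (𝟙 T' ≫ b) at this
    rwa [Category.id_comp, Category.id_comp] at this
  -- A section belongs to the glued subbundle if every pullback of it that lies over some `U p`
  -- belongs to `w p`. Quantifying over all test objects makes stability under pullback immediate.
  let sec : ∀ {T' : Over S} (_ : T' ⟶ T), Submodule (Fn T') (T' ⟶ V.tot) := fun {T'} f =>
    { carrier := {x | ∀ (p) (T'' : Over S) (g : T'' ⟶ T') (h : T'' ⟶ restr T (U p)),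
        g ≫ f = h ≫ restrι T (U p) → g ≫ x ∈ (w p).sec h}
      add_mem' := fun {x y} hx hy p T'' g h hgh => by
        rw [V.comp_add]
        exact Submodule.add_mem _ (hx p T'' g h hgh) (hy p T'' g h hgh)
      zero_mem' := fun p T'' g h hgh => by
        rw [V.comp_zero]
        exact Submodule.zero_mem _
      smul_mem' := fun a x hx p T'' g h hgh => by
        rw [V.comp_smul]
        exact Submodule.smul_mem _ _ (hx p T'' g h hgh) }
  have hsec : ∀ (p) {T' : Over S} (h : T' ⟶ restr T (U p)),
      sec (h ≫ restrι T (U p)) = (w p).sec h := by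
    intro p T' h
    ext x
    constructor
    · intro hx
      have := hx p T' (𝟙 T') h (Category.id_comp _)
      rwa [Category.id_comp] at this
    · intro hx q T'' g h' hg
      have := (w p).comp_mem g h x hx
      rwa [← hw' p q T'' (g ≫ h) h' (by rw [Category.assoc, hg])]
  let W : Subbundle V k T :=
    { sec := fun f => sec f
      comp_mem := fun g f x hx p T'' g' h hgh => by
        rw [← Category.assoc]
        exact hx p T'' (g' ≫ g) h (by rw [← hgh, Category.assoc])
      mem_of_locally := fun {T'} f x hx p T'' g h hgh => by
        refine (w p).mem_of_locally h _ fun q => ?_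
        obtain ⟨A, hA, hA'⟩ := hx (g.left q)
        obtain ⟨g', hg'⟩ := exists_restr_comp g A
        refine ⟨g.left ⁻¹ᵁ A, hA, ?_⟩
        have := hA' p _ g' (restrι T'' (g.left ⁻¹ᵁ A) ≫ h) (by
          rw [Category.assoc, ← hgh, ← Category.assoc, hg', Category.assoc])
        rwa [← Category.assoc, hg', Category.assoc] at this
      exists_frame := fun p => by
        obtain ⟨A, hA, e, he⟩ := (w p).exists_isFrame ⟨p, hU p⟩
        obtain ⟨g, hg⟩ := exists_restr_image (U p) A
        refine ⟨(U p).ι ''ᵁ A, ⟨⟨p, hU p⟩, hA, rfl⟩, fun i => g ≫ e i, fun T' f => ?_⟩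
        have := he.comp g f
        rw [← hsec, Category.assoc, Category.assoc, hg] at this
        exact this }
  refine ⟨W, fun p => ?_⟩
  apply Subbundle.ext
  funext T' h
  exact hsec p h

/-- A subbundle assigns submodules to all `T'`, hence lives in a larger universe, but by
`Subbundle.ext_of_opens` it is determined by sets of morphisms out of the open subschemes of `X`. -/
instance (k : ℕ) (X : Scheme.{u}) : Small.{u} (TotalPt (grFunctor V k) X) := by
  let c : TotalPt (grFunctor V k) X →
      (Σ _ : X ⟶ S, ∀ U : X.Opens, Set (U.toScheme ⟶ V.tot.left)) := fun t =>
    ⟨t.1, fun U => {x | ∃ y ∈ (show Subbundle V k (Over.mk t.1) from t.2).sec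
      (restrι (Over.mk t.1) U), y.left = x}⟩
  refine small_of_injective (f := c) ?_
  rintro ⟨g, W⟩ ⟨g', W'⟩ h
  obtain rfl : g = g' := congrArg Sigma.fst h
  have h2 := eq_of_heq (Sigma.mk.inj h).2
  refine congrArg (Sigma.mk g) ?_
  refine Subbundle.ext_of_opens (W := W) (W' := W') fun U => ?_
  ext x
  have h3 := congrArg (fun z : Set _ => x.left ∈ z) (congrFun h2 U)
  constructor
  · intro hx
    obtain ⟨y, hy, hyx⟩ := h3.mp ⟨x, hx, rfl⟩
    rwa [← Over.OverMorphism.ext hyx]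
  · intro hx
    obtain ⟨y, hy, hyx⟩ := h3.mpr ⟨x, hx, rfl⟩
    rwa [← Over.OverMorphism.ext hyx]

end Frames

/-! ### Open conditions -/

section OpenConditions

/-- A compact open `V` is a finite union of affine open sets, each contained in one of the given
neighbourhoods; in each of these the trace of `Y` is compact. -/
lemma isRetrocompact_of_locally {X : Scheme.{u}} (Y : Set X)
    (h : ∀ p : X, ∃ U : X.Opens, p ∈ U ∧ IsRetrocompact (U.ι ⁻¹' Y)) : IsRetrocompact Y := by
  intro V hV hVo
  obtain ⟨W, hVW, hWV, hW⟩ := hV.induction_on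
    (p := fun s => ∃ W : Set X, s ⊆ W ∧ W ⊆ V ∧ IsCompact (Y ∩ W))
    ⟨∅, subset_rfl, Set.empty_subset _, by simp⟩
    (fun s t hst ⟨W, h₁, h₂⟩ => ⟨W, hst.trans h₁, h₂⟩)
    (fun s t ⟨W, h₁, h₂, h₃⟩ ⟨W', h₁', h₂', h₃'⟩ => ⟨W ∪ W', Set.union_subset_union h₁ h₁',
      Set.union_subset h₂ h₂', by rw [Set.inter_union_distrib_left]; exact h₃.union h₃'⟩)
    fun x hx => by
      obtain ⟨U, hU, hYU⟩ := h x
      obtain ⟨A, hA, hxA, hAU⟩ := exists_isAffineOpen_mem_and_subset (U := U ⊓ ⟨V, hVo⟩)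
        (show x ∈ U ⊓ ⟨V, hVo⟩ from ⟨hU, hx⟩)
      refine ⟨A, mem_nhdsWithin_of_mem_nhds (A.2.mem_nhds hxA), A, subset_rfl,
        fun y hy => (hAU hy).2, ?_⟩
      have hAr : (A : Set X) ⊆ Set.range U.ι := by
        rw [Scheme.Opens.range_ι]
        exact fun y hy => (hAU hy).1
      have hc : IsCompact (U.ι ⁻¹' (A : Set X)) :=
        U.ι.isOpenEmbedding.isInducing.isCompact_preimage_iff hAr |>.mpr hA.isCompact
      have := (hYU hc (A.2.preimage U.ι.continuous)).image U.ι.continuous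
      rw [← Set.preimage_inter, Set.image_preimage_eq_of_subset (Set.inter_subset_right.trans hAr)]
        at this
      exact this
  have : W = V := subset_antisymm hWV hVW
  rwa [this] at hW

variable {S : Scheme.{u}}

lemma pull_ne_zero_iff {T : Over S} (d : Fn T) {K : Type u} [Field K] {σ : Spec (.of K) ⟶ S}
    (x : Over.mk σ ⟶ T) (q : (Over.mk σ).left) :
    Fn.pull x d ≠ 0 ↔ x.left q ∈ T.left.basicOpen d := by
  have h : x.left q ∈ T.left.basicOpen d ↔ q ∈ (Over.mk σ).left.basicOpen (Fn.pull x d) := by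
    change q ∈ x.left ⁻¹ᵁ T.left.basicOpen d ↔ _
    rw [Scheme.preimage_basicOpen]
    rfl
  rw [h]
  constructor
  · intro hd
    have hu : IsUnit (Fn.pull x d) := by
      let _ := (isField_fn σ).toField
      exact isUnit_iff_ne_zero.mpr hd
    exact (Scheme.basicOpen_of_isUnit _ hu).ge trivial
  · intro hq h0
    rw [h0, Scheme.basicOpen_zero] at hq
    exact hq

/-- A condition on field-valued points which is locally the nonvanishing of a function defines an
open subscheme. -/
lemma exists_open_of_points {T : Over S}
    (Q : ∀ (K : Type u) [Field K] (σ : Spec (.of K) ⟶ S), (Over.mk σ ⟶ T) → Prop)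
    (h : ∀ p : T.left, ∃ U : T.left.Opens, p ∈ U ∧ ∃ d : Fn (restr T U),
      ∀ (K : Type u) [Field K] (σ : Spec (.of K) ⟶ S) (x : Over.mk σ ⟶ restr T U),
        Q K σ (x ≫ restrι T U) ↔ Fn.pull x d ≠ 0) :
    ∃ D : T.left.Opens, QuasiCompact D.ι ∧
      (∀ (K : Type u) [Field K] (σ : Spec (.of K) ⟶ S) (x : Over.mk σ ⟶ T)
        (q : (Over.mk σ).left), x.left q ∈ D ↔ Q K σ x) ∧
      ∀ {T' : Over S} (f : T' ⟶ T), (∀ p, f.left p ∈ D) ↔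
        ∀ (K : Type u) [Field K] (σ : Spec (.of K) ⟶ S) (x : Over.mk σ ⟶ T'), Q K σ (x ≫ f) := by
  choose U hU d hd using h
  -- The union of the local nonvanishing loci. These loci agree on overlaps because `Q` is tested at
  -- field-valued points and does not depend on the choice of `d p`.
  let D : T.left.Opens := ⨆ p, (U p).ι ''ᵁ (U p).toScheme.basicOpen (d p)
  have hQ : ∀ (p) (K : Type u) [Field K] (σ : Spec (.of K) ⟶ S) (x : Over.mk σ ⟶ T)
      (q : (Over.mk σ).left), x.left q ∈ U p →
      (x.left q ∈ (U p).ι ''ᵁ (U p).toScheme.basicOpen (d p) ↔ Q K σ x) := by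
    intro p K _ σ x q hq
    have hq' : ∀ q', x.left q' ∈ U p := by
      intro q'
      have : q' = q := (inferInstance : Subsingleton (PrimeSpectrum K)).elim q' q
      rwa [this]
    have hx : liftRestr x (U p) hq' ≫ restrι T (U p) = x := liftRestr_restrι _ _ _
    have h1 := hd p K σ (liftRestr x (U p) hq')
    rw [hx, pull_ne_zero_iff _ _ q] at h1
    rw [h1]
    have hx' : (U p).ι ((liftRestr x (U p) hq').left q) = x.left q :=
      congrArg (fun f => f.left q) hx
    constructor
    · rintro ⟨z, hz, hz'⟩
      rw [← hx'] at hz'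
      rw [← (U p).ι.injective hz']
      exact hz
    · intro hz
      exact ⟨_, hz, hx'⟩
  have hQ' : ∀ (K : Type u) [Field K] (σ : Spec (.of K) ⟶ S) (x : Over.mk σ ⟶ T)
      (q : (Over.mk σ).left), x.left q ∈ D ↔ Q K σ x := by
    intro K _ σ x q
    constructor
    · intro hq
      obtain ⟨p, hp⟩ := TopologicalSpace.Opens.mem_iSup.mp hq
      refine (hQ p K σ x q ?_).mp hp
      obtain ⟨z, _, hz⟩ := hp
      rw [← hz]
      exact z.2
    · intro hx
      exact TopologicalSpace.Opens.mem_iSup.mpr ⟨x.left q, (hQ _ K σ x q (hU _)).mpr hx⟩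
  -- Inside `U p` the union is exactly the basic open set of `d p`; retrocompactness of `D` follows
  -- locally from this.
  have hpt : ∀ p (z : (U p).toScheme), (U p).ι z ∈ D ↔ z ∈ (U p).toScheme.basicOpen (d p) := by
    intro p z
    obtain ⟨K, _, σ, x, hx⟩ := exists_point (T := restr T (U p)) z
    let q : (Over.mk σ).left := (default : PrimeSpectrum K)
    have h1 := hQ' K σ (x ≫ restrι T (U p)) q
    have h2 := hd p K σ x
    rw [pull_ne_zero_iff _ _ q] at h2
    have h3 : (x ≫ restrι T (U p)).left q = (U p).ι z := congrArg (U p).ι (hx q)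
    rw [h3, h2, hx q] at h1
    exact h1
  refine ⟨D, ?_, hQ', fun {T'} f => ⟨fun hf K _ σ x => ?_, fun hf p => ?_⟩⟩
  · rw [quasiCompact_iff_isSpectralMap]
    refine IsRetrocompact_iff_isSpectralMap_subtypeVal.mp (isRetrocompact_of_locally _ fun p =>
      ⟨U p, hU p, ?_⟩)
    have hset : (U p).ι ⁻¹' (D : Set T.left) = (U p).toScheme.basicOpen (d p) := by
      ext z
      exact hpt p z
    rw [hset]
    exact isRetrocompact_basicOpen (d p)
  · exact (hQ' K σ (x ≫ f) (default : PrimeSpectrum K)).mp (hf _)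
  · obtain ⟨K, _, σ, x, hx⟩ := exists_point p
    rw [← hx (default : PrimeSpectrum K)]
    exact (hQ' K σ (x ≫ f) (default : PrimeSpectrum K)).mpr (hf K σ x)

end OpenConditions

/-! ### Functionals, linear maps and bilinear forms -/

section Relative

variable {S : Scheme.{u}} {n n' k : ℕ}

/-- A linear functional on the pullback to `T` of the bundle `V`. -/
structure RelFun (V : VectorBundle S n) (T : Over S) where
  app : ∀ {T' : Over S} (_ : T' ⟶ T), (T' ⟶ V.tot) →ₗ[Fn T'] Fn T'
  app_comp : ∀ {T'' T' : Over S} (g : T'' ⟶ T') (f : T' ⟶ T) (x : T' ⟶ V.tot),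
    app (g ≫ f) (g ≫ x) = Fn.pull g (app f x)

/-- The pullback of a functional. -/
def RelFun.pull {V : VectorBundle S n} {T T₁ : Over S} (c : RelFun V T) (h : T₁ ⟶ T) :
    RelFun V T₁ where
  app f := c.app (f ≫ h)
  app_comp g f x := by
    rw [← c.app_comp]
    rw [Category.assoc]

/-- A linear map between the pullbacks to `T` of the bundles `V` and `V'`. -/
structure RelHom (V : VectorBundle S n) (V' : VectorBundle S n') (T : Over S) where
  app : ∀ {T' : Over S} (_ : T' ⟶ T), (T' ⟶ V.tot) →ₗ[Fn T'] (T' ⟶ V'.tot)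
  app_comp : ∀ {T'' T' : Over S} (g : T'' ⟶ T') (f : T' ⟶ T) (x : T' ⟶ V.tot),
    app (g ≫ f) (g ≫ x) = g ≫ app f x

/-- A bilinear form on the bundle `V`. -/
structure BilForm (V : VectorBundle S n) where
  form : ∀ T : Over S, (T ⟶ V.tot) →ₗ[Fn T] (T ⟶ V.tot) →ₗ[Fn T] Fn T
  form_comp : ∀ {T' T : Over S} (f : T' ⟶ T) (x y : T ⟶ V.tot),
    form T' (f ≫ x) (f ≫ y) = Fn.pull f (form T x y)

/-- The bilinear form is nondegenerate on the subbundle `W` at all field-valued points. -/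
def BilForm.NondegOn {V : VectorBundle S n} (β : BilForm V) {T : Over S} (W : Subbundle V k T) :
    Prop :=
  ∀ (K : Type u) [Field K] (σ : Spec (.of K) ⟶ S) (f : Over.mk σ ⟶ T), ∀ x ∈ W.sec f,
    (∀ y ∈ W.sec f, β.form _ x y = 0) → x = 0

/-- The bilinear form underlying a symplectic form. -/
def SymplecticForm.toBilForm {V : VectorBundle S n} (ω : SymplecticForm V) : BilForm V :=
  ⟨ω.form, ω.form_comp⟩

/-- The functional `β(·, y)`. -/
def BilForm.right {V : VectorBundle S n} (β : BilForm V) {T : Over S} (y : T ⟶ V.tot) :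
    RelFun V T where
  app {T'} f := (β.form T').flip (f ≫ y)
  app_comp g f x := by
    rw [LinearMap.flip_apply, LinearMap.flip_apply, Category.assoc, β.form_comp]

/-- The functional `β(y, ·)`. -/
def BilForm.left {V : VectorBundle S n} (β : BilForm V) {T : Over S} (y : T ⟶ V.tot) :
    RelFun V T where
  app {T'} f := β.form T' (f ≫ y)
  app_comp g f x := by
    rw [Category.assoc, β.form_comp]

variable {V : VectorBundle S n} {V' : VectorBundle S n'} {T : Over S}

lemma Subbundle.comp_mem_id (W : Subbundle V k T) {T' : Over S} (f : T' ⟶ T) {x : T ⟶ V.tot}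
    (hx : x ∈ W.sec (𝟙 T)) : f ≫ x ∈ W.sec f := by
  have := W.comp_mem f (𝟙 T) x hx
  rwa [Category.comp_id] at this

/-- The functionals `c` are jointly injective on `W` at all field-valued points. -/
def PointwiseInjective (W : Subbundle V k T) (c : Fin k → RelFun V T) : Prop :=
  ∀ (K : Type u) [Field K] (σ : Spec (.of K) ⟶ S) (x : Over.mk σ ⟶ T), ∀ v ∈ W.sec x,
    (∀ a, (c a).app x v = 0) → v = 0

/-- The matrix of values of the functionals `c a` on the sections `e b` over `T'`. -/
def relMatrix (c : Fin k → RelFun V T) {T' : Over S} (f : T' ⟶ T) (e : Fin k → (T' ⟶ V.tot)) :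
    Matrix (Fin k) (Fin k) (Fn T') :=
  valueMatrix (fun a => (c a).app f) e

lemma det_relMatrix_comp (c : Fin k → RelFun V T) {T'' T' : Over S} (g : T'' ⟶ T') (f : T' ⟶ T)
    (e : Fin k → (T' ⟶ V.tot)) :
    (relMatrix c (g ≫ f) (fun i => g ≫ e i)).det = Fn.pull g (relMatrix c f e).det := by
  rw [RingHom.map_det]
  congr 1
  ext a b
  exact (c a).app_comp g f (e b)

lemma det_relMatrix_ne_zero_iff {W : Subbundle V k T} (c : Fin k → RelFun V T) {K : Type u}
    [Field K] {σ : Spec (.of K) ⟶ S} (x : Over.mk σ ⟶ T) {e : Fin k → (Over.mk σ ⟶ V.tot)}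
    (he : W.IsFrame x e) :
    (relMatrix c x e).det ≠ 0 ↔ ∀ v ∈ W.sec x, (∀ a, (c a).app x v = 0) → v = 0 := by
  have : IsDomain (Fn (Over.mk σ)) := (isField_fn σ).isDomain
  exact he.isBasisOf.det_ne_zero_iff _

/-- The determinant commutes with pullback and is nonzero at every field-valued point. -/
lemma PointwiseInjective.isUnit_det {W : Subbundle V k T} {c : Fin k → RelFun V T}
    (h : PointwiseInjective W c) {T' : Over S} {f : T' ⟶ T} {e : Fin k → (T' ⟶ V.tot)}
    (he : W.IsFrame f e) : IsUnit (relMatrix c f e).det := by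
  refine isUnit_of_points _ fun K _ σ x => ?_
  rw [← det_relMatrix_comp]
  exact (det_relMatrix_ne_zero_iff c _ (he.comp x)).mpr (h K σ _)

lemma PointwiseInjective.eq_of_app_eq {W : Subbundle V k T} {c : Fin k → RelFun V T}
    (h : PointwiseInjective W c) {T' : Over S} {f : T' ⟶ T} {s s' : T' ⟶ V.tot}
    (hs : s ∈ W.sec f) (hs' : s' ∈ W.sec f) (hc : ∀ a, (c a).app f s = (c a).app f s') :
    s = s' := by
  refine hom_ext_of_locally fun p => ?_
  obtain ⟨U, hU, e, he⟩ := W.exists_isFrame_comp f p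
  refine ⟨U, hU, (he.isBasisOf.existsUnique_of_isUnit _ (h.isUnit_det he)
    fun a => (c a).app _ (restrι T' U ≫ s')).unique ⟨W.comp_mem _ _ _ hs, fun a => ?_⟩
    ⟨W.comp_mem _ _ _ hs', fun a => rfl⟩⟩
  rw [(c a).app_comp, (c a).app_comp, hc]

/-- In a local frame this is a linear system with invertible matrix. Its solution is unique, so the
local solutions glue. -/
lemma PointwiseInjective.exists_section {W : Subbundle V k T} {c : Fin k → RelFun V T}
    (h : PointwiseInjective W c) (y : Fin k → Fn T) :
    ∃ s ∈ W.sec (𝟙 T), ∀ a, (c a).app (𝟙 T) s = y a := by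
  obtain ⟨s, hs⟩ := exists_of_locally (T := T) (X := V.tot)
    (fun {T'} f x => x ∈ W.sec f ∧ ∀ a, (c a).app f x = Fn.pull f (y a))
    (fun g f x hx => ⟨W.comp_mem g f x hx.1, fun a => by
      rw [(c a).app_comp, hx.2, Fn.pull_comp]⟩)
    (fun f x y hx hy => h.eq_of_app_eq hx.1 hy.1 fun a => (hx.2 a).trans (hy.2 a).symm)
    (fun p => by
      obtain ⟨U, hU, e, he⟩ := W.exists_isFrame p
      obtain ⟨s, hs, -⟩ := he.isBasisOf.existsUnique_of_isUnit _ (h.isUnit_det he)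
        fun a => Fn.pull (restrι T U) (y a)
      exact ⟨U, hU, s, hs⟩)
  refine ⟨s, W.mem_of_locally _ _ fun p => ?_, fun a => Fn.ext_of_locally fun p => ?_⟩
  · obtain ⟨U, hU, hs, -⟩ := hs p
    exact ⟨U, hU, by rwa [Category.comp_id]⟩
  · obtain ⟨U, hU, -, hs⟩ := hs p
    refine ⟨U, hU, ?_⟩
    rw [← hs a, ← (c a).app_comp, Category.comp_id]

/-- Being orthogonal to a frame means being orthogonal to all of `W`. Results on families of
functionals thereby apply to nondegenerate forms. -/
lemma BilForm.pointwiseInjective_of_isFrame (β : BilForm V) {W : Subbundle V k T}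
    (h : β.NondegOn W) {T' : Over S} {f : T' ⟶ T} {e : Fin k → (T' ⟶ V.tot)}
    (he : W.IsFrame f e) : PointwiseInjective (W.pull f) (fun a => β.right (e a)) := by
  intro K _ σ x v hv hc
  refine h K σ (x ≫ f) v hv fun y hy => ?_
  obtain ⟨z, rfl⟩ := (he x).exists_eq_sum hy
  rw [map_sum]
  refine Finset.sum_eq_zero fun i _ => ?_
  rw [map_smul]
  exact (congrArg (z i • ·) (hc i)).trans (smul_zero _)

lemma BilForm.NondegOn.eq_of_form_eq {β : BilForm V} {W : Subbundle V k T} (h : β.NondegOn W)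
    {T' : Over S} {f : T' ⟶ T} {s s' : T' ⟶ V.tot} (hs : s ∈ W.sec f) (hs' : s' ∈ W.sec f)
    (hc : ∀ {T'' : Over S} (g : T'' ⟶ T'), ∀ u ∈ W.sec (g ≫ f),
      β.form T'' (g ≫ s) u = β.form T'' (g ≫ s') u) : s = s' := by
  refine hom_ext_of_locally fun p => ?_
  obtain ⟨U, hU, e, he⟩ := W.exists_isFrame_comp f p
  refine ⟨U, hU, (β.pointwiseInjective_of_isFrame h he).eq_of_app_eq (f := 𝟙 _) ?_ ?_ fun a => ?_⟩
  · change _ ∈ W.sec (𝟙 _ ≫ _)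
    rw [Category.id_comp]
    exact W.comp_mem _ _ _ hs
  · change _ ∈ W.sec (𝟙 _ ≫ _)
    rw [Category.id_comp]
    exact W.comp_mem _ _ _ hs'
  · refine hc _ _ ?_
    rw [Category.id_comp]
    exact he.isBasisOf.mem a

/-- Over any base a nondegenerate form on `W` represents every functional: locally `s` solves `β(s,
e_a) = l(e_a)` for a frame `e`, and uniqueness glues. This produces the components of a graph as
well as the sections `s_±`. -/
lemma BilForm.NondegOn.exists_dual {β : BilForm V} {W : Subbundle V k T} (h : β.NondegOn W)
    (l : RelFun V T) : ∃ s ∈ W.sec (𝟙 T), ∀ {T' : Over S} (f : T' ⟶ T), ∀ u ∈ W.sec f,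
      β.form T' (f ≫ s) u = l.app f u := by
  let P : ∀ {T' : Over S}, (T' ⟶ T) → (T' ⟶ V.tot) → Prop := fun {T'} f x =>
    x ∈ W.sec f ∧ ∀ {T'' : Over S} (g : T'' ⟶ T'), ∀ u ∈ W.sec (g ≫ f),
      β.form T'' (g ≫ x) u = l.app (g ≫ f) u
  obtain ⟨s, hs⟩ := exists_of_locally (T := T) (X := V.tot) P
    (fun g f x hx => ⟨W.comp_mem g f x hx.1, fun g' u hu => by
      rw [← Category.assoc] at hu ⊢
      rw [hx.2 (g' ≫ g) u hu, Category.assoc]⟩)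
    (fun f x y hx hy => h.eq_of_form_eq hx.1 hy.1 fun g u hu =>
      (hx.2 g u hu).trans (hy.2 g u hu).symm)
    (fun p => by
      obtain ⟨U, hU, e, he⟩ := W.exists_isFrame p
      obtain ⟨s, hs, hs'⟩ := (β.pointwiseInjective_of_isFrame h he).exists_section
        fun a => l.app (restrι T U) (e a)
      have hs₁ : s ∈ W.sec (restrι T U) := by
        change s ∈ W.sec (𝟙 _ ≫ _) at hs
        rwa [Category.id_comp] at hs
      refine ⟨U, hU, s, hs₁, fun g u hu => ?_⟩
      obtain ⟨z, rfl⟩ := (he g).exists_eq_sum hu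
      rw [map_sum, map_sum]
      refine Finset.sum_congr rfl fun i _ => ?_
      rw [map_smul, map_smul, β.form_comp, l.app_comp, ← hs' i]
      change z i • Fn.pull g (β.form _ s (e i)) = z i • Fn.pull g (β.form _ s (𝟙 _ ≫ e i))
      rw [Category.id_comp])
  refine ⟨s, W.mem_of_locally _ _ fun p => ?_, fun {T'} f u hu => Fn.ext_of_locally fun p => ?_⟩
  · obtain ⟨U, hU, hs, -⟩ := hs p
    exact ⟨U, hU, by rwa [Category.comp_id]⟩
  · obtain ⟨U, hU, -, hs⟩ := hs (f.left p)
    obtain ⟨g, hg⟩ := exists_restr_comp f U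
    refine ⟨f.left ⁻¹ᵁ U, hU, ?_⟩
    have h1 := W.comp_mem (restrι T' (f.left ⁻¹ᵁ U)) f u hu
    have h2 := hs g (restrι T' (f.left ⁻¹ᵁ U) ≫ u) (by rwa [hg])
    rw [← β.form_comp, ← l.app_comp, ← Category.assoc, ← hg, Category.assoc]
    exact h2

lemma BilForm.form_congr (β : BilForm V) {W : Subbundle V k T} {T' : Over S} {f : T' ⟶ T}
    {s : T' ⟶ V.tot} {e : Fin k → (T' ⟶ V.tot)} (he : W.IsFrame f e) :
    (∀ u ∈ W.sec f, β.form T' s u = 0) ↔ ∀ a, (β.form T').flip (e a) s = 0 := by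
  refine ⟨fun h a => h _ (he.isBasisOf.mem a), fun h u hu => ?_⟩
  obtain ⟨z, rfl⟩ := he.isBasisOf.exists_eq_sum hu
  rw [map_sum]
  refine Finset.sum_eq_zero fun i _ => ?_
  rw [map_smul]
  exact (congrArg (z i • ·) (h i)).trans (smul_zero _)

/-- The locus over which a bilinear form is nondegenerate on a subbundle. -/
lemma BilForm.exists_open_nondegOn (β : BilForm V) (W : Subbundle V k T) :
    ∃ D : T.left.Opens, QuasiCompact D.ι ∧
      ∀ {T' : Over S} (f : T' ⟶ T), (∀ p, f.left p ∈ D) ↔ β.NondegOn (W.pull f) := by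
  obtain ⟨D, hD, -, hD'⟩ := exists_open_of_points (T := T)
    (fun K _ σ f => ∀ x ∈ W.sec f, (∀ y ∈ W.sec f, β.form _ x y = 0) → x = 0) fun p => by
      obtain ⟨U, hU, e, he⟩ := W.exists_isFrame p
      refine ⟨U, hU, (relMatrix (fun a => β.right (e a)) (𝟙 _) e).det, fun K _ σ x => ?_⟩
      have he' : (W.pull (restrι T U)).IsFrame x (fun i => x ≫ e i) := by
        intro T'' g
        have := he.comp x g
        rw [← Category.assoc] at this
        exact this
      rw [← det_relMatrix_comp, Category.comp_id, det_relMatrix_ne_zero_iff _ _ he']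
      refine forall₂_congr fun v hv => imp_congr_left ?_
      exact β.form_congr (he.comp x)
  exact ⟨D, hD, fun f => hD' f⟩

lemma exists_open_pointwiseInjective (W : Subbundle V k T) (c : Fin k → RelFun V T) :
    ∃ D : T.left.Opens,
      (∀ (K : Type u) [Field K] (σ : Spec (.of K) ⟶ S) (x : Over.mk σ ⟶ T)
        (q : (Over.mk σ).left), x.left q ∈ D ↔
          ∀ v ∈ W.sec x, (∀ a, (c a).app x v = 0) → v = 0) ∧
      ∀ {T' : Over S} (f : T' ⟶ T), (∀ p, f.left p ∈ D) ↔
        PointwiseInjective (W.pull f) (fun a => (c a).pull f) := by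
  obtain ⟨D, -, hD, hD'⟩ := exists_open_of_points (T := T)
    (fun K _ σ x => ∀ v ∈ W.sec x, (∀ a, (c a).app x v = 0) → v = 0) fun p => by
      obtain ⟨U, hU, e, he⟩ := W.exists_isFrame p
      refine ⟨U, hU, (relMatrix c (restrι T U) e).det, fun K _ σ x => ?_⟩
      rw [← det_relMatrix_comp, det_relMatrix_ne_zero_iff _ _ (he.comp x)]
  exact ⟨D, hD, fun f => hD' f⟩

/-! ### Images of subbundles -/

/-- A family of maps, natural in `T' ⟶ T`, which is a left inverse of `θ` on the subbundle `W`. -/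
structure RelHom.LeftInverseOn (θ : RelHom V V' T) (W : Subbundle V k T) where
  inv : ∀ {T' : Over S} (_ : T' ⟶ T), (T' ⟶ V'.tot) → (T' ⟶ V.tot)
  inv_comp : ∀ {T'' T' : Over S} (g : T'' ⟶ T') (f : T' ⟶ T) (x : T' ⟶ V'.tot),
    inv (g ≫ f) (g ≫ x) = g ≫ inv f x
  inv_app : ∀ {T' : Over S} (f : T' ⟶ T), ∀ x ∈ W.sec f, inv f (θ.app f x) = x

/-- The image of a subbundle under a linear map with a left inverse. -/
def Subbundle.image (W : Subbundle V k T) (θ : RelHom V V' T) (ρ : θ.LeftInverseOn W) :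
    Subbundle V' k T where
  sec f := (W.sec f).map (θ.app f)
  comp_mem g f x hx := by
    obtain ⟨w, hw, rfl⟩ := hx
    exact ⟨g ≫ w, W.comp_mem g f w hw, θ.app_comp g f w⟩
  mem_of_locally {T'} f x h := by
    -- The left inverse supplies a global candidate for the preimage, which locally coincides with
    -- the given preimages.
    refine ⟨ρ.inv f x, W.mem_of_locally f _ fun p => ?_, hom_ext_of_locally fun p => ?_⟩
    · obtain ⟨U, hU, w, hw, hwx⟩ := h p
      refine ⟨U, hU, ?_⟩
      rwa [← ρ.inv_comp, ← hwx, ρ.inv_app _ _ hw]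
    · obtain ⟨U, hU, w, hw, hwx⟩ := h p
      refine ⟨U, hU, ?_⟩
      rw [← θ.app_comp, ← ρ.inv_comp, ← hwx, ρ.inv_app _ _ hw]
  exists_frame p := by
    obtain ⟨U, hU, e, he⟩ := W.exists_frame p
    refine ⟨U, hU, fun i => θ.app (restrι T U) (e i), fun T' f => ?_⟩
    have h := he T' f
    have hfun : (fun i => f ≫ θ.app (restrι T U) (e i)) = θ.app (f ≫ restrι T U) ∘ fun i => f ≫ e i := by
      funext i
      exact (θ.app_comp f _ _).symm
    rw [hfun]
    refine ⟨h.1.map_injOn _ fun x hx y hy hxy => ?_, ?_⟩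
    · rw [h.2] at hx hy
      rw [← ρ.inv_app _ x hx, ← ρ.inv_app _ y hy, hxy]
    · rw [Set.range_comp, ← Submodule.map_span, h.2]

/-- The subbundle spanned by sections which are dual to some functionals. -/
def Subbundle.ofDual (w : Fin k → (T ⟶ V.tot)) (c : Fin k → RelFun V T)
    (hc : ∀ a b, (c a).app (𝟙 T) (w b) = if a = b then 1 else 0) : Subbundle V k T :=
  have hc' : ∀ {T' : Over S} (f : T' ⟶ T) (a b),
      (c a).app f (f ≫ w b) = if a = b then 1 else 0 := by
    intro T' f a b
    have := (c a).app_comp f (𝟙 T) (w b)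
    rw [Category.comp_id, hc] at this
    rw [this]
    split <;> simp
  { sec := fun {T'} f => Submodule.span (Fn T') (Set.range fun b => f ≫ w b)
    comp_mem := fun g f x hx => by
      obtain ⟨z, rfl⟩ := (Submodule.mem_span_range_iff_exists_fun _).mp hx
      rw [V.comp_sum_smul]
      refine Submodule.sum_mem _ fun b _ => Submodule.smul_mem _ _ (Submodule.subset_span ⟨b, ?_⟩)
      exact Category.assoc _ _ _
    mem_of_locally := fun {T'} f x h => by
      -- The dual functionals give globally defined coefficients, so an expansion that is known only
      -- locally holds globally.
      have hx : x = ∑ b, (c b).app f x • (f ≫ w b) := by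
        refine hom_ext_of_locally fun p => ?_
        obtain ⟨U, hU, hx⟩ := h p
        refine ⟨U, hU, ?_⟩
        rw [V.comp_sum_smul]
        refine (eq_sum_of_mem_span _ (hc' (restrι T' U ≫ f)) hx).trans
          (Finset.sum_congr rfl fun b _ => ?_)
        rw [(c b).app_comp, Category.assoc]
      rw [hx]
      exact Submodule.sum_mem _ fun b _ => Submodule.smul_mem _ _ (Submodule.subset_span ⟨b, rfl⟩)
    exists_frame := fun p => by
      refine ⟨⊤, trivial, fun b => restrι T ⊤ ≫ w b, fun T' f => ?_⟩
      have := IsBasisOf.of_dual _ (hc' (f ≫ restrι T ⊤))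
      simp only [Category.assoc] at this
      simp only [Category.assoc]
      exact this }

end Relative

/-! ### Existence and smoothness of Grassmannian bundles -/

section Charts

open MvPolynomial in
-- Affine space over `S` is the base change of the spectrum of a polynomial ring over `ℤ`, and
-- polynomial algebras are smooth.
lemma smooth_affineSpace (n : Type u) [Finite n] (S : Scheme.{u}) : Smooth (𝔸(n; S) ↘ S) := by
  have h : IsPullback (𝔸(n; S) ↘ S) (AffineSpace.toSpecMvPoly n S) (terminal.from S)
      (terminal.from _) := IsPullback.of_hasPullback _ _
  refine MorphismProperty.of_isPullback (P := @Smooth) h.flip ?_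
  have := isIso_of_isTerminal specULiftZIsTerminal.{u} terminalIsTerminal (terminal.from _)
  rw [← terminal.comp_from (Spec.map (CommRingCat.ofHom
      (C : ULift.{u} ℤ →+* MvPolynomial n (ULift.{u} ℤ))))]
  have : Smooth (Spec.map (CommRingCat.ofHom
      (C : ULift.{u} ℤ →+* MvPolynomial n (ULift.{u} ℤ)))) := by
    rw [HasRingHomProperty.Spec_iff (P := @Smooth)]
    change RingHom.Smooth (algebraMap (ULift.{u} ℤ) (MvPolynomial n (ULift.{u} ℤ)))
    rw [RingHom.smooth_algebraMap]
    exact ⟨inferInstance, inferInstance⟩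
  infer_instance

/-- Injectivity means rank `k`, so the rows span a space of dimension `k` and a basis can be chosen
among them. -/
lemma exists_rows_det_ne_zero {K : Type*} [Field K] {n k : ℕ} (A : Matrix (Fin n) (Fin k) K)
    (h : Function.Injective A.mulVec) : ∃ I : Fin k ↪ Fin n, (A.submatrix I id).det ≠ 0 := by
  obtain ⟨κ, a, ha, hs, hli⟩ := exists_linearIndependent' K A.row
  have : Finite κ := Finite.of_injective a ha
  have := Fintype.ofFinite κ
  have hr : A.rank = k := by
    have := LinearMap.finrank_range_of_inj (f := A.mulVecLin) h
    simpa [Matrix.rank] using this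
  have hc : Fintype.card κ = k := by
    rw [← finrank_span_eq_card hli, hs, ← Matrix.rank_eq_finrank_span_row, hr]
  let e : Fin k ≃ κ := (Fintype.equivFinOfCardEq hc).symm
  refine ⟨⟨a ∘ e, ha.comp e.injective⟩, ?_⟩
  have h2 : LinearIndependent K (A.submatrix (a ∘ e) id).row := hli.comp e e.injective
  have := Matrix.linearIndependent_rows_iff_isUnit.mp h2
  exact ((Matrix.isUnit_iff_isUnit_det _).mp this).ne_zero

variable {S : Scheme.{u}} {n k : ℕ} {V : VectorBundle S n}

/-- The sections `e` over the `S`-scheme `A` form a frame of the bundle `V`. -/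
def VectorBundle.IsFrame (V : VectorBundle S n) {A : Over S} (e : Fin n → (A ⟶ V.tot)) : Prop :=
  ∀ (T : Over S) (f : T ⟶ A), IsBasisOf (R := Fn T) (fun i => f ≫ e i) ⊤

namespace VectorBundle.IsFrame

variable {A : Over S} {e : Fin n → (A ⟶ V.tot)}

/-- The basis of sections over `T` given by a frame. -/
def basis (he : V.IsFrame e) {T : Over S} (f : T ⟶ A) :
    Module.Basis (Fin n) (Fn T) (T ⟶ V.tot) :=
  Module.Basis.mk (he T f).1 (he T f).2.ge

lemma basis_apply (he : V.IsFrame e) {T : Over S} (f : T ⟶ A) (i : Fin n) :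
    he.basis f i = f ≫ e i :=
  Module.Basis.mk_apply _ _ i

/-- The coordinate functionals of a frame. -/
def coord (he : V.IsFrame e) (i : Fin n) : RelFun V A where
  app f := (he.basis f).coord i
  app_comp {T'' T'} g f x := by
    have h1 : g ≫ x = ∑ j, Fn.pull g ((he.basis f).coord j x) • he.basis (g ≫ f) j := by
      conv_lhs => rw [← (he.basis f).sum_repr x]
      rw [V.comp_sum_smul]
      refine Finset.sum_congr rfl fun j _ => ?_
      rw [basis_apply, basis_apply, Category.assoc]
      rfl
    rw [h1, map_sum, Finset.sum_eq_single i]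
    · have h2 : (he.basis (g ≫ f)).coord i (he.basis (g ≫ f) i) = 1 := by
        change (he.basis (g ≫ f)).repr (he.basis (g ≫ f) i) i = 1
        rw [Module.Basis.repr_self, Finsupp.single_eq_same]
      rw [map_smul, h2, smul_eq_mul, mul_one]
    · intro j _ hj
      have h2 : (he.basis (g ≫ f)).coord i (he.basis (g ≫ f) j) = 0 := by
        change (he.basis (g ≫ f)).repr (he.basis (g ≫ f) j) i = 0
        rw [Module.Basis.repr_self, Finsupp.single_eq_of_ne (Ne.symm hj)]
      rw [map_smul, h2, smul_zero]
    · simp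

lemma coord_comp_frame (he : V.IsFrame e) {T : Over S} (f : T ⟶ A) (i j : Fin n) :
    (he.coord i).app f (f ≫ e j) = if i = j then 1 else 0 := by
  rw [← he.basis_apply f]
  change (he.basis f).repr (he.basis f j) i = _
  rw [Module.Basis.repr_self, Finsupp.single_apply]
  simp only [eq_comm]

lemma ext_coord (he : V.IsFrame e) {T : Over S} (f : T ⟶ A) {x y : T ⟶ V.tot}
    (h : ∀ i, (he.coord i).app f x = (he.coord i).app f y) : x = y :=
  (he.basis f).ext_elem h

end VectorBundle.IsFrame

/-- The index set of the coordinates of the standard chart of the Grassmannian of rank `k`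
subbundles of a bundle of rank `n` at the set of rows `I`. -/
abbrev ChartIndex (I : Fin k ↪ Fin n) : Type u := ULift.{u} (Fin k × {j // j ∉ Set.range I})

/-- A standard chart of a Grassmannian bundle. -/
def chart (U : S.Opens) (I : Fin k ↪ Fin n) : Over S :=
  Over.mk ((𝔸(ChartIndex.{u} I; U.toScheme) ↘ U.toScheme) ≫ U.ι)

/-- The projection of a chart to the open subscheme of `S` over which it lies. -/
def chartBase (U : S.Opens) (I : Fin k ↪ Fin n) : chart U I ⟶ Over.mk U.ι :=
  Over.homMk (𝔸(ChartIndex.{u} I; U.toScheme) ↘ U.toScheme) rfl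

/-- The coordinates of a chart. -/
def chartCoord (U : S.Opens) (I : Fin k ↪ Fin n) (b : Fin k) (j : {j // j ∉ Set.range I}) :
    Fn (chart U I) :=
  AffineSpace.coord U.toScheme (ULift.up (b, j))

lemma smooth_chart (U : S.Opens) (I : Fin k ↪ Fin n) : Smooth (chart U I).hom := by
  have := smooth_affineSpace (ChartIndex.{u} I) U.toScheme
  exact inferInstanceAs (Smooth ((𝔸(ChartIndex.{u} I; U.toScheme) ↘ U.toScheme) ≫ U.ι))

instance (U : S.Opens) (T : Over S) : Subsingleton (T ⟶ Over.mk U.ι) := by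
  refine ⟨fun a b => ?_⟩
  ext1
  rw [← cancel_mono U.ι]
  exact (Over.w a).trans (Over.w b).symm

lemma chart_ext {U : S.Opens} {I : Fin k ↪ Fin n} {T : Over S} {h h' : T ⟶ chart U I}
    (hc : ∀ b j, Fn.pull h (chartCoord U I b j) = Fn.pull h' (chartCoord U I b j)) : h = h' := by
  ext1
  refine AffineSpace.hom_ext ?_ fun i => hc i.down.1 i.down.2
  exact congrArg (fun z => z.left) (Subsingleton.elim (h ≫ chartBase U I) (h' ≫ chartBase U I))

lemma exists_chart_hom {U : S.Opens} {I : Fin k ↪ Fin n} {T : Over S} (g : T ⟶ Over.mk U.ι)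
    (t : Fin k → {j // j ∉ Set.range I} → Fn T) :
    ∃ h : T ⟶ chart U I, ∀ b j, Fn.pull h (chartCoord U I b j) = t b j := by
  refine ⟨Over.homMk (AffineSpace.homOfVector g.left fun i => t i.down.1 i.down.2) ?_,
    fun b j => AffineSpace.homOfVector_appTop_coord _ _ _⟩
  exact (AffineSpace.homOfVector_over_assoc _ _ _).trans (Over.w g)

section Frame

variable {U : S.Opens} {e : Fin n → (Over.mk U.ι ⟶ V.tot)} (I : Fin k ↪ Fin n)

/-- The sections spanning the universal subbundle on a chart. -/
def chartSection (e : Fin n → (Over.mk U.ι ⟶ V.tot)) (b : Fin k) : chart U I ⟶ V.tot :=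
  chartBase U I ≫ e (I b) + ∑ j, chartCoord U I b j • (chartBase U I ≫ e j)

variable {I}

lemma coord_chartSection (he : V.IsFrame e) {T : Over S} (h : T ⟶ chart U I) (g : T ⟶ Over.mk U.ι)
    (i : Fin n) (b : Fin k) : (he.coord i).app g (h ≫ chartSection I e b) =
      (if i = I b then 1 else 0) +
        ∑ j, Fn.pull h (chartCoord U I b j) * (if i = j.1 then 1 else 0) := by
  obtain rfl : g = h ≫ chartBase U I := Subsingleton.elim _ _
  rw [chartSection, V.comp_add, V.comp_sum_smul, map_add, map_sum]
  simp only [map_smul, smul_eq_mul, ← Category.assoc, he.coord_comp_frame]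

lemma coord_chartSection_mem (he : V.IsFrame e) {T : Over S} (h : T ⟶ chart U I)
    (g : T ⟶ Over.mk U.ι) (a b : Fin k) :
    (he.coord (I a)).app g (h ≫ chartSection I e b) = if a = b then 1 else 0 := by
  rw [coord_chartSection he, Finset.sum_eq_zero fun j _ => ?_, add_zero]
  · simp only [I.injective.eq_iff]
  · rw [if_neg, mul_zero]
    intro hj
    exact j.2 ⟨a, hj⟩

lemma coord_chartSection_notMem (he : V.IsFrame e) {T : Over S} (h : T ⟶ chart U I)
    (g : T ⟶ Over.mk U.ι) (j : {j // j ∉ Set.range I}) (b : Fin k) :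
    (he.coord j).app g (h ≫ chartSection I e b) = Fn.pull h (chartCoord U I b j) := by
  rw [coord_chartSection he, if_neg, zero_add, Finset.sum_eq_single j]
  · simp
  · intro i _ hi
    rw [if_neg, mul_zero]
    exact fun hji => hi (Subtype.ext hji.symm)
  · simp
  · exact fun hj => j.2 ⟨b, hj.symm⟩

variable (I) in
/-- The universal subbundle on a chart. -/
def chartSubbundle (he : V.IsFrame e) : Subbundle V k (chart U I) :=
  Subbundle.ofDual (chartSection I e) (fun a => (he.coord (I a)).pull (chartBase U I)) fun a b => by
    rw [← coord_chartSection_mem he (𝟙 (chart U I)) (𝟙 (chart U I) ≫ chartBase U I), Category.id_comp]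
    rfl

lemma eq_sum_of_mem_chartSubbundle (he : V.IsFrame e) {T : Over S} (h : T ⟶ chart U I)
    (g : T ⟶ Over.mk U.ι) {x : T ⟶ V.tot} (hx : x ∈ (chartSubbundle I he).sec h) :
    x = ∑ b, (he.coord (I b)).app g x • (h ≫ chartSection I e b) :=
  eq_sum_of_mem_span (fun a => (he.coord (I a)).app g) (coord_chartSection_mem he h g) hx

lemma chartSection_mem (he : V.IsFrame e) {T : Over S} (h : T ⟶ chart U I) (b : Fin k) :
    h ≫ chartSection I e b ∈ (chartSubbundle I he).sec h :=
  Submodule.subset_span ⟨b, rfl⟩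

/-- The subbundle contains only one section whose coordinates in `I` form the `b`-th unit vector,
and the remaining coordinates of that section are the coordinates of the chart. -/
lemma chartSubbundle_pull_injective (he : V.IsFrame e) {T : Over S} {h h' : T ⟶ chart U I}
    (hh : (chartSubbundle I he).pull h = (chartSubbundle I he).pull h') : h = h' := by
  have hs : (chartSubbundle I he).sec h = (chartSubbundle I he).sec h' := by
    have := congrArg (fun W => W.sec (𝟙 T)) hh
    change (chartSubbundle I he).sec (𝟙 T ≫ h) = (chartSubbundle I he).sec (𝟙 T ≫ h') at this
    rwa [Category.id_comp, Category.id_comp] at this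
  have g := h ≫ chartBase U I
  refine chart_ext fun b j => ?_
  have h1 := chartSection_mem he h b
  rw [hs] at h1
  have h2 := eq_sum_of_mem_chartSubbundle he h' g h1
  rw [Finset.sum_eq_single b, coord_chartSection_mem, if_pos rfl, one_smul] at h2
  · rw [← coord_chartSection_notMem he h g, ← coord_chartSection_notMem he h' g, h2]
  · intro a _ ha
    rw [coord_chartSection_mem, if_neg ha, zero_smul]
  · simp

/-- A subbundle on which the coordinates `I` are jointly injective comes from the chart at `I`. -/
lemma exists_chart_of_pointwiseInjective (he : V.IsFrame e) {T : Over S} (W : Subbundle V k T)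
    (g : T ⟶ Over.mk U.ι) (hW : PointwiseInjective W (fun a => (he.coord (I a)).pull g)) :
    ∃ h : T ⟶ chart U I, (chartSubbundle I he).pull h = W := by
  -- The frame of `W` normalized to the identity matrix in the rows `I`; its other rows are the
  -- coordinates of the required point of the chart.
  choose w hw hc using fun b => hW.exists_section fun a => if a = b then 1 else 0
  have hc' : ∀ a b, (he.coord (I a)).app g (w b) = if a = b then 1 else 0 := by
    intro a b
    rw [← hc b a]
    change _ = (he.coord (I a)).app (𝟙 T ≫ g) (w b)
    rw [Category.id_comp]
  obtain ⟨h, hh⟩ := exists_chart_hom g fun b (j : {j // j ∉ Set.range I}) =>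
    (he.coord j).app g (w b)
  have hhw : ∀ b, h ≫ chartSection I e b = w b := by
    intro b
    refine he.ext_coord g fun i => ?_
    by_cases hi : i ∈ Set.range I
    · obtain ⟨a, rfl⟩ := hi
      rw [coord_chartSection_mem, hc']
    · exact (coord_chartSection_notMem he h g ⟨i, hi⟩ b).trans (hh b ⟨i, hi⟩)
  refine ⟨h, Subbundle.ext_of_sec_le (fun {T'} f x hx => ?_) fun {T'} f x hx => ?_⟩
  · obtain ⟨z, rfl⟩ := (Submodule.mem_span_range_iff_exists_fun _).mp hx
    refine Submodule.sum_mem _ fun b _ => Submodule.smul_mem _ _ ?_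
    rw [Category.assoc, hhw]
    exact W.comp_mem_id f (hw b)
  · have hx' : x = ∑ b, (he.coord (I b)).app (f ≫ g) x • (f ≫ w b) := by
      refine hW.eq_of_app_eq hx (Submodule.sum_mem _ fun b _ => Submodule.smul_mem _ _
        (W.comp_mem_id f (hw b))) fun a => ?_
      rw [map_sum]
      simp only [map_smul, smul_eq_mul]
      change (he.coord (I a)).app (f ≫ g) x = ∑ b, _ * (he.coord (I a)).app (f ≫ g) (f ≫ w b)
      simp only [RelFun.app_comp, hc']
      rw [Finset.sum_eq_single a]
      · simp
      · intro b _ hb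
        rw [if_neg (Ne.symm hb), map_zero, mul_zero]
      · simp
    rw [hx']
    refine Submodule.sum_mem _ fun b _ => Submodule.smul_mem _ _ ?_
    rw [← hhw, ← Category.assoc]
    exact chartSection_mem he _ b

lemma pointwiseInjective_of_chart (he : V.IsFrame e) {T : Over S} (g : T ⟶ Over.mk U.ι)
    (h : T ⟶ chart U I) : PointwiseInjective ((chartSubbundle I he).pull h)
      (fun a => (he.coord (I a)).pull g) := by
  intro K _ σ x v hv hc
  rw [eq_sum_of_mem_chartSubbundle he (x ≫ h) (x ≫ g) hv]
  refine Finset.sum_eq_zero fun b _ => ?_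
  have := hc b
  change (he.coord (I b)).app (x ≫ g) v = 0 at this
  rw [this, zero_smul]

end Frame

lemma exists_lift_preimage {T : Over S} (U : S.Opens) :
    Nonempty (restr T (T.hom ⁻¹ᵁ U) ⟶ Over.mk U.ι) :=
  ⟨Over.homMk (T.hom ∣_ U) (by
    change T.hom ∣_ U ≫ U.ι = (T.hom ⁻¹ᵁ U).ι ≫ T.hom
    rw [morphismRestrict_ι])⟩

/-- The open subscheme of `T` over which a subbundle comes from a chart. -/
lemma exists_open_chart {U : S.Opens} {e : Fin n → (Over.mk U.ι ⟶ V.tot)} (he : V.IsFrame e)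
    (I : Fin k ↪ Fin n) {T : Over S} (W : Subbundle V k T) :
    ∃ D : T.left.Opens,
      (∀ {T' : Over S} (f : T' ⟶ T), (∀ p, f.left p ∈ D) ↔
        ∃ h : T' ⟶ chart U I, (chartSubbundle I he).pull h = W.pull f) ∧
      ∀ (K : Type u) [Field K] (σ : Spec (.of K) ⟶ S) (x : Over.mk σ ⟶ T)
        (g : Over.mk σ ⟶ Over.mk U.ι) (q : (Over.mk σ).left),
        (∀ v ∈ W.sec x, (∀ a, (he.coord (I a)).app g v = 0) → v = 0) → x.left q ∈ D := by
  obtain ⟨g⟩ := exists_lift_preimage (T := T) U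
  set TU := T.hom ⁻¹ᵁ U
  have hlift : ∀ {T' : Over S} (f : T' ⟶ T), (T' ⟶ Over.mk U.ι) → ∀ p, f.left p ∈ TU := by
    intro T' f g' p
    change T.hom (f.left p) ∈ U
    have h1 : f.left ≫ T.hom = g'.left ≫ U.ι := (Over.w f).trans (Over.w g').symm
    have h2 : T.hom (f.left p) = U.ι (g'.left p) := congrArg (fun z => z p) h1
    rw [h2]
    exact (g'.left p).2
  obtain ⟨D, hD, hD'⟩ := exists_open_pointwiseInjective (W.pull (restrι T TU))
    (fun a => (he.coord (I a)).pull g)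
  have hmem : ∀ {T' : Over S} (f' : T' ⟶ restr T TU) (p : T'.left),
      (f' ≫ restrι T TU).left p ∈ TU.ι ''ᵁ D ↔ f'.left p ∈ D := by
    intro T' f' p
    constructor
    · rintro ⟨z, hz, hz'⟩
      have h : z = f'.left p := TU.ι.injective hz'
      exact h ▸ hz
    · exact fun h => ⟨_, h, rfl⟩
  -- The part of `T` over `U` where the coordinates in `I` are jointly injective on `W`, regarded as
  -- an open subscheme of `T`.
  refine ⟨TU.ι ''ᵁ D, fun {T'} f => ⟨fun hf => ?_, ?_⟩, fun K _ σ x g' q hx => ?_⟩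
  · have hfU : ∀ p, f.left p ∈ TU := by
      intro p
      obtain ⟨z, _, hz⟩ := hf p
      rw [← hz]
      exact z.2
    have hf' : liftRestr f TU hfU ≫ restrι T TU = f := liftRestr_restrι _ _ _
    generalize liftRestr f TU hfU = f' at hf'
    subst hf'
    have h1 := (hD' f').mp fun p => (hmem f' p).mp (hf p)
    have h2 := exists_chart_of_pointwiseInjective he ((W.pull (restrι T TU)).pull f') (f' ≫ g)
      (fun K _ σ x v hv hc => h1 K σ x v hv fun a => by
        rw [← hc a]
        change (he.coord (I a)).app ((x ≫ f') ≫ g) v = (he.coord (I a)).app (x ≫ f' ≫ g) v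
        rw [Category.assoc])
    obtain ⟨h, hh⟩ := h2
    refine ⟨h, hh.trans ?_⟩
    apply Subbundle.ext
    funext T'' q
    exact congrArg (fun z => W.sec z) (Category.assoc _ _ _)
  · rintro ⟨h, hh⟩
    have hf' := liftRestr_restrι f TU (hlift f (h ≫ chartBase U I))
    generalize liftRestr f TU (hlift f (h ≫ chartBase U I)) = f' at hf'
    subst hf'
    refine fun p => (hmem f' p).mpr ((hD' f').mpr (fun K _ σ x v hv hc => ?_) p)
    refine pointwiseInjective_of_chart he (f' ≫ g) h K σ x v ?_ fun a => ?_
    · rw [hh]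
      change v ∈ W.sec ((x ≫ f') ≫ restrι T TU) at hv
      rwa [Category.assoc] at hv
    · rw [← hc a]
      change (he.coord (I a)).app (x ≫ f' ≫ g) v = (he.coord (I a)).app ((x ≫ f') ≫ g) v
      rw [Category.assoc]
  · have hx' := liftRestr_restrι x TU (hlift x g')
    generalize liftRestr x TU (hlift x g') = x' at hx'
    subst hx'
    refine (hmem x' q).mpr ((hD K σ x' q).mpr fun v hv hc => hx v hv fun a => ?_)
    obtain rfl : g' = x' ≫ g := Subsingleton.elim _ _
    exact hc a

/-- At the residue field of `p` the coordinates of a frame of `W` form an `n × k` matrix of full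
rank. A nonvanishing minor selects `I`, and `exists_open_chart` spreads this out to a neighbourhood.
-/
lemma exists_chart_mem {U : S.Opens} {e : Fin n → (Over.mk U.ι ⟶ V.tot)} (he : V.IsFrame e)
    {T : Over S} (W : Subbundle V k T) (p : T.left) (hp : T.hom p ∈ U) :
    ∃ (I : Fin k ↪ Fin n) (A : T.left.Opens), p ∈ A ∧
      ∃ h : restr T A ⟶ chart U I, (chartSubbundle I he).pull h = W.pull (restrι T A) := by
  obtain ⟨K, _, σ, x, hx⟩ := exists_point p
  let q : (Over.mk σ).left := (default : PrimeSpectrum K)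
  obtain ⟨B, hB, d, hd⟩ := W.exists_isFrame p
  have hxB := liftRestr_restrι x B fun q => by rw [hx q]; exact hB
  set x' := liftRestr x B fun q => by rw [hx q]; exact hB
  have hdx := Subbundle.IsFrame.isBasisOf (W := W) (f := x' ≫ restrι T B) (hd.comp x')
  rw [hxB] at hdx
  have hxU : ∀ q, x.left q ∈ T.hom ⁻¹ᵁ U := fun q => by rw [hx q]; exact hp
  obtain ⟨g₀⟩ := exists_lift_preimage (T := T) U
  let g : Over.mk σ ⟶ Over.mk U.ι := liftRestr x _ hxU ≫ g₀
  let _ : Field (Fn (Over.mk σ)) := (isField_fn σ).toField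
  obtain ⟨I, hI⟩ := exists_rows_det_ne_zero
    (Matrix.of fun i b => (he.coord i).app g (x' ≫ d b)) (by
      intro y y' hy
      refine hdx.eq_of_sum_eq (he.ext_coord g fun i => ?_)
      have := congrFun hy i
      simp only [map_sum, map_smul, smul_eq_mul]
      simpa [Matrix.mulVec, dotProduct, mul_comm] using this)
  obtain ⟨D, hD, hD'⟩ := exists_open_chart he I W
  refine ⟨I, D, ?_, (hD (restrι T D)).mp fun r => ?_⟩
  · rw [← hx q]
    refine hD' K σ x g q ?_
    exact (hdx.det_ne_zero_iff (fun a => (he.coord (I a)).app g)).mp hI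
  · have := comp_restrι_mem (𝟙 (restr T D)) r
    rwa [Category.id_comp] at this

end Charts

/-! ### Representability of the Grassmannian functor, and smoothness. -/

section Existence

variable {S : Scheme.{u}} {n : ℕ} (V : VectorBundle S n) (k : ℕ)

/-- Grassmannian bundles exist. -/
theorem nonempty_gr : Nonempty (Gr V k) := by
  choose U hU e he using V.exists_frame
  have he' : ∀ s, V.IsFrame (e s) := he
  obtain ⟨X, ⟨h⟩⟩ := exists_representableBy (subbundle_locallySeparated V k)
    (subbundle_locallyGluing V k) (ι := Σ _ : S, (Fin k ↪ Fin n))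
    (fun i => chart (U i.1) i.2) (fun i => chartSubbundle i.2 (he' i.1))
    (fun i T h h' hh => chartSubbundle_pull_injective (he' i.1) hh)
    (fun i T W => by
      obtain ⟨D, hD, -⟩ := exists_open_chart (he' i.1) i.2 W
      exact ⟨D, fun T' f => hD f⟩)
    (fun T W p => by
      obtain ⟨I, A, hA, h, hh⟩ := exists_chart_mem (he' (T.hom p)) W p (hU _)
      exact ⟨A, hA, ⟨T.hom p, I⟩, h, hh⟩)
  exact ⟨⟨X, h⟩⟩

variable {V k} {T : Over S}

/-- The morphism to a Grassmannian bundle given by a subbundle. -/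
def Gr.lift (G : Gr V k) (W : Subbundle V k T) : T ⟶ G.scheme :=
  G.rep.homEquiv.symm W

lemma Gr.homEquiv_eq_pull (G : Gr V k) {T : Over S} (f : T ⟶ G.scheme) :
    G.rep.homEquiv f = G.taut.pull f := by
  have := G.rep.homEquiv_comp f (𝟙 _)
  rwa [Category.comp_id] at this

lemma Gr.taut_pull_lift (G : Gr V k) (W : Subbundle V k T) :
    G.taut.pull (G.lift W) = W :=
  (G.homEquiv_eq_pull _).symm.trans (Equiv.apply_symm_apply _ _)

lemma Gr.hom_ext (G : Gr V k) {T : Over S} {f f' : T ⟶ G.scheme}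
    (h : G.taut.pull f = G.taut.pull f') : f = f' := by
  apply G.rep.homEquiv.injective
  exact (G.homEquiv_eq_pull f).trans (h.trans (G.homEquiv_eq_pull f').symm)

lemma Subbundle.pull_pull (W : Subbundle V k T) {T₁ T₂ : Over S} (g : T₁ ⟶ T) (g' : T₂ ⟶ T₁) :
    (W.pull g).pull g' = W.pull (g' ≫ g) := by
  apply Subbundle.ext
  funext T' f
  exact congrArg (fun z => W.sec z) (Category.assoc _ _ _)

lemma Subbundle.pull_id (W : Subbundle V k T) : W.pull (𝟙 T) = W := by
  apply Subbundle.ext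
  funext T' f
  exact congrArg (fun z => W.sec z) (Category.comp_id f)

lemma smooth_of_locally {X : Over S} (h : ∀ p : X.left, ∃ D : X.left.Opens, p ∈ D ∧
    ∃ C : Over S, Smooth C.hom ∧ Nonempty (restr X D ≅ C)) : Smooth X.hom := by
  choose D hD C hC i using h
  have : IsZariskiLocalAtSource (@Smooth : MorphismProperty Scheme.{u}) :=
    HasRingHomProperty.instIsZariskiLocalAtSource
  refine (IsZariskiLocalAtSource.iff_of_openCover (P := @Smooth)
    (X.left.openCoverOfIsOpenCover D (openCover_of_nhds D hD))).mpr fun p => ?_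
  have h1 : (D p).ι ≫ X.hom = (i p).some.hom.left ≫ (C p).hom := (Over.w (i p).some.hom).symm
  have := hC p
  have : IsIso (i p).some.hom.left := ((Over.forget S).mapIso (i p).some).isIso_hom
  change Smooth ((D p).ι ≫ X.hom)
  rw [h1]
  infer_instance

/-- The open locus where the tautological subbundle comes from a given chart has the same points as
that chart, hence is isomorphic to it; charts are affine spaces over open subschemes of `S`. -/
lemma Gr.smooth (G : Gr V k) : Smooth G.scheme.hom := by
  refine smooth_of_locally fun p => ?_
  obtain ⟨U, hU, e, he'⟩ := V.exists_frame (G.scheme.hom p)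
  have he : V.IsFrame e := he'
  obtain ⟨I, A, hA, h, hh⟩ := exists_chart_mem he G.taut p hU
  obtain ⟨D, hD, -⟩ := exists_open_chart he I G.taut
  have hpD : p ∈ D := (hD (restrι G.scheme A)).mpr ⟨h, hh⟩ ⟨p, hA⟩
  refine ⟨D, hpD, chart U I, smooth_chart U I, ?_⟩
  obtain ⟨a, ha⟩ := (hD (restrι G.scheme D)).mp fun q => q.2
  have hW := G.taut_pull_lift (chartSubbundle I he)
  have hb := (hD (G.lift (chartSubbundle I he))).mpr
    ⟨𝟙 _, (Subbundle.pull_id _).trans hW.symm⟩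
  have hb' := liftRestr_restrι _ D hb
  generalize liftRestr _ D hb = b at hb'
  have hba : G.taut.pull (b ≫ restrι G.scheme D) = chartSubbundle I he := by rw [hb']; exact hW
  refine ⟨⟨a, b, restrι_cancel (G.hom_ext ?_), chartSubbundle_pull_injective he ?_⟩⟩
  · rw [Category.assoc, Category.id_comp, ← ha, ← hba, Subbundle.pull_pull]
  · rw [← Subbundle.pull_pull, ha, Subbundle.pull_pull, Subbundle.pull_id]
    exact hba

end Existence

/-! ### Quaternionic Grassmannian bundles -/

section Quaternionic

variable {S : Scheme.{u}} {n : ℕ} {V : VectorBundle S n} {ω : SymplecticForm V} {r : ℕ}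

lemma HGr.homEquiv_eq_pull (H : HGr ω r) {T : Over S} (f : T ⟶ H.scheme) :
    (H.rep.homEquiv f).1 = H.taut.pull f := by
  have := H.rep.homEquiv_comp f (𝟙 _)
  rw [Category.comp_id] at this
  exact congrArg Subtype.val this

lemma HGr.nondegOn_taut (H : HGr ω r) : ω.NondegOn H.taut :=
  (H.rep.homEquiv (𝟙 _)).2

/-- The morphism to a quaternionic Grassmannian bundle given by a symplectic subbundle. -/
def HGr.lift (H : HGr ω r) {T : Over S} (W : Subbundle V (2 * r) T) (hW : ω.NondegOn W) :
    T ⟶ H.scheme :=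
  H.rep.homEquiv.symm ⟨W, hW⟩

lemma HGr.taut_pull_lift (H : HGr ω r) {T : Over S} (W : Subbundle V (2 * r) T)
    (hW : ω.NondegOn W) : H.taut.pull (H.lift W hW) = W :=
  (H.homEquiv_eq_pull _).symm.trans
    (congrArg Subtype.val (Equiv.apply_symm_apply H.rep.homEquiv ⟨W, hW⟩))

lemma HGr.hom_ext (H : HGr ω r) {T : Over S} {f f' : T ⟶ H.scheme}
    (h : H.taut.pull f = H.taut.pull f') : f = f' := by
  apply H.rep.homEquiv.injective
  apply Subtype.ext
  exact (H.homEquiv_eq_pull f).trans (h.trans (H.homEquiv_eq_pull f').symm)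

lemma HGr.taut_pull_toGr (H : HGr ω r) (G : Gr V (2 * r)) : G.taut.pull (H.toGr G) = H.taut :=
  G.taut_pull_lift _

lemma SymplecticForm.NondegOn.pull {k : ℕ} {T : Over S} {W : Subbundle V k T} (h : ω.NondegOn W)
    {T' : Over S} (f : T' ⟶ T) : ω.NondegOn (W.pull f) :=
  fun K _ σ x => h K σ (x ≫ f)

variable (ω r) in
/-- Quaternionic Grassmannian bundles exist. -/
theorem nonempty_hgr : Nonempty (HGr ω r) := by
  obtain ⟨G⟩ := nonempty_gr V (2 * r)
  -- A subbundle is symplectic exactly when its classifying morphism factors through `D`, so `D` is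
  -- the representing scheme.
  obtain ⟨D, -, hD⟩ := ω.toBilForm.exists_open_nondegOn G.taut
  have hD' : ∀ {T : Over S} (f : T ⟶ G.scheme), (∀ p, f.left p ∈ D) ↔ ω.NondegOn (G.taut.pull f) :=
    hD
  let eq (T : Over S) : (T ⟶ restr G.scheme D) ≃ {W : Subbundle V (2 * r) T // ω.NondegOn W} :=
    { toFun := fun f => ⟨G.taut.pull (f ≫ restrι G.scheme D),
        (hD' _).mp (comp_restrι_mem f)⟩
      invFun := fun W => liftRestr (G.lift W.1) D ((hD' _).mpr (by
        rw [G.taut_pull_lift]; exact W.2))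
      left_inv := fun f => restrι_cancel (G.hom_ext (by
        rw [liftRestr_restrι, G.taut_pull_lift]))
      right_inv := fun W => Subtype.ext (by
        change G.taut.pull (liftRestr _ D _ ≫ restrι G.scheme D) = _
        rw [liftRestr_restrι, G.taut_pull_lift]) }
  refine ⟨⟨restr G.scheme D, ⟨fun {T} => eq T, fun {T T'} f g => ?_⟩⟩⟩
  apply Subtype.ext
  change G.taut.pull ((f ≫ g) ≫ _) = (G.taut.pull (g ≫ _)).pull f
  rw [Subbundle.pull_pull, Category.assoc]

/-- A quaternionic Grassmannian bundle is the open subscheme of the Grassmannian bundle over which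
the form is nondegenerate on the tautological subbundle. -/
lemma HGr.exists_iso_restr (H : HGr ω r) (G : Gr V (2 * r)) :
    ∃ (D : G.scheme.left.Opens) (i : H.scheme ≅ restr G.scheme D), QuasiCompact D.ι ∧
      H.toGr G = i.hom ≫ restrι G.scheme D := by
  obtain ⟨D, hq, hD⟩ := ω.toBilForm.exists_open_nondegOn G.taut
  have hD' : ∀ {T : Over S} (f : T ⟶ G.scheme), (∀ p, f.left p ∈ D) ↔ ω.NondegOn (G.taut.pull f) :=
    hD
  have h1 := (hD' (H.toGr G)).mpr (by rw [H.taut_pull_toGr]; exact H.nondegOn_taut)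
  have h2 : ω.NondegOn (G.taut.pull (restrι G.scheme D)) := (hD' _).mp fun q => q.2
  have h3 : H.lift _ h2 ≫ H.toGr G = restrι G.scheme D := G.hom_ext (by
    rw [← Subbundle.pull_pull, H.taut_pull_toGr, H.taut_pull_lift])
  refine ⟨D, ⟨liftRestr (H.toGr G) D h1, H.lift _ h2, H.hom_ext ?_, restrι_cancel ?_⟩, hq,
    (liftRestr_restrι (H.toGr G) D h1).symm⟩
  · rw [← H.taut_pull_toGr G, Subbundle.pull_pull, Subbundle.pull_pull, Category.assoc, h3,
      liftRestr_restrι, Category.id_comp]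
  · rw [Category.assoc, liftRestr_restrι, h3, Category.id_comp]

lemma HGr.isOpenImmersion_toGr (H : HGr ω r) (G : Gr V (2 * r)) :
    IsOpenImmersion (H.toGr G).left := by
  obtain ⟨D, i, -, h⟩ := H.exists_iso_restr G
  have : IsIso i.hom.left := ((Over.forget S).mapIso i).isIso_hom
  rw [h]
  exact inferInstanceAs (IsOpenImmersion (i.hom.left ≫ D.ι))

lemma HGr.quasiCompact_toGr (H : HGr ω r) (G : Gr V (2 * r)) : QuasiCompact (H.toGr G).left := by
  obtain ⟨D, i, hq, h⟩ := H.exists_iso_restr G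
  have : IsIso i.hom.left := ((Over.forget S).mapIso i).isIso_hom
  rw [h]
  exact inferInstanceAs (QuasiCompact (i.hom.left ≫ D.ι))

lemma HGr.mono_toGr (H : HGr ω r) (G : Gr V (2 * r)) : Mono (H.toGr G) :=
  ⟨fun a b hab => H.hom_ext (by
    rw [← H.taut_pull_toGr G, Subbundle.pull_pull, Subbundle.pull_pull, hab])⟩

lemma HGr.smooth (H : HGr ω r) : Smooth H.scheme.hom := by
  obtain ⟨G⟩ := nonempty_gr V (2 * r)
  have := H.isOpenImmersion_toGr G
  have := G.smooth
  rw [← Over.w (H.toGr G)]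
  infer_instance

end Quaternionic

/-! ### Graphs -/

section Graph

variable {S : Scheme.{u}} {n k : ℕ} {E : VectorBundle S n}

lemma Subbundle.mem_pull {T T₁ T' : Over S} {W : Subbundle E k T} {g : T₁ ⟶ T} {f : T' ⟶ T₁}
    {x : T' ⟶ E.tot} : x ∈ (W.pull g).sec f ↔ x ∈ W.sec (f ≫ g) :=
  Iff.rfl

lemma Subbundle.mem_pull_id {T T' : Over S} {W : Subbundle E k T} {f : T' ⟶ T}
    {x : T' ⟶ E.tot} : x ∈ (W.pull f).sec (𝟙 T') ↔ x ∈ W.sec f := by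
  rw [mem_pull, Category.id_comp]

lemma vec_add {T : Over S} (a a' : Fn T) (x x' : T ⟶ E.tot) (b b' : Fn T) :
    (vec (a + a') (x + x') (b + b') : T ⟶ (extBundle E).tot) = vec a x b + vec a' x' b' :=
  vec_ext (by simp) (by simp) (by simp)

lemma vec_smul {T : Over S} (c a : Fn T) (x : T ⟶ E.tot) (b : Fn T) :
    (vec (c * a) (c • x) (c * b) : T ⟶ (extBundle E).tot) = c • vec a x b :=
  vec_ext (by simp) (by simp) (by simp)

lemma comp_vec {T' T : Over S} (f : T' ⟶ T) (a : Fn T) (x : T ⟶ E.tot) (b : Fn T) :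
    f ≫ (vec a x b : T ⟶ (extBundle E).tot) = vec (Fn.pull f a) (f ≫ x) (Fn.pull f b) :=
  vec_ext (by rw [coordL_comp, coordL_vec, coordL_vec]) (by rw [coordE_comp, coordE_vec, coordE_vec])
    (by rw [coordR_comp, coordR_vec, coordR_vec])

lemma vec_coord {T : Over S} (y : T ⟶ (extBundle E).tot) :
    vec (coordL E T y) (coordE E T y) (coordR E T y) = y :=
  vec_ext (coordL_vec _ _ _) (coordE_vec _ _ _) (coordR_vec _ _ _)

variable (φ : SymplecticForm E) {T : Over S}

lemma extForm_apply (y z : T ⟶ (extBundle E).tot) : (extForm φ).form T y z =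
    coordL E T y * coordR E T z + φ.form T (coordE E T y) (coordE E T z)
      - coordR E T y * coordL E T z :=
  rfl

/-- The linear map `w ↦ (φ(a, w), w, φ(b, w))`. -/
def graphHom (a b : T ⟶ E.tot) : RelHom E (extBundle E) T where
  app {T'} f :=
    { toFun := fun w => vec (φ.form T' (f ≫ a) w) w (φ.form T' (f ≫ b) w)
      map_add' := fun w w' => by rw [map_add, map_add, vec_add]
      map_smul' := fun c w => by
        rw [map_smul, map_smul, smul_eq_mul, smul_eq_mul, vec_smul, RingHom.id_apply] }
  app_comp g f w := by
    refine Eq.trans ?_ (comp_vec g _ _ _).symm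
    rw [← φ.form_comp, ← φ.form_comp, ← Category.assoc, ← Category.assoc]
    rfl

/-- The subbundle `{(φ(a, w), w, φ(b, w)) : w ∈ W}` of `F`. -/
def graph (W : Subbundle E k T) (a b : T ⟶ E.tot) : Subbundle (extBundle E) k T :=
  W.image (graphHom φ a b)
    { inv := fun {T'} _ => coordE E T'
      inv_comp := fun g _ => coordE_comp E g
      inv_app := fun _ w _ => coordE_vec _ w _ }

variable {φ} {W : Subbundle E k T} {a b : T ⟶ E.tot} {T' : Over S}

lemma mem_graph_iff_exists {f : T' ⟶ T} {y : T' ⟶ (extBundle E).tot} :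
    y ∈ (graph φ W a b).sec f ↔
      ∃ w ∈ W.sec f, y = vec (φ.form T' (f ≫ a) w) w (φ.form T' (f ≫ b) w) :=
  exists_congr fun _ => and_congr_right fun _ => eq_comm

lemma vec_mem_graph {f : T' ⟶ T} {w : T' ⟶ E.tot} (hw : w ∈ W.sec f) :
    vec (φ.form T' (f ≫ a) w) w (φ.form T' (f ≫ b) w) ∈ (graph φ W a b).sec f :=
  mem_graph_iff_exists.mpr ⟨w, hw, rfl⟩

lemma mem_graph {f : T' ⟶ T} {y : T' ⟶ (extBundle E).tot} : y ∈ (graph φ W a b).sec f ↔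
    coordE E T' y ∈ W.sec f ∧ coordL E T' y = φ.form T' (f ≫ a) (coordE E T' y) ∧
      coordR E T' y = φ.form T' (f ≫ b) (coordE E T' y) := by
  rw [mem_graph_iff_exists]
  constructor
  · rintro ⟨w, hw, rfl⟩
    rw [coordE_vec, coordL_vec, coordR_vec]
    exact ⟨hw, rfl, rfl⟩
  · rintro ⟨h, hl, hr⟩
    exact ⟨_, h, by rw [← hl, ← hr, vec_coord]⟩

lemma graph_pull (h : T' ⟶ T) : (graph φ W a b).pull h = graph φ (W.pull h) (h ≫ a) (h ≫ b) := by
  refine Subbundle.ext_of_sec_le (fun {T''} f y hy => ?_) fun {T''} f y hy => ?_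
  · rw [Subbundle.mem_pull, mem_graph] at hy
    rw [mem_graph, Subbundle.mem_pull, ← Category.assoc, ← Category.assoc]
    exact hy
  · rw [mem_graph, Subbundle.mem_pull, ← Category.assoc, ← Category.assoc] at hy
    rw [Subbundle.mem_pull, mem_graph]
    exact hy

variable (φ) in
/-- The form `φ` on the components in `E` of sections of `F`. -/
def midForm : BilForm (extBundle E) where
  form T := (φ.form T).compl₁₂ (coordE E T) (coordE E T)
  form_comp f x y := by
    rw [LinearMap.compl₁₂_apply, LinearMap.compl₁₂_apply, coordE_comp, coordE_comp, φ.form_comp]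

lemma midForm_apply (y z : T ⟶ (extBundle E).tot) :
    (midForm φ).form T y z = φ.form T (coordE E T y) (coordE E T z) := rfl

/-- A vector of the graph is determined by its component in `E`, and through this component
`midForm` on the graph becomes `φ` on `W`. -/
lemma midForm_nondegOn_graph (h : φ.NondegOn W) : (midForm φ).NondegOn (graph φ W a b) := by
  intro K _ σ f x hx hy
  have h' := mem_graph.mp hx
  have h0 := h K σ f _ h'.1 fun y hy' => by
    have := hy _ (vec_mem_graph hy')
    rwa [midForm_apply, coordE_vec] at this
  refine vec_ext ?_ ?_ ?_
  · rw [h'.2.1, h0, map_zero, map_zero]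
  · rw [h0, map_zero]
  · rw [h'.2.2, h0, map_zero, map_zero]

/-- A section of a symplectic subbundle is determined by the functional which it represents. -/
lemma SymplecticForm.NondegOn.eq_of_form_eq {V : VectorBundle S n} {ω : SymplecticForm V}
    {U : Subbundle V k T} (h : ω.NondegOn U) {f : T' ⟶ T} {s s' : T' ⟶ V.tot}
    (hs : s ∈ U.sec f) (hs' : s' ∈ U.sec f)
    (hc : ∀ {T'' : Over S} (g : T'' ⟶ T'), ∀ u ∈ U.sec (g ≫ f),
      ω.form T'' (g ≫ s) u = ω.form T'' (g ≫ s') u) : s = s' :=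
  BilForm.NondegOn.eq_of_form_eq (β := ω.toBilForm) h hs hs' hc

/-- `W` is the projection of its graph, and the outer coordinates are the functionals `φ(a, ·)` and
`φ(b, ·)` on `W`. Since `a` and `b` lie in `W`, nondegeneracy recovers them. -/
lemma eq_of_graph_eq (h : φ.NondegOn W) {W' : Subbundle E k T} {a' b' : T ⟶ E.tot}
    (ha : a ∈ W.sec (𝟙 T)) (hb : b ∈ W.sec (𝟙 T)) (ha' : a' ∈ W'.sec (𝟙 T))
    (hb' : b' ∈ W'.sec (𝟙 T)) (hg : graph φ W a b = graph φ W' a' b') :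
    W = W' ∧ a = a' ∧ b = b' := by
  have hW : W = W' := by
    refine Subbundle.ext_of_sec_le (fun f x hx => ?_) fun f x hx => ?_
    · have := vec_mem_graph (φ := φ) (a := a) (b := b) hx
      rw [hg, mem_graph, coordE_vec] at this
      exact this.1
    · have := vec_mem_graph (φ := φ) (a := a') (b := b') hx
      rw [← hg, mem_graph, coordE_vec] at this
      exact this.1
  subst hW
  refine ⟨rfl, h.eq_of_form_eq ha ha' fun g u hu => ?_, h.eq_of_form_eq hb hb' fun g u hu => ?_⟩
  · rw [Category.comp_id] at hu
    have := vec_mem_graph (φ := φ) (a := a) (b := b) hu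
    rw [hg, mem_graph, coordE_vec, coordL_vec] at this
    exact this.2.1
  · rw [Category.comp_id] at hu
    have := vec_mem_graph (φ := φ) (a := a) (b := b) hu
    rw [hg, mem_graph, coordE_vec, coordR_vec] at this
    exact this.2.2

variable (E) in
/-- The first coordinate as a functional. -/
def funL (T : Over S) : RelFun (extBundle E) T where
  app {T'} _ := coordL E T'
  app_comp g _ x := coordL_comp E g x

variable (E) in
/-- The last coordinate as a functional. -/
def funR (T : Over S) : RelFun (extBundle E) T where
  app {T'} _ := coordR E T'
  app_comp g _ x := coordR_comp E g x

variable (E) in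
/-- The component in `E` as a linear map. -/
def homE (T : Over S) : RelHom (extBundle E) E T where
  app {T'} _ := coordE E T'
  app_comp g _ x := coordE_comp E g x

/-- The composition of a functional with a linear map. -/
def RelHom.pullFun {n' : ℕ} {V : VectorBundle S n} {V' : VectorBundle S n'} (θ : RelHom V V' T)
    (c : RelFun V' T) : RelFun V T where
  app f := c.app f ∘ₗ θ.app f
  app_comp g f x := by
    rw [LinearMap.comp_apply, LinearMap.comp_apply, θ.app_comp, c.app_comp]

/-- A subbundle of `F` on which the form `φ` is nondegenerate is a graph. -/
lemma exists_graph_eq (U : Subbundle (extBundle E) k T) (h : (midForm φ).NondegOn U) :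
    ∃ W : Subbundle E k T, φ.NondegOn W ∧ ∃ a ∈ W.sec (𝟙 T), ∃ b ∈ W.sec (𝟙 T),
      graph φ W a b = U := by
  -- For `y` in `E`, the section of `U` representing `u ↦ φ(y, u_E)`. This is a lift to `U` of the
  -- orthogonal projection of `y`, and it will invert the projection of `U` to `E`.
  have hex : ∀ (T' : Over S) (f : T' ⟶ T) (y : T' ⟶ E.tot), ∃ s ∈ U.sec f,
      ∀ {T'' : Over S} (g : T'' ⟶ T'), ∀ u ∈ U.sec (g ≫ f),
        (midForm φ).form T'' (g ≫ s) u = φ.form T'' (g ≫ y) (coordE E T'' u) := by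
    intro T' f y
    have h' : (midForm φ).NondegOn (U.pull f) := fun K _ σ x => h K σ (x ≫ f)
    obtain ⟨s, hs, hs'⟩ := h'.exists_dual ((homE E T').pullFun (φ.toBilForm.left y))
    exact ⟨s, Subbundle.mem_pull_id.mp hs, fun g u hu => hs' g u hu⟩
  choose inv hinv hform using hex
  have hcomp : ∀ {T'' T' : Over S} (g : T'' ⟶ T') (f : T' ⟶ T) (y : T' ⟶ E.tot),
      inv T'' (g ≫ f) (g ≫ y) = g ≫ inv T' f y := by
    intro T'' T' g f y
    refine h.eq_of_form_eq (f := g ≫ f) (hinv T'' (g ≫ f) (g ≫ y)) (U.comp_mem g f _ (hinv T' f y)) ?_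
    intro T₃ g' u hu
    rw [hform _ (g ≫ f) (g ≫ y) g' u hu, ← Category.assoc, ← Category.assoc]
    rw [← Category.assoc] at hu
    exact (hform _ f y (g' ≫ g) u hu).symm
  have happ : ∀ {T' : Over S} (f : T' ⟶ T), ∀ x ∈ U.sec f, inv T' f (coordE E T' x) = x := by
    intro T' f x hx
    refine h.eq_of_form_eq (hinv T' f (coordE E T' x)) hx ?_
    intro T'' g u hu
    rw [hform _ f (coordE E T' x) g u hu, midForm_apply, coordE_comp]
  let ρ : (homE E T).LeftInverseOn U := ⟨fun {T'} f y => inv T' f y, hcomp, happ⟩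
  -- The components in `E` of the sections of `U` dual to the first and the last coordinate are the
  -- required `a` and `b`.
  obtain ⟨sa, hsa, ha⟩ := h.exists_dual (funL E T)
  obtain ⟨sb, hsb, hb⟩ := h.exists_dual (funR E T)
  have hW : φ.NondegOn (U.image (homE E T) ρ) := by
    rintro K _ σ f _ ⟨u, hu, rfl⟩ hy
    have : u = 0 := h K σ f u hu fun v hv => hy _ ⟨v, hv, rfl⟩
    rw [this, map_zero]
  refine ⟨U.image (homE E T) ρ, hW, coordE E T sa, ⟨sa, hsa, rfl⟩, coordE E T sb, ⟨sb, hsb, rfl⟩, ?_⟩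
  have key : ∀ {T' : Over S} (f : T' ⟶ T), ∀ u ∈ U.sec f,
      vec (φ.form T' (f ≫ coordE E T sa) (coordE E T' u)) (coordE E T' u)
        (φ.form T' (f ≫ coordE E T sb) (coordE E T' u)) = u := by
    intro T' f u hu
    have h1 := ha f u hu
    have h2 := hb f u hu
    rw [midForm_apply, coordE_comp] at h1 h2
    rw [h1, h2]
    exact vec_coord u
  refine Subbundle.ext_of_sec_le (fun f y hy => ?_) fun f u hu => ?_
  · obtain ⟨w, ⟨u, hu, rfl⟩, rfl⟩ := mem_graph_iff_exists.mp hy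
    have := key f u hu
    change vec (φ.form _ (f ≫ coordE E T sa) (coordE E _ u)) (coordE E _ u)
      (φ.form _ (f ≫ coordE E T sb) (coordE E _ u)) ∈ _
    rw [this]
    exact hu
  · exact mem_graph_iff_exists.mpr ⟨coordE E _ u, ⟨u, hu, rfl⟩, (key f u hu).symm⟩

end Graph

/-! ### Bundles representing a module-valued functor -/

section OfEquiv

/-- The basis of a submodule underlying `IsBasisOf`. -/
def IsBasisOf.toBasis {R M : Type u} [CommRing R] [AddCommGroup M] [Module R M] {k : ℕ}
    {e : Fin k → M} {W : Submodule R M} (h : IsBasisOf e W) : Module.Basis (Fin k) R W :=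
  (Module.Basis.span h.1).map (LinearEquiv.ofEq _ _ h.2)

lemma IsBasisOf.coe_toBasis {R M : Type u} [CommRing R] [AddCommGroup M] [Module R M] {k : ℕ}
    {e : Fin k → M} {W : Submodule R M} (h : IsBasisOf e W) (i : Fin k) :
    (h.toBasis i : M) = e i := by
  rw [toBasis, Module.Basis.map_apply, LinearEquiv.coe_ofEq_apply, Module.Basis.span_apply]

lemma isBasisOf_top_of_basis {R M : Type u} [CommRing R] [AddCommGroup M] [Module R M] {k : ℕ}
    (B : Module.Basis (Fin k) R M) : IsBasisOf (R := R) B ⊤ :=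
  ⟨B.linearIndependent, B.span_eq⟩

/-- A scheme whose points form a module, naturally and with local frames, is a vector bundle. -/
def VectorBundle.ofEquiv {S : Scheme.{u}} {n : ℕ} (tot : Over S) (M : Over S → Type u)
    [∀ T, AddCommGroup (M T)] [∀ T, Module (Fn T) (M T)] (e : ∀ T, (T ⟶ tot) ≃ M T)
    (res : ∀ {T' T : Over S} (_ : T' ⟶ T), M T → M T')
    (res_add : ∀ {T' T : Over S} (f : T' ⟶ T) (x y : M T), res f (x + y) = res f x + res f y)
    (res_smul : ∀ {T' T : Over S} (f : T' ⟶ T) (a : Fn T) (x : M T),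
      res f (a • x) = Fn.pull f a • res f x)
    (he : ∀ {T' T : Over S} (f : T' ⟶ T) (x : T ⟶ tot), e T' (f ≫ x) = res f (e T x))
    (frame : ∀ s : S, ∃ U : S.Opens, s ∈ U ∧ ∃ b : Fin n → M (Over.mk U.ι),
      ∀ (T : Over S) (f : T ⟶ Over.mk U.ι), IsBasisOf (R := Fn T) (fun i => res f (b i)) ⊤) :
    VectorBundle S n where
  tot := tot
  addCommGroup T := (e T).addCommGroup
  module T := letI := (e T).addCommGroup; (e T).module (Fn T)
  comp_add {T' T} f x y := by
    apply (e T').injective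
    refine Eq.trans ?_ ((e T').apply_symm_apply _).symm
    refine (he f _).trans ?_
    refine (congrArg (res f) ((e T).apply_symm_apply _)).trans ?_
    exact (res_add f _ _).trans (congrArg₂ (· + ·) (he f x).symm (he f y).symm)
  comp_smul {T' T} f a x := by
    apply (e T').injective
    refine Eq.trans ?_ ((e T').apply_symm_apply _).symm
    refine (he f _).trans ?_
    refine (congrArg (res f) ((e T).apply_symm_apply _)).trans ?_
    exact (res_smul f _ _).trans (congrArg (Fn.pull f a • ·) (he f x).symm)
  exists_frame s := by
    obtain ⟨U, hU, b, hb⟩ := frame s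
    refine ⟨U, hU, fun i => (e _).symm (b i), fun T f => ?_⟩
    let _ := (e T).addCommGroup
    let _ := (e T).module (Fn T)
    have h : ∀ i, f ≫ (e _).symm (b i) =
        ((Module.Basis.mk (hb T f).1 (hb T f).2.ge).map ((e T).linearEquiv (Fn T)).symm) i := by
      intro i
      apply (e T).injective
      rw [Module.Basis.map_apply, Module.Basis.mk_apply]
      refine Eq.trans ?_ ((e T).apply_symm_apply _).symm
      rw [he, Equiv.apply_symm_apply]
    have h' := funext h
    refine ⟨?_, ?_⟩
    · rw [h']; exact Module.Basis.linearIndependent _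
    · rw [h']; exact Module.Basis.span_eq _

end OfEquiv

/-! ### The normal bundle as an open subscheme of the Grassmannian bundle -/

section Normal

variable {S : Scheme.{u}} {n : ℕ} {E : VectorBundle S n} {φ : SymplecticForm E} {r : ℕ}
  (HE : HGr φ r) (GF : Gr (extBundle E) (2 * r))

variable (φ) in
/-- The locus where the projection of the tautological subbundle to `E` is symplectic. -/
def graphLocus : GF.scheme.left.Opens :=
  ((midForm φ).exists_open_nondegOn GF.taut).choose

lemma quasiCompact_graphLocus : QuasiCompact (graphLocus φ GF).ι :=
  ((midForm φ).exists_open_nondegOn GF.taut).choose_spec.1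

variable {GF} in
lemma mem_graphLocus {T : Over S} (f : T ⟶ GF.scheme) :
    (∀ p, f.left p ∈ graphLocus φ GF) ↔ (midForm φ).NondegOn (GF.taut.pull f) :=
  ((midForm φ).exists_open_nondegOn GF.taut).choose_spec.2 f

/-- Over the graph locus the tautological subbundle is a graph over a symplectic subbundle of `E`,
and `q` classifies that subbundle. The triple `(q, a, b)` is the universal one. -/
lemma exists_universal_graph : ∃ (q : restr GF.scheme (graphLocus φ GF) ⟶ HE.scheme),
    ∃ a ∈ HE.taut.sec q, ∃ b ∈ HE.taut.sec q,
      graph φ (HE.taut.pull q) a b = GF.taut.pull (restrι GF.scheme (graphLocus φ GF)) := by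
  obtain ⟨W, hW, a, ha, b, hb, hg⟩ := exists_graph_eq
    (GF.taut.pull (restrι GF.scheme (graphLocus φ GF))) ((mem_graphLocus _).mp fun p => p.2)
  have hq := HE.taut_pull_lift W hW
  generalize HE.lift W hW = q at hq
  subst hq
  exact ⟨q, a, Subbundle.mem_pull_id.mp ha, b, Subbundle.mem_pull_id.mp hb, hg⟩

/-- The symplectic subbundle of `E` of which a point of the graph locus is a graph. -/
def graphBase : restr GF.scheme (graphLocus φ GF) ⟶ HE.scheme :=
  (exists_universal_graph HE GF).choose

/-- The section representing the first coordinate on the universal graph. -/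
def graphPlus : restr GF.scheme (graphLocus φ GF) ⟶ E.tot :=
  (exists_universal_graph HE GF).choose_spec.choose

lemma graphPlus_mem : graphPlus HE GF ∈ HE.taut.sec (graphBase HE GF) :=
  (exists_universal_graph HE GF).choose_spec.choose_spec.1

/-- The section representing the last coordinate on the universal graph. -/
def graphMinus : restr GF.scheme (graphLocus φ GF) ⟶ E.tot :=
  (exists_universal_graph HE GF).choose_spec.choose_spec.2.choose

lemma graphMinus_mem : graphMinus HE GF ∈ HE.taut.sec (graphBase HE GF) :=
  (exists_universal_graph HE GF).choose_spec.choose_spec.2.choose_spec.1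

lemma graph_universal : graph φ (HE.taut.pull (graphBase HE GF)) (graphPlus HE GF)
    (graphMinus HE GF) = GF.taut.pull (restrι GF.scheme (graphLocus φ GF)) :=
  (exists_universal_graph HE GF).choose_spec.choose_spec.2.choose_spec.2

/-- The total space of the normal bundle. -/
def normalTot : Over HE.scheme.left :=
  Over.mk (graphBase HE GF).left

/-- A point of the total space of the normal bundle as a point of the graph locus. -/
def normalToLocus {T : Over HE.scheme.left} (x : T ⟶ normalTot HE GF) :
    toBase HE.scheme T ⟶ restr GF.scheme (graphLocus φ GF) :=
  Over.homMk x.left (by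
    have h1 : x.left ≫ (graphBase HE GF).left = T.hom := Over.w x
    change x.left ≫ (restr GF.scheme (graphLocus φ GF)).hom = T.hom ≫ HE.scheme.hom
    rw [← Over.w (graphBase HE GF), ← h1]
    exact (Category.assoc _ _ _).symm)

lemma normalToLocus_graphBase {T : Over HE.scheme.left} (x : T ⟶ normalTot HE GF) :
    normalToLocus HE GF x ≫ graphBase HE GF = toBaseStr HE.scheme T := by
  ext1
  exact Over.w x

lemma normalToLocus_comp {T' T : Over HE.scheme.left} (f : T' ⟶ T) (x : T ⟶ normalTot HE GF) :
    normalToLocus HE GF (f ≫ x) = toBaseMap HE.scheme f ≫ normalToLocus HE GF x := by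
  ext1
  rfl

/-- Pairs of sections of the tautological subbundle of `HGr(E)`. -/
abbrev TautPair (T : Over HE.scheme.left) : Type u :=
  HE.taut.sec (toBaseStr HE.scheme T) × HE.taut.sec (toBaseStr HE.scheme T)

variable {HE} in
/-- The pullback of a section of the tautological subbundle. -/
def tautRes {T' T : Over HE.scheme.left} (f : T' ⟶ T) (x : HE.taut.sec (toBaseStr HE.scheme T)) :
    HE.taut.sec (toBaseStr HE.scheme T') :=
  ⟨toBaseMap HE.scheme f ≫ x.1, by
    have h : toBaseMap HE.scheme f ≫ toBaseStr HE.scheme T = toBaseStr HE.scheme T' := by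
      ext1
      exact Over.w f
    have := HE.taut.comp_mem (toBaseMap HE.scheme f) (toBaseStr HE.scheme T) x.1 x.2
    rwa [h] at this⟩

/-- The graph of the pair defines a point of the graph locus. Comparing it with the universal graph
shows that this point lies over the given morphism to `HGr(E)`, so it is a point of the normal
bundle over `HGr(E)`. -/
lemma exists_graph_point {T : Over HE.scheme.left} (p : TautPair HE T) :
    ∃ z : T ⟶ normalTot HE GF,
      GF.taut.pull (normalToLocus HE GF z ≫ restrι GF.scheme (graphLocus φ GF)) =
        graph φ (HE.taut.pull (toBaseStr HE.scheme T)) p.1.1 p.2.1 := by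
  have hG := GF.taut_pull_lift (graph φ (HE.taut.pull (toBaseStr HE.scheme T)) p.1.1 p.2.1)
  have hD := (mem_graphLocus (φ := φ) (GF.lift _)).mpr
    (hG.symm ▸ midForm_nondegOn_graph (HE.nondegOn_taut.pull _))
  have hz := liftRestr_restrι _ _ hD
  generalize liftRestr _ _ hD = z at hz
  rw [← hz] at hG
  have h2 : graph φ (HE.taut.pull (z ≫ graphBase HE GF)) (z ≫ graphPlus HE GF)
      (z ≫ graphMinus HE GF) = graph φ (HE.taut.pull (toBaseStr HE.scheme T)) p.1.1 p.2.1 := by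
    rw [← hG, ← Subbundle.pull_pull, ← Subbundle.pull_pull, ← graph_universal, graph_pull]
  have hb : z ≫ graphBase HE GF = toBaseStr HE.scheme T := by
    refine HE.hom_ext (eq_of_graph_eq (HE.nondegOn_taut.pull _) ?_ ?_ ?_ ?_ h2).1
    · exact Subbundle.mem_pull_id.mpr (HE.taut.comp_mem _ _ _ (graphPlus_mem HE GF))
    · exact Subbundle.mem_pull_id.mpr (HE.taut.comp_mem _ _ _ (graphMinus_mem HE GF))
    · exact Subbundle.mem_pull_id.mpr p.1.2
    · exact Subbundle.mem_pull_id.mpr p.2.2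
  refine ⟨Over.homMk z.left (congrArg (fun f => f.left) hb), ?_⟩
  exact hG

end Normal

section Normal

variable {S : Scheme.{u}} {n : ℕ} {E : VectorBundle S n} {φ : SymplecticForm E} {r : ℕ}
  (HE : HGr φ r) (GF : Gr (extBundle E) (2 * r))

/-- The sections of the tautological subbundle given by a point of the normal bundle. -/
def normalPair {T : Over HE.scheme.left} (x : T ⟶ normalTot HE GF) : TautPair HE T :=
  (⟨normalToLocus HE GF x ≫ graphPlus HE GF, by
      rw [← normalToLocus_graphBase HE GF x]
      exact HE.taut.comp_mem _ _ _ (graphPlus_mem HE GF)⟩,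
    ⟨normalToLocus HE GF x ≫ graphMinus HE GF, by
      rw [← normalToLocus_graphBase HE GF x]
      exact HE.taut.comp_mem _ _ _ (graphMinus_mem HE GF)⟩)

lemma taut_pull_normalToLocus {T : Over HE.scheme.left} (x : T ⟶ normalTot HE GF) :
    GF.taut.pull (normalToLocus HE GF x ≫ restrι GF.scheme (graphLocus φ GF)) =
      graph φ (HE.taut.pull (toBaseStr HE.scheme T)) (normalPair HE GF x).1.1
        (normalPair HE GF x).2.1 := by
  rw [← Subbundle.pull_pull, ← graph_universal HE, graph_pull, Subbundle.pull_pull,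
    normalToLocus_graphBase]
  rfl

/-- The points of the normal bundle are pairs of sections of the tautological subbundle. -/
def normalEquiv (T : Over HE.scheme.left) : (T ⟶ normalTot HE GF) ≃ TautPair HE T where
  toFun x := normalPair HE GF x
  invFun p := (exists_graph_point HE GF p).choose
  left_inv x := by
    have h := GF.hom_ext (((exists_graph_point HE GF (normalPair HE GF x)).choose_spec).trans
      (taut_pull_normalToLocus HE GF x).symm)
    ext1
    exact congrArg (fun f => f.left) (restrι_cancel h)
  right_inv p := by
    have h := eq_of_graph_eq (HE.nondegOn_taut.pull _) (Subbundle.mem_pull_id.mpr p.1.2)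
      (Subbundle.mem_pull_id.mpr p.2.2) (Subbundle.mem_pull_id.mpr (normalPair HE GF _).1.2)
      (Subbundle.mem_pull_id.mpr (normalPair HE GF _).2.2)
      ((exists_graph_point HE GF p).choose_spec.symm.trans (taut_pull_normalToLocus HE GF _))
    exact Prod.ext (Subtype.ext h.2.1.symm) (Subtype.ext h.2.2.symm)

lemma normalPair_comp {T' T : Over HE.scheme.left} (f : T' ⟶ T) (x : T ⟶ normalTot HE GF) :
    normalPair HE GF (f ≫ x) =
      (tautRes f (normalPair HE GF x).1, tautRes f (normalPair HE GF x).2) := by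
  refine Prod.ext (Subtype.ext ?_) (Subtype.ext ?_)
  · refine (congrArg (· ≫ graphPlus HE GF) (normalToLocus_comp HE GF f x)).trans ?_
    exact Category.assoc _ _ _
  · refine (congrArg (· ≫ graphMinus HE GF) (normalToLocus_comp HE GF f x)).trans ?_
    exact Category.assoc _ _ _

variable {HE} in
lemma tautRes_add {T' T : Over HE.scheme.left} (f : T' ⟶ T)
    (x y : HE.taut.sec (toBaseStr HE.scheme T)) :
    tautRes f (x + y) = tautRes f x + tautRes f y :=
  Subtype.ext (E.comp_add _ _ _)

variable {HE} in
lemma tautRes_smul {T' T : Over HE.scheme.left} (f : T' ⟶ T) (a : Fn T)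
    (x : HE.taut.sec (toBaseStr HE.scheme T)) :
    tautRes f (a • x) = Fn.pull f a • tautRes f x :=
  Subtype.ext (E.comp_smul (toBaseMap HE.scheme f) a x.1)

variable {HE} in
lemma tautRes_comp {T'' T' T : Over HE.scheme.left} (g : T'' ⟶ T') (f : T' ⟶ T)
    (x : HE.taut.sec (toBaseStr HE.scheme T)) : tautRes (g ≫ f) x = tautRes g (tautRes f x) := by
  refine Subtype.ext (Eq.trans ?_ (Category.assoc (toBaseMap HE.scheme g) (toBaseMap HE.scheme f) x.1))
  refine congrArg (· ≫ x.1) ?_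
  ext1
  rfl

lemma exists_taut_frame (s : HE.scheme.left) : ∃ U : HE.scheme.left.Opens, s ∈ U ∧
    ∃ e : Fin (2 * r) → HE.taut.sec (toBaseStr HE.scheme (Over.mk U.ι)),
      ∀ (T : Over HE.scheme.left) (f : T ⟶ Over.mk U.ι),
        IsBasisOf (R := Fn (toBase HE.scheme T)) (fun a => (tautRes f (e a)).1)
          (HE.taut.sec (toBaseStr HE.scheme T)) := by
  obtain ⟨U, hU, e, he⟩ := HE.taut.exists_frame s
  have hfr : ∀ (T : Over HE.scheme.left) (f : T ⟶ Over.mk U.ι),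
      IsBasisOf (R := Fn (toBase HE.scheme T)) (fun i => toBaseMap HE.scheme f ≫ e i)
        (HE.taut.sec (toBaseStr HE.scheme T)) := by
    intro T f
    have h : toBaseMap HE.scheme f ≫ restrι HE.scheme U = toBaseStr HE.scheme T := by
      ext1
      exact Over.w f
    have := he _ (toBaseMap HE.scheme f)
    rwa [h] at this
  refine ⟨U, hU, fun i => ⟨e i, ?_⟩, hfr⟩
  have := (hfr _ (𝟙 (Over.mk U.ι))).mem i
  have h : toBaseMap HE.scheme (𝟙 (Over.mk U.ι)) = 𝟙 _ := by
    ext1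
    rfl
  rwa [h, Category.id_comp] at this

/-- The normal bundle of `HGr(E)` in `HGr(F)`. -/
def normalBundle : VectorBundle HE.scheme.left (4 * r) :=
  VectorBundle.ofEquiv (normalTot HE GF) (TautPair HE) (normalEquiv HE GF)
    (fun f p => (tautRes f p.1, tautRes f p.2))
    (fun f x y => Prod.ext (tautRes_add f _ _) (tautRes_add f _ _))
    (fun f a x => Prod.ext (tautRes_smul f a _) (tautRes_smul f a _))
    (fun f x => normalPair_comp HE GF f x)
    (fun s => by
      obtain ⟨U, hU, e, hfr⟩ := exists_taut_frame HE s
      -- The rank is `4 r = 2 r + 2 r`, one summand for each component of a pair.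
      let s' : Fin (4 * r) ≃ Fin (2 * r) ⊕ Fin (2 * r) :=
        (finCongr (by ring)).trans finSumFinEquiv.symm
      let b : Fin (2 * r) ⊕ Fin (2 * r) → TautPair HE (Over.mk U.ι) :=
        Sum.elim (fun a => (e a, 0)) (fun a => (0, e a))
      refine ⟨U, hU, fun i => b (s' i), fun T f => ?_⟩
      have h := isBasisOf_top_of_basis (((hfr T f).toBasis.prod (hfr T f).toBasis).reindex s'.symm)
      refine Eq.mp (congrArg (fun z => IsBasisOf (R := Fn T) z ⊤) (funext fun i => ?_)) h
      refine (Module.Basis.reindex_apply _ _ _).trans ?_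
      change _ = (tautRes f (b (s' i)).1, tautRes f (b (s' i)).2)
      rw [Equiv.symm_symm]
      have h0 : tautRes f (0 : HE.taut.sec (toBaseStr HE.scheme (Over.mk U.ι))) = 0 :=
        Subtype.ext (E.comp_zero _)
      generalize s' i = c
      rcases c with a | a
      · rw [Module.Basis.prod_apply]
        refine Prod.ext (Subtype.ext ?_) ?_
        · exact (hfr T f).coe_toBasis a
        · exact h0.symm
      · rw [Module.Basis.prod_apply]
        refine Prod.ext ?_ (Subtype.ext ?_)
        · exact h0.symm
        · exact (hfr T f).coe_toBasis a)

/-- Sections of the normal bundle are pairs of sections of the tautological subbundle. -/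
def normalLin (T : Over HE.scheme.left) : (T ⟶ (normalBundle HE GF).tot) ≃ₗ[Fn T] TautPair HE T :=
  letI := (normalEquiv HE GF T).addCommGroup
  letI := (normalEquiv HE GF T).module (Fn T)
  (normalEquiv HE GF T).linearEquiv (Fn T)

lemma normalLin_comp {T' T : Over HE.scheme.left} (f : T' ⟶ T)
    (x : T ⟶ (normalBundle HE GF).tot) : normalLin HE GF T' (f ≫ x) =
      (tautRes f (normalLin HE GF T x).1, tautRes f (normalLin HE GF T x).2) :=
  normalPair_comp HE GF f x

/-- The total space of the normal bundle is the graph locus. -/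
def locusIso : toBase HE.scheme (normalBundle HE GF).tot ≅ restr GF.scheme (graphLocus φ GF) :=
  Over.isoMk (Iso.refl _) ((Category.id_comp _).trans (Over.w (graphBase HE GF)).symm)

/-- The open embedding of the normal bundle in the Grassmannian bundle. -/
def normalEmb : toBase HE.scheme (normalBundle HE GF).tot ⟶ GF.scheme :=
  (locusIso HE GF).hom ≫ restrι GF.scheme (graphLocus φ GF)

lemma locusIso_graphBase : (locusIso HE GF).hom ≫ graphBase HE GF =
    toBaseStr HE.scheme (normalBundle HE GF).tot := by
  ext1
  exact Category.id_comp _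

lemma toBaseMap_locusIso {T : Over HE.scheme.left} (x : T ⟶ (normalBundle HE GF).tot) :
    toBaseMap HE.scheme x ≫ (locusIso HE GF).hom = normalToLocus HE GF x := by
  ext1
  exact Category.comp_id _

lemma isOpenImmersion_normalEmb : IsOpenImmersion (normalEmb HE GF).left := by
  have : IsIso (locusIso HE GF).hom.left := ((Over.forget S).mapIso (locusIso HE GF)).isIso_hom
  exact inferInstanceAs (IsOpenImmersion ((locusIso HE GF).hom.left ≫ (graphLocus φ GF).ι))

lemma quasiCompact_normalEmb : QuasiCompact (normalEmb HE GF).left := by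
  have : IsIso (locusIso HE GF).hom.left := ((Over.forget S).mapIso (locusIso HE GF)).isIso_hom
  have := quasiCompact_graphLocus (φ := φ) GF
  exact inferInstanceAs (QuasiCompact ((locusIso HE GF).hom.left ≫ (graphLocus φ GF).ι))

lemma normalEmb_cancel {T : Over S} {a b : T ⟶ toBase HE.scheme (normalBundle HE GF).tot}
    (h : a ≫ normalEmb HE GF = b ≫ normalEmb HE GF) : a = b := by
  rw [← cancel_mono (locusIso HE GF).hom]
  refine restrι_cancel ?_
  rw [Category.assoc, Category.assoc]
  exact h

lemma taut_pull_normalEmb {T : Over HE.scheme.left} (x : T ⟶ (normalBundle HE GF).tot) :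
    GF.taut.pull (toBaseMap HE.scheme x ≫ normalEmb HE GF) =
      graph φ (HE.taut.pull (toBaseStr HE.scheme T)) (normalLin HE GF T x).1.1
        (normalLin HE GF T x).2.1 := by
  refine Eq.trans ?_ (taut_pull_normalToLocus HE GF x)
  rw [normalEmb, ← Category.assoc, toBaseMap_locusIso]

/-- The universal graph over the normal bundle. -/
lemma taut_pull_comp_normalEmb {T : Over S} (k : T ⟶ toBase HE.scheme (normalBundle HE GF).tot) :
    GF.taut.pull (k ≫ normalEmb HE GF) =
      graph φ (HE.taut.pull (k ≫ toBaseStr HE.scheme (normalBundle HE GF).tot))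
        (k ≫ (locusIso HE GF).hom ≫ graphPlus HE GF)
        (k ≫ (locusIso HE GF).hom ≫ graphMinus HE GF) := by
  rw [normalEmb, ← Category.assoc, ← Subbundle.pull_pull, ← graph_universal HE, graph_pull,
    Subbundle.pull_pull, Category.assoc, locusIso_graphBase, Category.assoc, Category.assoc]

/-- How morphisms to the Grassmannian are shown to land in `j(N)`: `midForm` must be nondegenerate
on the subbundle which they classify. -/
lemma exists_comp_normalEmb_eq {T : Over S} (h : T ⟶ GF.scheme)
    (hh : (midForm φ).NondegOn (GF.taut.pull h)) :
    ∃ k : T ⟶ toBase HE.scheme (normalBundle HE GF).tot, k ≫ normalEmb HE GF = h := by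
  have hz := liftRestr_restrι h _ ((mem_graphLocus h).mpr hh)
  refine ⟨liftRestr h _ ((mem_graphLocus h).mpr hh) ≫ (locusIso HE GF).inv, ?_⟩
  rw [normalEmb, Category.assoc, Iso.inv_hom_id_assoc]
  exact hz

end Normal

/-! ### `HGr(E)` as the zero section of the normal bundle. -/

section Embedding

variable {S : Scheme.{u}} {n : ℕ} {E : VectorBundle S n}

lemma inl_lin {n' m : ℕ} (A : VectorBundle S m) (B : VectorBundle S n') {T : Over S}
    (x : T ⟶ A.tot) : (oplus.inl A B).lin T x = (prod.lift x 0 : T ⟶ A.tot ⨯ B.tot) :=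
  (prodEquiv A.tot B.tot T).injective ((comp_lift_id_zero A B x).trans
    (Prod.ext (prod.lift_fst _ _).symm (prod.lift_snd _ _).symm))

lemma inr_lin {n' m : ℕ} (A : VectorBundle S m) (B : VectorBundle S n') {T : Over S}
    (x : T ⟶ B.tot) : (oplus.inr A B).lin T x = (prod.lift 0 x : T ⟶ A.tot ⨯ B.tot) :=
  (prodEquiv A.tot B.tot T).injective ((comp_lift_zero_id A B x).trans
    (Prod.ext (prod.lift_fst _ _).symm (prod.lift_snd _ _).symm))

lemma inclE_lin {T : Over S} (x : T ⟶ E.tot) : (inclE E).ι.lin T x = vec 0 x 0 := by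
  have h : (inclE E).ι.lin T x = (oplus.inr (trivialLine S) (oplus E (trivialLine S))).lin T
      ((oplus.inl E (trivialLine S)).lin T x) := (Category.assoc x _ _).symm
  refine h.trans ((congrArg _ (inl_lin E (trivialLine S) x)).trans ((inr_lin _ _ _).trans ?_))
  rw [vec, map_zero]
  rfl

variable {φ : SymplecticForm E} {r : ℕ} (HE : HGr φ r) (GF : Gr (extBundle E) (2 * r))
  (HF : HGr (extForm φ) r)

variable (φ) in
lemma map_inclE_eq_graph {k : ℕ} {T : Over S} (W : Subbundle E k T) :
    W.map (inclE E) = graph φ W 0 0 := by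
  have h0 : ∀ {T' : Over S} (f : T' ⟶ T) (w : T' ⟶ E.tot),
      vec (φ.form T' (f ≫ 0) w) w (φ.form T' (f ≫ 0) w) = (inclE E).ι.lin T' w := by
    intro T' f w
    rw [inclE_lin, E.comp_zero, map_zero, LinearMap.zero_apply]
  refine Subbundle.ext_of_sec_le (fun {T'} f y hy => ?_) fun {T'} f y hy => ?_
  · obtain ⟨w, hw, rfl⟩ := hy
    exact mem_graph_iff_exists.mpr ⟨w, hw, (h0 f w).symm⟩
  · obtain ⟨w, hw, rfl⟩ := mem_graph_iff_exists.mp hy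
    exact ⟨w, hw, (h0 f w).symm⟩

lemma taut_pull_emb : HF.taut.pull (HE.emb HF) = graph φ HE.taut 0 0 :=
  (HF.taut_pull_lift _ _).trans (map_inclE_eq_graph φ _)

/-- Both morphisms classify the graph with `a = b = 0`, which is `𝒰_E` regarded as a subbundle of
`F`. -/
lemma zero_normalEmb : toBaseMap HE.scheme (0 : Over.mk (𝟙 HE.scheme.left) ⟶
      (normalBundle HE GF).tot) ≫ normalEmb HE GF =
    toBaseStr HE.scheme (Over.mk (𝟙 HE.scheme.left)) ≫ HE.emb HF ≫ HF.toGr GF := by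
  refine GF.hom_ext ((taut_pull_normalEmb HE GF _).trans ?_)
  rw [map_zero, ← Subbundle.pull_pull, ← Subbundle.pull_pull, HF.taut_pull_toGr, taut_pull_emb,
    graph_pull, E.comp_zero]
  rfl

lemma zero_left_normalEmb : (0 : Over.mk (𝟙 HE.scheme.left) ⟶ (normalBundle HE GF).tot).left ≫
    (normalEmb HE GF).left = (HE.emb HF).left ≫ (HF.toGr GF).left :=
  (congrArg (fun f => f.left) (zero_normalEmb HE GF HF)).trans (Category.id_comp _)

end Embedding

/-! ### Zeros of sections -/

section Zeros

variable {S : Scheme.{u}} {n : ℕ} {V : VectorBundle S n}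

lemma exists_coordinates {X : Over S} (s : X ⟶ V.tot) (p : X.left) :
    ∃ U : X.left.Opens, p ∈ U ∧ ∃ c : Fin n → Fn (restr X U),
      ∀ {T : Over S} (f : T ⟶ restr X U),
        (f ≫ restrι X U) ≫ s = 0 ↔ ∀ i, Fn.pull f (c i) = 0 := by
  obtain ⟨U, hU, e, he'⟩ := V.exists_frame (X.hom p)
  have he : V.IsFrame e := he'
  obtain ⟨g⟩ := exists_lift_preimage (T := X) U
  refine ⟨X.hom ⁻¹ᵁ U, hU, fun i => (he.coord i).app g (restrι X _ ≫ s), fun {T} f => ?_⟩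
  have h : ∀ i, Fn.pull f ((he.coord i).app g (restrι X _ ≫ s)) =
      (he.coord i).app (f ≫ g) ((f ≫ restrι X _) ≫ s) := by
    intro i
    rw [← (he.coord i).app_comp, Category.assoc]
  refine ⟨fun h0 i => by rw [h, h0, map_zero], fun hi => he.ext_coord (f ≫ g) fun i => ?_⟩
  rw [← h, hi, map_zero]

/-- The zeros of the functions are the equalizer of two morphisms to affine space, which is
separated over `S`; hence the equalizer is a closed subscheme. -/
lemma isClosedImmersion_equations {X : Over S} (c : Fin n → Fn X) :
    ∃ (Z : Over S) (z : Z ⟶ X), Mono z ∧ IsClosedImmersion z.left ∧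
      ∀ {T : Over S} (f : T ⟶ X), (∀ i, Fn.pull f (c i) = 0) ↔ ∃ g, g ≫ z = f := by
  let A : Over S := Over.mk (𝔸(ULift.{u} (Fin n); S) ↘ S)
  let hom (c : Fin n → Fn X) : X ⟶ A :=
    Over.homMk (AffineSpace.homOfVector X.hom fun i => c i.down) (AffineSpace.homOfVector_over _ _)
  have hom_coord : ∀ {T : Over S} (f : T ⟶ X) (c : Fin n → Fn X) (i),
      (f ≫ hom c).left.appTop.hom (AffineSpace.coord S i) = Fn.pull f (c i.down) := by
    intro T f c i
    have h1 : (f ≫ hom c).left.appTop.hom (AffineSpace.coord S i) =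
        f.left.appTop.hom ((hom c).left.appTop.hom (AffineSpace.coord S i)) := by
      change (f.left ≫ (hom c).left).appTop.hom _ = _
      rw [Scheme.Hom.comp_appTop]
      rfl
    rw [h1]
    exact congrArg _ (AffineSpace.homOfVector_appTop_coord _ _ _)
  have hA : IsSeparated A.hom := inferInstanceAs (IsSeparated (𝔸(ULift.{u} (Fin n); S) ↘ S))
  refine ⟨equalizer (hom c) (hom 0), equalizer.ι _ _, inferInstance, inferInstance,
    fun {T} f => ⟨fun hf => ⟨equalizer.lift f ?_, equalizer.lift_ι _ _⟩, ?_⟩⟩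
  · ext1
    refine AffineSpace.hom_ext ?_ fun i => ?_
    · exact (Over.w (f ≫ hom c)).trans (Over.w (f ≫ hom 0)).symm
    · refine (hom_coord f c i).trans (Eq.trans ?_ (hom_coord f 0 i).symm)
      rw [hf, Pi.zero_apply, map_zero]
  · rintro ⟨g, rfl⟩ i
    have h : (g ≫ equalizer.ι (hom c) (hom 0)) ≫ hom c =
        (g ≫ equalizer.ι (hom c) (hom 0)) ≫ hom 0 := by
      rw [Category.assoc, Category.assoc, equalizer.condition]
    rw [← hom_coord _ c ⟨i⟩, h, hom_coord, Pi.zero_apply, map_zero]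

variable {X Z : Over S} {s : X ⟶ V.tot} {z : Z ⟶ X}

/-- The scheme of zeros of a section of a vector bundle is a closed subscheme. -/
lemma isClosedImmersion_of_zeros [Mono z]
    (h : ∀ {T : Over S} (f : T ⟶ X), f ≫ s = 0 ↔ ∃ g, g ≫ z = f) : IsClosedImmersion z.left := by
  choose U hU c hc using exists_coordinates s
  refine (IsZariskiLocalAtTarget.iff_of_openCover (P := @IsClosedImmersion)
    (X.left.openCoverOfIsOpenCover U (openCover_of_nhds U hU))).mpr fun p => ?_
  change IsClosedImmersion (pullback.snd z.left (U p).ι)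
  -- Over `U p` the zeros of `s` are those of its coordinates. The base change `P` of `z` and the
  -- equalizer `Z'` have the same factorization property, so they are isomorphic over `U p`.
  obtain ⟨Z', z', hz', hz'c, hz⟩ := isClosedImmersion_equations (c p)
  let P : Over S := Over.mk (pullback.snd z.left (U p).ι ≫ (U p).ι ≫ X.hom)
  let a : P ⟶ restr X (U p) := Over.homMk (pullback.snd z.left (U p).ι) rfl
  let b : P ⟶ Z := Over.homMk (pullback.fst z.left (U p).ι) (by
    change _ = pullback.snd z.left (U p).ι ≫ (U p).ι ≫ X.hom
    rw [← Over.w z, ← Category.assoc, pullback.condition, Category.assoc])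
  have hab : b ≫ z = a ≫ restrι X (U p) := by
    ext1
    exact pullback.condition
  obtain ⟨t, ht⟩ := (hz a).mp ((hc p a).mp ((h _).mpr ⟨b, hab⟩))
  obtain ⟨t', ht'⟩ := (h (z' ≫ restrι X (U p))).mp ((hc p z').mpr ((hz z').mpr ⟨𝟙 _,
    Category.id_comp _⟩))
  let l : Z'.left ⟶ P.left := pullback.lift t'.left z'.left (congrArg (fun f => f.left) ht')
  have hl : l ≫ pullback.snd z.left (U p).ι = z'.left := pullback.lift_snd _ _ _
  have ht₁ : t.left ≫ z'.left = pullback.snd z.left (U p).ι := congrArg (fun f => f.left) ht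
  have h1 : t.left ≫ l = 𝟙 _ := by
    rw [← cancel_mono (pullback.snd z.left (U p).ι), Category.assoc, hl, ht₁]
    exact (Category.id_comp _).symm
  have h2 : l ≫ t.left = 𝟙 _ := by
    rw [← cancel_mono z'.left, Category.assoc, ht₁, hl, Category.id_comp]
  have : IsIso t.left := ⟨l, h1, h2⟩
  rw [← ht₁]
  infer_instance

/-- The complement of the scheme of zeros of a section of a vector bundle is retrocompact. -/
lemma isRetrocompact_compl_zeros
    (h : ∀ {T : Over S} (f : T ⟶ X), f ≫ s = 0 ↔ ∃ g, g ≫ z = f) :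
    IsRetrocompact (Set.range z.left)ᶜ := by
  refine isRetrocompact_of_locally _ fun p => ?_
  obtain ⟨U, hU, c, hc⟩ := exists_coordinates s p
  refine ⟨U, hU, ?_⟩
  have hset : U.ι ⁻¹' (Set.range z.left)ᶜ =
      ⋃ i, ((restr X U).left.basicOpen (c i) : Set (restr X U).left) := by
    ext q
    obtain ⟨K, _, σ, x, hx⟩ := exists_point (T := restr X U) q
    let o : (Over.mk σ).left := (default : PrimeSpectrum K)
    -- For the converse, a point of `Z` above `q` may have another residue field, but whether `c i`
    -- vanishes there depends only on the underlying point.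
    have h1 : (∀ i, Fn.pull x (c i) = 0) ↔ U.ι q ∈ Set.range z.left := by
      rw [← hc x, h]
      constructor
      · rintro ⟨g, hg⟩
        refine ⟨g.left o, ?_⟩
        have := congrArg (fun f => f.left o) hg
        refine this.trans (congrArg U.ι (hx o))
      · rintro ⟨w, hw⟩
        obtain ⟨K', _, σ', x', hx'⟩ := exists_point (T := Z) w
        have h2 : ∀ p', (x' ≫ z).left p' ∈ U := by
          intro p'
          have h3 : (x' ≫ z).left p' = U.ι q := (congrArg z.left (hx' p')).trans hw
          rw [h3]
          exact q.2
        have h4 := liftRestr_restrι _ U h2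
        generalize liftRestr _ U h2 = x'' at h4
        have h5 := (hc x'').mp ((h _).mpr ⟨x', h4.symm⟩)
        refine (h _).mp ((hc x).mpr fun i => ?_)
        by_contra h6
        have h7 := (pull_ne_zero_iff (c i) x o).mp h6
        rw [hx o] at h7
        let o' : (Over.mk σ').left := (default : PrimeSpectrum K')
        have h8 : x''.left o' = q := by
          refine U.ι.injective ?_
          have h9 : U.ι (x''.left o') = (x' ≫ z).left o' := congrArg (fun f => f.left o') h4
          rw [h9]
          exact (congrArg z.left (hx' o')).trans hw
        rw [← h8] at h7
        exact (pull_ne_zero_iff (c i) x'' o').mpr h7 (h5 i)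
    rw [Set.mem_preimage, Set.mem_compl_iff, ← h1, Set.mem_iUnion, not_forall]
    refine exists_congr fun i => ?_
    rw [← hx o]
    exact pull_ne_zero_iff (c i) x o
  rw [hset]
  -- Only finitely many equations occur, so the complement of the zeros is locally a finite union of
  -- basic open sets.
  exact IsRetrocompact.iUnion fun i => isRetrocompact_basicOpen (c i)

end Zeros

/-! ### Subbundles contained in a direct summand -/

section Summand

variable {S : Scheme.{u}} {n m k : ℕ} {V : VectorBundle S n} {D : VectorBundle S m}

lemma SplitInclusion.ρ_ι (d : SplitInclusion D V) {T : Over S} (x : T ⟶ D.tot) :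
    d.ρ.lin T (d.ι.lin T x) = x := by
  change (x ≫ d.ι.hom) ≫ d.ρ.hom = x
  rw [Category.assoc, d.ι_ρ, Category.comp_id]

lemma Subbundle.map_pull {T T' : Over S} (W : Subbundle D k T) (d : SplitInclusion D V)
    (f : T' ⟶ T) : (W.map d).pull f = (W.pull f).map d :=
  rfl

lemma Subbundle.map_injective (d : SplitInclusion D V) {T : Over S} {W W' : Subbundle D k T}
    (h : W.map d = W'.map d) : W = W' := by
  refine Subbundle.ext_of_sec_le (fun {T'} f x hx => ?_) fun {T'} f x hx => ?_
  · have h1 : d.ι.lin T' x ∈ (W.map d).sec f := ⟨x, hx, rfl⟩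
    rw [h] at h1
    obtain ⟨y, hy, hyx⟩ := h1
    rwa [← d.ρ_ι x, ← hyx, d.ρ_ι]
  · have h1 : d.ι.lin T' x ∈ (W'.map d).sec f := ⟨x, hx, rfl⟩
    rw [← h] at h1
    obtain ⟨y, hy, hyx⟩ := h1
    rwa [← d.ρ_ι x, ← hyx, d.ρ_ι]

/-- If `W` lies in the summand, the image of `W` under the retraction is a subbundle of `D`, because
the inclusion is a left inverse of the retraction on `W`. -/
lemma Subbundle.exists_map_eq_iff (d : SplitInclusion D V) {T : Over S} (W : Subbundle V k T) :
    (∃ W' : Subbundle D k T, W'.map d = W) ↔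
      ∀ {T' : Over S} (f : T' ⟶ T), ∀ u ∈ W.sec f, d.ι.lin T' (d.ρ.lin T' u) = u := by
  constructor
  · rintro ⟨W', rfl⟩ T' f _ ⟨x, hx, rfl⟩
    exact congrArg _ (d.ρ_ι x)
  · intro h
    let θ : RelHom V D T := ⟨fun {T'} _ => d.ρ.lin T', fun g _ x => d.ρ.lin_comp g x⟩
    let l : θ.LeftInverseOn W := ⟨fun {T'} _ => d.ι.lin T', fun g _ x => d.ι.lin_comp g x, h⟩
    refine ⟨W.image θ l, Subbundle.ext_of_sec_le (fun {T'} f x hx => ?_) fun {T'} f x hx => ?_⟩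
    · obtain ⟨_, ⟨u, hu, rfl⟩, rfl⟩ := hx
      have h1 := h f u hu
      change d.ι.lin T' (d.ρ.lin T' u) ∈ _
      rwa [h1]
    · exact ⟨d.ρ.lin T' x, ⟨x, hx, rfl⟩, h f x hx⟩

variable (G : Gr V k) (G' : Gr D k) (d : SplitInclusion D V)

lemma Gr.taut_pull_map : G.taut.pull (G'.map G d) = G'.taut.map d :=
  G.taut_pull_lift _

lemma Gr.mono_map : Mono (G'.map G d) :=
  ⟨fun a b h => G'.hom_ext (Subbundle.map_injective d (by
    rw [← Subbundle.map_pull, ← Subbundle.map_pull, ← G.taut_pull_map, Subbundle.pull_pull,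
      Subbundle.pull_pull, h]))⟩

variable {G G' d} in
lemma Gr.exists_comp_map_eq_iff {T : Over S} (f : T ⟶ G.scheme) :
    (∃ g, g ≫ G'.map G d = f) ↔
      ∀ {T' : Over S} (h : T' ⟶ T), ∀ u ∈ G.taut.sec (h ≫ f), d.ι.lin T' (d.ρ.lin T' u) = u := by
  refine Iff.trans ?_ (Subbundle.exists_map_eq_iff d (G.taut.pull f))
  constructor
  · rintro ⟨g, rfl⟩
    exact ⟨G'.taut.pull g, by rw [← Subbundle.map_pull, ← G.taut_pull_map, Subbundle.pull_pull]⟩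
  · rintro ⟨W, hW⟩
    refine ⟨G'.lift W, G.hom_ext ?_⟩
    rw [← Subbundle.pull_pull, G.taut_pull_map, Subbundle.map_pull, G'.taut_pull_lift, hW]

end Summand

/-! ### Points of the intersection of `HGr` with the Grassmannian of a direct summand. -/

section Inter

variable {S : Scheme.{u}} {n m r : ℕ} {V : VectorBundle S n} {ω : SymplecticForm V}
  {D : VectorBundle S m} (H : HGr ω r) (G : Gr V (2 * r)) (G' : Gr D (2 * r))
  (d : SplitInclusion D V)

instance HGr.mono_interι : Mono (H.interι G G' d) := by
  have := G.mono_map G' d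
  infer_instance

lemma HGr.exists_comp_interι_eq_iff {T : Over S} (f : T ⟶ H.scheme) :
    (∃ g, g ≫ H.interι G G' d = f) ↔
      ∀ {T' : Over S} (h : T' ⟶ T), ∀ u ∈ H.taut.sec (h ≫ f), d.ι.lin T' (d.ρ.lin T' u) = u := by
  have h1 := Gr.exists_comp_map_eq_iff (G' := G') (d := d) (f ≫ H.toGr G)
  have h2 : (∃ g, g ≫ H.interι G G' d = f) ↔ ∃ g, g ≫ G'.map G d = f ≫ H.toGr G := by
    constructor
    · rintro ⟨g, rfl⟩
      exact ⟨g ≫ pullback.snd _ _, by rw [Category.assoc, ← pullback.condition, Category.assoc]⟩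
    · rintro ⟨g, hg⟩
      exact ⟨pullback.lift f g hg.symm, pullback.lift_fst _ _ _⟩
  rw [h2, h1, ← H.taut_pull_toGr G]
  refine forall₂_congr fun T' h => ?_
  change _ ↔ ∀ u ∈ G.taut.sec ((h ≫ f) ≫ H.toGr G), _
  rw [Category.assoc]

end Inter

/-! ### The first and the last coordinate -/

section Edge

variable {S : Scheme.{u}} {n m : ℕ}

/-- A coordinate on `F` whose kernel is the direct summand `d`, on which `ψ` is the pullback of `φ`. -/
structure EdgeCoordinate (E : VectorBundle S n) {D : VectorBundle S m}
    (d : SplitInclusion D (extBundle E)) where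
  app : ∀ T : Over S, (T ⟶ (extBundle E).tot) →ₗ[Fn T] Fn T
  app_comp : ∀ {T' T : Over S} (f : T' ⟶ T) (y : T ⟶ (extBundle E).tot),
    app T' (f ≫ y) = Fn.pull f (app T y)
  ι_ρ_iff : ∀ {T : Over S} (u : T ⟶ (extBundle E).tot),
    d.ι.lin T (d.ρ.lin T u) = u ↔ app T u = 0
  form_eq : ∀ (φ : SymplecticForm E) {T : Over S} (u v : T ⟶ (extBundle E).tot),
    app T u = 0 → app T v = 0 → (extForm φ).form T u v = (midForm φ).form T u v
  exists_unit : ∀ T : Over S, ∃ t : T ⟶ (extBundle E).tot, app T t = 1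

lemma inclPlus_ι_ρ {E : VectorBundle S n} {T : Over S} (u : T ⟶ (extBundle E).tot) :
    (inclPlus E).ι.lin T ((inclPlus E).ρ.lin T u) = vec (coordL E T u) (coordE E T u) 0 := by
  have h1 := prodEquiv_comp_map (A := (trivialLine S).tot) (oplus.inl E (trivialLine S)).hom
    ((inclPlus E).ρ.lin T u)
  have h2 := prodEquiv_comp_map (A := (trivialLine S).tot) (oplus.fst E (trivialLine S)).hom u
  have h3 := congrArg Prod.fst h2
  have h4 := congrArg Prod.snd h2
  have h5 := inl_lin E (trivialLine S) (coordE E T u)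
  refine (prodEquiv _ _ T).injective (h1.trans (Prod.ext ?_ ?_))
  · refine h3.trans (Eq.trans ?_ (prod.lift_fst _ _).symm)
    exact ((lineLin T).symm_apply_apply _).symm
  · refine (congrArg (· ≫ (oplus.inl E (trivialLine S)).hom) h4).trans ?_
    refine h5.trans (Eq.trans ?_ (prod.lift_snd _ _).symm)
    rw [map_zero]

lemma inclMinus_ι_ρ {E : VectorBundle S n} {T : Over S} (u : T ⟶ (extBundle E).tot) :
    (inclMinus E).ι.lin T ((inclMinus E).ρ.lin T u) = vec 0 (coordE E T u) (coordR E T u) := by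
  refine (inr_lin (trivialLine S) (oplus E (trivialLine S)) _).trans ?_
  refine Limits.prod.hom_ext ?_ ?_
  · refine (prod.lift_fst _ _).trans (Eq.trans ?_ (prod.lift_fst _ _).symm)
    rw [map_zero]
  · refine (prod.lift_snd _ _).trans (Eq.trans ?_ (prod.lift_snd _ _).symm)
    refine Limits.prod.hom_ext (prod.lift_fst _ _).symm ?_
    refine Eq.trans ?_ (prod.lift_snd _ _).symm
    exact ((lineLin T).symm_apply_apply _).symm

variable (E : VectorBundle S n)

/-- The last coordinate. -/
def edgeR : EdgeCoordinate E (inclPlus E) where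
  app := coordR E
  app_comp := coordR_comp E
  ι_ρ_iff u := by
    rw [inclPlus_ι_ρ]
    refine ⟨fun h => ?_, fun h => ?_⟩
    · rw [← h, coordR_vec]
    · rw [← h, vec_coord]
  form_eq φ T u v hu hv := by
    rw [extForm_apply, midForm_apply, hu, hv, mul_zero, zero_mul, zero_add, sub_zero]
  exists_unit T := ⟨vec 0 0 1, coordR_vec _ _ _⟩

/-- The first coordinate. -/
def edgeL : EdgeCoordinate E (inclMinus E) where
  app := coordL E
  app_comp := coordL_comp E
  ι_ρ_iff u := by
    rw [inclMinus_ι_ρ]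
    refine ⟨fun h => ?_, fun h => ?_⟩
    · rw [← h, coordL_vec]
    · rw [← h, vec_coord]
  form_eq φ T u v hu hv := by
    rw [extForm_apply, midForm_apply, hu, hv, mul_zero, zero_mul, zero_add, sub_zero]
  exists_unit T := ⟨vec 1 0 0, coordL_vec _ _ _⟩

end Edge

/-! ### `N⁺` and `N⁻` inside the graph locus, and the isometry of tautological bundles. -/

section EdgeInter

variable {S : Scheme.{u}} {n m r : ℕ} {E : VectorBundle S n} {φ : SymplecticForm E}
  {D : VectorBundle S m} {d : SplitInclusion D (extBundle E)} (c : EdgeCoordinate E d)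
  (GF : Gr (extBundle E) (2 * r)) (G' : Gr D (2 * r)) (HE : HGr φ r) (HF : HGr (extForm φ) r)

/-- The coordinate vanishes on the subbundle. -/
def EdgeCoordinate.VanishesOn {k : ℕ} {T : Over S} (W : Subbundle (extBundle E) k T) : Prop :=
  ∀ (T' : Over S) (f : T' ⟶ T), ∀ u ∈ W.sec f, c.app T' u = 0

variable {c}

lemma EdgeCoordinate.VanishesOn.pull {k : ℕ} {T T₁ : Over S} {W : Subbundle (extBundle E) k T}
    (h : c.VanishesOn W) (g : T₁ ⟶ T) : c.VanishesOn (W.pull g) :=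
  fun T' f => h T' (f ≫ g)

/-- The outer coordinates enter `ψ` only through products of one with the other, so once one of them
vanishes on `W`, `ψ` and `midForm` agree there. This places `N⁺` and `N⁻` in the graph locus. -/
lemma EdgeCoordinate.VanishesOn.nondegOn_iff {k : ℕ} {T : Over S}
    {W : Subbundle (extBundle E) k T} (h : c.VanishesOn W) :
    (extForm φ).NondegOn W ↔ (midForm φ).NondegOn W := by
  refine forall₄_congr fun K _ σ f => forall₂_congr fun x hx => imp_congr_left ?_
  refine forall₂_congr fun y hy => ?_
  rw [c.form_eq φ x y (h _ f x hx) (h _ f y hy)]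

variable (c)

lemma exists_comp_interι_eq_iff_vanishesOn {T : Over S} (f : T ⟶ HF.scheme) :
    (∃ g, g ≫ HF.interι GF G' d = f) ↔ c.VanishesOn (HF.taut.pull f) := by
  rw [HF.exists_comp_interι_eq_iff]
  exact forall₂_congr fun T' h => forall₂_congr fun u hu => c.ι_ρ_iff u

lemma vanishesOn_taut_interι : c.VanishesOn (HF.taut.pull (HF.interι GF G' d)) :=
  (exists_comp_interι_eq_iff_vanishesOn c GF G' HF _).mp ⟨𝟙 _, Category.id_comp _⟩

lemma exists_inter_normalEmb (c : EdgeCoordinate E d) :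
    ∃ k : HF.inter GF G' d ⟶ toBase HE.scheme (normalBundle HE GF).tot,
      k ≫ normalEmb HE GF = HF.interι GF G' d ≫ HF.toGr GF := by
  refine exists_comp_normalEmb_eq HE GF _ ?_
  rw [← Subbundle.pull_pull, HF.taut_pull_toGr]
  have h := vanishesOn_taut_interι c GF G' HF
  exact h.nondegOn_iff.mp (HF.nondegOn_taut.pull _)

variable {GF G' HE HF}

/-- A point of `N` is a graph, on which `midForm` is nondegenerate. If the coordinate vanishes on
it, `ψ` is nondegenerate too, so the graph is a point of `HGr(F)` lying in the summand. -/
lemma exists_comp_eq_iff_vanishesOn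
    {k : HF.inter GF G' d ⟶ toBase HE.scheme (normalBundle HE GF).tot}
    (hk : k ≫ normalEmb HE GF = HF.interι GF G' d ≫ HF.toGr GF) {T : Over S}
    (x : T ⟶ toBase HE.scheme (normalBundle HE GF).tot) :
    (∃ y, y ≫ k = x) ↔ c.VanishesOn (GF.taut.pull (x ≫ normalEmb HE GF)) := by
  constructor
  · rintro ⟨y, rfl⟩
    rw [Category.assoc, hk, ← Category.assoc, ← Subbundle.pull_pull, HF.taut_pull_toGr,
      ← Subbundle.pull_pull]
    exact (vanishesOn_taut_interι c GF G' HF).pull y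
  · intro h
    have hn : (extForm φ).NondegOn (GF.taut.pull (x ≫ normalEmb HE GF)) := by
      rw [h.nondegOn_iff, taut_pull_comp_normalEmb]
      exact midForm_nondegOn_graph (HE.nondegOn_taut.pull _)
    have h1 := HF.taut_pull_lift _ hn
    obtain ⟨y, hy⟩ := (exists_comp_interι_eq_iff_vanishesOn c GF G' HF (HF.lift _ hn)).mpr
      (by rwa [h1])
    refine ⟨y, normalEmb_cancel HE GF (GF.hom_ext ?_)⟩
    rw [Category.assoc, hk, ← Category.assoc, hy, ← Subbundle.pull_pull, HF.taut_pull_toGr, h1]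

/-- A subbundle is isomorphic to its graphs. -/
def graphSubbundleIso {k : ℕ} {T : Over S} (W : Subbundle E k T) (a b : T ⟶ E.tot) :
    SubbundleIso W (graph φ W a b) where
  equiv {T'} f :=
    { toFun := fun w => ⟨_, vec_mem_graph (φ := φ) (a := a) (b := b) w.2⟩
      map_add' := fun w w' => Subtype.ext (((graphHom φ a b).app f).map_add w.1 w'.1)
      map_smul' := fun t w => Subtype.ext (((graphHom φ a b).app f).map_smul t w.1)
      invFun := fun y => ⟨coordE E T' y.1, (mem_graph.mp y.2).1⟩
      left_inv := fun w => Subtype.ext (coordE_vec _ _ _)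
      right_inv := fun y => Subtype.ext (by
        have h := mem_graph.mp y.2
        refine (congrArg₂ (fun p q => vec p _ q) h.2.1.symm h.2.2.symm).trans (vec_coord y.1)) }
  naturality g f x := (graphHom φ a b).app_comp g f x.1

/-- The tautological subbundles over the intersection with a direct summand are isometric. -/
lemma exists_isometry (c : EdgeCoordinate E d)
    {k : HF.inter GF G' d ⟶ toBase HE.scheme (normalBundle HE GF).tot}
    (hk : k ≫ normalEmb HE GF = HF.interι GF G' d ≫ HF.toGr GF) :
    ∃ e : SubbundleIso (HE.taut.pull (k ≫ toBaseStr HE.scheme (normalBundle HE GF).tot))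
        (HF.taut.pull (HF.interι GF G' d)),
      ∀ (T : Over S) (f : T ⟶ HF.inter GF G' d) (x y),
        (extForm φ).form T (e.equiv f x).1 (e.equiv f y).1 = φ.form T x.1 y.1 := by
  have hv := vanishesOn_taut_interι c GF G' HF
  have h1 := taut_pull_comp_normalEmb HE GF k
  -- Over the intersection `𝒰_F` becomes a graph over `𝒰_E`, and there `ψ` is `φ` of the components
  -- in `E`.
  rw [hk, ← Subbundle.pull_pull, HF.taut_pull_toGr] at h1
  rw [h1] at hv ⊢
  refine ⟨graphSubbundleIso _ _ _, fun T f x y => ?_⟩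
  rw [c.form_eq φ _ _ (hv T f _ (Subtype.property _)) (hv T f _ (Subtype.property _)), midForm_apply]
  exact congrArg₂ (fun p q => φ.form T p q) (coordE_vec _ _ _) (coordE_vec _ _ _)

end EdgeInter

/-! ### Transversality -/

section Transversality

variable {S : Scheme.{u}}

lemma dualEps_mul_self {A : CommRingCat.{u}} (σ : Spec A ⟶ S) : dualEps σ * dualEps σ = 0 := by
  rw [dualEps, ← map_mul, DualNumber.eps_mul_eps, map_zero]

lemma pull_dualZero_dualEps {A : CommRingCat.{u}} (σ : Spec A ⟶ S) :
    Fn.pull (dualZero σ) (dualEps σ) = 0 := by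
  have h := Scheme.ΓSpecIso_inv_naturality
    (CommRingCat.ofHom (TrivSqZeroExt.fstHom A A A).toRingHom : dualRing A ⟶ A)
  have h1 := ConcreteCategory.congr_hom h (DualNumber.eps : DualNumber A)
  refine h1.symm.trans ?_
  refine (congrArg (Scheme.ΓSpecIso A).inv.hom ?_).trans (map_zero _)
  exact TrivSqZeroExt.fst_inr A (1 : A)

lemma dualZero_dualProj {A : CommRingCat.{u}} (σ : Spec A ⟶ S) :
    dualZero σ ≫ dualProj σ = 𝟙 _ := by
  ext1
  change Spec.map _ ≫ Spec.map _ = 𝟙 (Spec A)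
  rw [← Spec.map_comp, ← CommRingCat.ofHom_comp]
  have : (TrivSqZeroExt.fstHom A A A).toRingHom.comp (TrivSqZeroExt.inlHom A A) =
      RingHom.id A := by ext; rfl
  rw [this, CommRingCat.ofHom_id, Spec.map_id]

/-- `ε` is nilpotent, so field-valued points do not see it. Nondegeneracy over dual numbers is
therefore a condition on the undeformed subbundle only. -/
lemma pull_dualEps_eq_zero {A : CommRingCat.{u}} (σ : Spec A ⟶ S) {K : Type u} [Field K]
    {τ : Spec (.of K) ⟶ S} (x : Over.mk τ ⟶ dualOver σ) : Fn.pull x (dualEps σ) = 0 := by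
  have : IsDomain (Fn (Over.mk τ)) := (isField_fn τ).isDomain
  rw [← mul_self_eq_zero, ← map_mul, dualEps_mul_self, map_zero]

variable {n : ℕ}

/-- The linear map `u ↦ u + a l(u) t`. -/
def transvection {V : VectorBundle S n} {T : Over S} (l : RelFun V T) (a : Fn T) (t : T ⟶ V.tot) :
    RelHom V V T where
  app f := LinearMap.id + (l.app f).smulRight (Fn.pull f a • (f ≫ t))
  app_comp g f x := by
    rw [LinearMap.add_apply, LinearMap.add_apply, LinearMap.smulRight_apply,
      LinearMap.smulRight_apply, V.comp_add, V.comp_smul, V.comp_smul, l.app_comp, Fn.pull_comp,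
      Category.assoc]
    rfl

lemma transvection_apply {V : VectorBundle S n} {T : Over S} (l : RelFun V T) (a : Fn T)
    (t : T ⟶ V.tot) {T' : Over S} (f : T' ⟶ T) (x : T' ⟶ V.tot) :
    (transvection l a t).app f x = x + l.app f x • (Fn.pull f a • (f ≫ t)) :=
  rfl

/-- The cross term carries `a² = 0`, so changing the sign of `a` inverts the transvection whatever
the value `l(t)` is. -/
lemma transvection_neg {V : VectorBundle S n} {T : Over S} (l : RelFun V T) (a : Fn T)
    (ha : a * a = 0) (t : T ⟶ V.tot) {T' : Over S} (f : T' ⟶ T) (x : T' ⟶ V.tot) :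
    (transvection l (-a) t).app f ((transvection l a t).app f x) = x := by
  have h : Fn.pull f a * Fn.pull f a = 0 := by rw [← map_mul, ha, map_zero]
  rw [transvection_apply, transvection_apply, map_add, map_smul, map_smul, smul_eq_mul, smul_eq_mul,
    map_neg, add_smul, smul_smul, smul_smul, smul_smul]
  have h2 : l.app f x * (Fn.pull f a * l.app f (f ≫ t)) * -Fn.pull f a = 0 := by
    linear_combination (-l.app f x * l.app f (f ≫ t)) * h
  rw [h2, zero_smul, add_zero, add_assoc, ← add_smul]
  simp

variable {m r : ℕ} {E : VectorBundle S n} {φ : SymplecticForm E}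
  {D : VectorBundle S m} {d : SplitInclusion D (extBundle E)} (c : EdgeCoordinate E d)
  (GF : Gr (extBundle E) (2 * r)) (G' : Gr D (2 * r)) (HF : HGr (extForm φ) r)

/-- The coordinate as a functional. -/
def EdgeCoordinate.fun (T : Over S) : RelFun (extBundle E) T where
  app {T'} _ := c.app T'
  app_comp g _ x := c.app_comp g x

/-- Let `W` be the subspace at the zero `x`; the coordinate `c` vanishes on it. Choose `t` with
`c(t) = 1` and deform `W` by `u ↦ u + ε ψ(v, u) t`. On the deformed subbundle `c` takes the value `ε
ψ(v, u)`, which is also the value of `ψ(ε v, ·)`; so the section representing `c` is there `ε v`. -/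
lemma exists_deformation {K : Type u} [Field K] (σ : Spec (.of K) ⟶ S)
    (x : Over.mk σ ⟶ HF.scheme) (hx : c.VanishesOn (HF.taut.pull x)) {s : HF.scheme ⟶ (extBundle E).tot}
    (hs : s ∈ HF.taut.sec (𝟙 _))
    (hsc : ∀ {T : Over S} (f : T ⟶ HF.scheme), ∀ u ∈ HF.taut.sec f,
      (extForm φ).form T (f ≫ s) u = c.app T u) (v : Over.mk σ ⟶ (extBundle E).tot)
    (hv : v ∈ HF.taut.sec x) : ∃ x' : dualOver σ ⟶ HF.scheme,
      dualZero σ ≫ x' = x ∧ x' ≫ s = dualEps σ • (dualProj σ ≫ v) := by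
  obtain ⟨t, ht⟩ := c.exists_unit (dualOver σ)
  let l : RelFun (extBundle E) (dualOver σ) := (extForm φ).toBilForm.left (dualProj σ ≫ v)
  have hl : ∀ {T : Over S} (f : T ⟶ dualOver σ) (u),
      l.app f u = (extForm φ).form T (f ≫ dualProj σ ≫ v) u := fun f u => rfl
  let W := HF.taut.pull (dualProj σ ≫ x)
  let θ := transvection l (dualEps σ) t
  let W' := W.image θ ⟨fun f => (transvection l (-dualEps σ) t).app f,
    fun g f y => (transvection l (-dualEps σ) t).app_comp g f y,
    fun f y _ => transvection_neg l _ (dualEps_mul_self σ) t f y⟩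
  have hW' : ∀ {T : Over S} (f : T ⟶ dualOver σ) (y), y ∈ W'.sec f ↔ ∃ u ∈ W.sec f,
      u + l.app f u • (Fn.pull f (dualEps σ) • (f ≫ t)) = y := fun f y => Iff.rfl
  have hW'₀ : ∀ {T : Over S} (f : T ⟶ dualOver σ), Fn.pull f (dualEps σ) = 0 →
      W'.sec f = W.sec f := by
    intro T f hf
    ext y
    rw [hW', hf]
    simp
  -- At field-valued points `ε` vanishes and `W'` is the original symplectic subspace.
  have hn : (extForm φ).NondegOn W' := by
    intro L _ τ f
    have h := (HF.nondegOn_taut.pull (dualProj σ ≫ x)) L τ f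
    rw [hW'₀ f (pull_dualEps_eq_zero σ f)]
    exact h
  have hlift := HF.taut_pull_lift W' hn
  generalize HF.lift W' hn = x' at hlift
  have hx' : ∀ {T : Over S} (f : T ⟶ dualOver σ), HF.taut.sec (f ≫ x') = W'.sec f := by
    intro T f
    rw [← hlift]
    rfl
  refine ⟨x', HF.hom_ext ?_, ?_⟩
  · rw [← Subbundle.pull_pull, hlift]
    apply Subbundle.ext
    funext T f
    have h0 : Fn.pull (f ≫ dualZero σ) (dualEps σ) = 0 :=
      (Fn.pull_comp f (dualZero σ) _).symm.trans
        ((congrArg (Fn.pull f) (pull_dualZero_dualEps σ)).trans (map_zero _))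
    refine (hW'₀ (f ≫ dualZero σ) h0).trans ?_
    change HF.taut.sec ((f ≫ dualZero σ) ≫ dualProj σ ≫ x) = HF.taut.sec (f ≫ x)
    rw [Category.assoc, ← Category.assoc (dualZero σ), dualZero_dualProj, Category.id_comp]
  -- The transvection fixes `ε v` because `ψ` is alternating, so `ε v` belongs to the deformed
  -- subbundle. It then suffices to compare the functionals which it and `s` represent.
  · have hεv : dualEps σ • (dualProj σ ≫ v) ∈ HF.taut.sec x' := by
      rw [← Category.id_comp x', hx', hW']
      refine ⟨dualEps σ • (dualProj σ ≫ v), Submodule.smul_mem _ _ ?_, ?_⟩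
      · change _ ∈ HF.taut.sec (𝟙 _ ≫ dualProj σ ≫ x)
        rw [Category.id_comp]
        exact HF.taut.comp_mem _ _ _ hv
      · rw [hl, Category.id_comp, map_smul, (extForm φ).alt, smul_zero, zero_smul, add_zero]
    refine HF.nondegOn_taut.eq_of_form_eq (f := x') (HF.taut.comp_mem_id _ hs) hεv ?_
    intro T g u hu
    rw [← Category.assoc, hsc (g ≫ x') u hu]
    rw [hx', hW'] at hu
    -- For `u = w + ε ψ(v, w) t`, both sides equal `ε ψ(v, w)` up to a multiple of `ε²`.
    obtain ⟨w, hw, rfl⟩ := hu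
    have hcw : c.app T w = 0 := by
      refine hx T (g ≫ dualProj σ) w ?_
      change w ∈ HF.taut.sec ((g ≫ dualProj σ) ≫ x)
      rw [Category.assoc]
      exact hw
    have hε : Fn.pull g (dualEps σ) * Fn.pull g (dualEps σ) = 0 := by
      rw [← map_mul, dualEps_mul_self, map_zero]
    rw [map_add, map_smul, map_smul, c.app_comp, ht, map_one, hcw, (extBundle E).comp_smul, map_add,
      map_smul, map_smul, LinearMap.smul_apply, LinearMap.smul_apply, hl]
    simp only [map_smul, smul_eq_mul]
    linear_combination (-(extForm φ).form T (g ≫ dualProj σ ≫ v) w *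
      (extForm φ).form T (g ≫ dualProj σ ≫ v) (g ≫ t)) * hε

/-- The section of the tautological subbundle dual to the coordinate meets the zero section
transversally. -/
theorem exists_transversal_section : ∃ s : HF.scheme ⟶ (extBundle E).tot,
    (∀ (T : Over S) (f : T ⟶ HF.scheme), ∀ u ∈ HF.taut.sec f,
      (extForm φ).form T (f ≫ s) u = c.app T u) ∧
    MeetsZeroTransversally HF.taut s (HF.interι GF G' d) := by
  obtain ⟨s, hs, hsc⟩ := BilForm.NondegOn.exists_dual (β := (extForm φ).toBilForm)
    HF.nondegOn_taut (c.fun HF.scheme)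
  have hsc' : ∀ {T : Over S} (f : T ⟶ HF.scheme), ∀ u ∈ HF.taut.sec f,
      (extForm φ).form T (f ≫ s) u = c.app T u := fun f u hu => hsc f u hu
  -- The section is zero exactly when the functional which it represents is zero on the tautological
  -- subbundle.
  have hzero : ∀ {T : Over S} (f : T ⟶ HF.scheme),
      f ≫ s = 0 ↔ c.VanishesOn (HF.taut.pull f) := by
    intro T f
    constructor
    · intro h T' g u hu
      rw [← hsc' (g ≫ f) u hu, Category.assoc, h, (extBundle E).comp_zero, map_zero,
        LinearMap.zero_apply]
    · intro h
      refine HF.nondegOn_taut.eq_of_form_eq (f := f) (HF.taut.comp_mem_id _ hs)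
        (Submodule.zero_mem _) ?_
      intro T' g u hu
      rw [← Category.assoc, hsc' (g ≫ f) u hu, h _ g u hu, (extBundle E).comp_zero, map_zero,
        LinearMap.zero_apply]
  have hz : ∀ {T : Over S} (f : T ⟶ HF.scheme),
      f ≫ s = 0 ↔ ∃ g, g ≫ HF.interι GF G' d = f := fun f =>
    (hzero f).trans (exists_comp_interι_eq_iff_vanishesOn c GF G' HF f).symm
  exact ⟨s, fun T f u hu => hsc' f u hu, hs, HF.smooth, isClosedImmersion_of_zeros hz, hz,
    fun K _ σ x hx v hv => exists_deformation c HF σ x ((hzero x).mp hx) hs hsc' v hv⟩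

end Transversality

/-! ### The summands of the normal bundle -/

section Summands

variable {S : Scheme.{u}} {n : ℕ} {E : VectorBundle S n} {φ : SymplecticForm E} {r : ℕ}

/-- One of the two copies of the tautological subbundle of `HGr(E)` in its normal bundle. -/
structure TautSummand (HE : HGr φ r) where
  incl : ∀ T : Over HE.scheme.left, HE.taut.sec (toBaseStr HE.scheme T) →ₗ[Fn T] TautPair HE T
  proj : ∀ T : Over HE.scheme.left, TautPair HE T →ₗ[Fn T] HE.taut.sec (toBaseStr HE.scheme T)
  proj_incl : ∀ {T : Over HE.scheme.left} (x), proj T (incl T x) = x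
  incl_res : ∀ {T' T : Over HE.scheme.left} (f : T' ⟶ T) (x),
    incl T' (tautRes f x) = (tautRes f (incl T x).1, tautRes f (incl T x).2)
  proj_res : ∀ {T' T : Over HE.scheme.left} (f : T' ⟶ T) (p),
    proj T' (tautRes f p.1, tautRes f p.2) = tautRes f (proj T p)

variable (HE : HGr φ r) (GF : Gr (extBundle E) (2 * r))

variable {HE} in
lemma tautRes_zero {T' T : Over HE.scheme.left} (f : T' ⟶ T) :
    tautRes f (0 : HE.taut.sec (toBaseStr HE.scheme T)) = 0 :=
  Subtype.ext (E.comp_zero _)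

/-- The first copy of the tautological subbundle. -/
def TautSummand.inl : TautSummand HE where
  incl T := LinearMap.inl (Fn T) _ _
  proj T := LinearMap.fst (Fn T) _ _
  proj_incl _ := rfl
  incl_res f _ := Prod.ext rfl (tautRes_zero f).symm
  proj_res _ _ := rfl

/-- The second copy of the tautological subbundle. -/
def TautSummand.inr : TautSummand HE where
  incl T := LinearMap.inr (Fn T) _ _
  proj T := LinearMap.snd (Fn T) _ _
  proj_incl _ := rfl
  incl_res f _ := Prod.ext (tautRes_zero f).symm rfl
  proj_res _ _ := rfl

variable {HE}

/-- The inclusion of a copy of the tautological subbundle in the normal bundle. -/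
def TautSummand.lin (t : TautSummand HE) (T : Over HE.scheme.left) :
    HE.taut.sec (toBaseStr HE.scheme T) →ₗ[Fn T] (T ⟶ (normalBundle HE GF).tot) :=
  (normalLin HE GF T).symm.toLinearMap ∘ₗ t.incl T

variable (t : TautSummand HE) {GF}

lemma TautSummand.normalLin_lin {T : Over HE.scheme.left}
    (x : HE.taut.sec (toBaseStr HE.scheme T)) :
    normalLin HE GF T (t.lin GF T x) = t.incl T x :=
  (normalLin HE GF T).apply_symm_apply _

lemma TautSummand.proj_normalLin_lin {T : Over HE.scheme.left}
    (x : HE.taut.sec (toBaseStr HE.scheme T)) :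
    t.proj T (normalLin HE GF T (t.lin GF T x)) = x := by
  rw [t.normalLin_lin, t.proj_incl]

lemma TautSummand.lin_injective (T : Over HE.scheme.left) :
    Function.Injective (t.lin GF T) :=
  Function.LeftInverse.injective (g := fun x => t.proj T (normalLin HE GF T x))
    fun x => t.proj_normalLin_lin x

lemma TautSummand.comp_lin {T' T : Over HE.scheme.left} (f : T' ⟶ T)
    (x : HE.taut.sec (toBaseStr HE.scheme T)) : f ≫ t.lin GF T x = t.lin GF T' (tautRes f x) := by
  apply (normalLin HE GF T').injective
  rw [normalLin_comp, t.normalLin_lin, t.normalLin_lin, t.incl_res]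

lemma TautSummand.proj_comp {T' T : Over HE.scheme.left} (f : T' ⟶ T)
    (x : T ⟶ (normalBundle HE GF).tot) : t.proj T' (normalLin HE GF T' (f ≫ x)) =
      tautRes f (t.proj T (normalLin HE GF T x)) := by
  rw [normalLin_comp, t.proj_res]

lemma TautSummand.mem_range {T : Over HE.scheme.left} {x : T ⟶ (normalBundle HE GF).tot} :
    x ∈ LinearMap.range (t.lin GF T) ↔ t.lin GF T (t.proj T (normalLin HE GF T x)) = x := by
  constructor
  · rintro ⟨y, rfl⟩
    rw [t.proj_normalLin_lin]
  · exact fun h => ⟨_, h⟩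

variable (GF) in
/-- A copy of the tautological subbundle as a subbundle of the normal bundle. -/
def TautSummand.subbundle : Subbundle (normalBundle HE GF) (2 * r) (Over.mk (𝟙 HE.scheme.left)) where
  sec {T} _ := LinearMap.range (t.lin GF T)
  comp_mem g f x hx := by
    obtain ⟨y, rfl⟩ := hx
    exact ⟨_, (t.comp_lin g y).symm⟩
  mem_of_locally {T'} f x h := by
    refine t.mem_range.mpr (hom_ext_of_locally fun p => ?_)
    obtain ⟨U, hU, hx⟩ := h p
    exact ⟨U, hU, (t.comp_lin _ _).trans ((congrArg (t.lin GF (restr T' U))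
      (t.proj_comp (restrι T' U) x).symm).trans (t.mem_range.mp hx))⟩
  exists_frame p := by
    obtain ⟨U, hU, e, he⟩ := exists_taut_frame HE p
    let u : restr (Over.mk (𝟙 HE.scheme.left)) U ⟶ Over.mk U.ι :=
      Over.homMk (𝟙 _) ((Category.id_comp _).trans (Category.comp_id _).symm)
    refine ⟨U, hU, fun a => t.lin GF (restr (Over.mk (𝟙 HE.scheme.left)) U) (tautRes u (e a)), fun T f => ?_⟩
    let B : Module.Basis (Fin (2 * r)) (Fn T) (HE.taut.sec (toBaseStr HE.scheme T)) :=
      (he T (f ≫ u)).toBasis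
    have h : (fun a => f ≫ t.lin GF (restr (Over.mk (𝟙 HE.scheme.left)) U) (tautRes u (e a))) = t.lin GF T ∘ B := by
      funext a
      refine (t.comp_lin f _).trans (congrArg (t.lin GF T) ?_)
      rw [← tautRes_comp]
      exact Subtype.ext ((he T (f ≫ u)).coe_toBasis a).symm
    rw [h]
    refine ⟨B.linearIndependent.map' (t.lin GF T) (LinearMap.ker_eq_bot.mpr (t.lin_injective T)), ?_⟩
    rw [Set.range_comp, ← Submodule.map_span]
    refine (congrArg (Submodule.map (t.lin GF T)) B.span_eq).trans ?_
    exact Submodule.map_top _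

variable (GF) in
/-- The isomorphism of a summand of the normal bundle with the tautological subbundle. -/
def TautSummand.baseIso : BaseIso (t.subbundle GF) HE.taut where
  equiv T := (LinearEquiv.ofInjective (t.lin GF T) (t.lin_injective T)).symm
  naturality {T' T} f x x' h := by
    have hx : ∀ (T : Over HE.scheme.left)
        (x : (t.subbundle GF).sec (Over.mkIdTerminal.from T)), t.lin GF T
          ((LinearEquiv.ofInjective (t.lin GF T) (t.lin_injective T)).symm x) = x.1 := fun T x =>
      congrArg Subtype.val
        ((LinearEquiv.ofInjective (t.lin GF T) (t.lin_injective T)).apply_symm_apply x)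
    exact (congrArg Subtype.val (t.lin_injective T' ((t.comp_lin f _).symm.trans
      ((congrArg (f ≫ ·) (hx T x)).trans (h.trans (hx T' x').symm))))).symm

lemma TautSummand.lin_baseIso {T : Over HE.scheme.left}
    (x : (t.subbundle GF).sec (Over.mkIdTerminal.from T)) :
    t.lin GF T ((t.baseIso GF).equiv T x) = x.1 :=
  congrArg Subtype.val
    ((LinearEquiv.ofInjective (t.lin GF T) (t.lin_injective T)).apply_symm_apply x)

lemma mem_subbundle_inl {T : Over HE.scheme.left} {x : T ⟶ (normalBundle HE GF).tot} :
    x ∈ ((TautSummand.inl HE).subbundle GF).sec (Over.mkIdTerminal.from T) ↔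
      (normalLin HE GF T x).2 = 0 := by
  refine (TautSummand.mem_range _).trans ?_
  rw [← (normalLin HE GF T).injective.eq_iff, TautSummand.normalLin_lin]
  exact ⟨fun h => (congrArg Prod.snd h).symm, fun h => Prod.ext rfl h.symm⟩

lemma mem_subbundle_inr {T : Over HE.scheme.left} {x : T ⟶ (normalBundle HE GF).tot} :
    x ∈ ((TautSummand.inr HE).subbundle GF).sec (Over.mkIdTerminal.from T) ↔
      (normalLin HE GF T x).1 = 0 := by
  refine (TautSummand.mem_range _).trans ?_
  rw [← (normalLin HE GF T).injective.eq_iff, TautSummand.normalLin_lin]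
  exact ⟨fun h => (congrArg Prod.fst h).symm, fun h => Prod.ext h.symm rfl⟩

variable (HE GF) in
lemma isCompl_summands (T : Over HE.scheme.left) :
    IsCompl (((TautSummand.inl HE).subbundle GF).sec (Over.mkIdTerminal.from T))
      (((TautSummand.inr HE).subbundle GF).sec (Over.mkIdTerminal.from T)) := by
  refine ⟨Submodule.disjoint_def.mpr fun x h₁ h₂ => ?_, codisjoint_iff_le_sup.mpr fun x _ => ?_⟩
  · apply (normalLin HE GF T).injective
    rw [map_zero]
    exact Prod.ext (mem_subbundle_inr.mp h₂) (mem_subbundle_inl.mp h₁)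
  · have h : x = (TautSummand.inl HE).lin GF T (normalLin HE GF T x).1 +
        (TautSummand.inr HE).lin GF T (normalLin HE GF T x).2 := by
      apply (normalLin HE GF T).injective
      rw [map_add, TautSummand.normalLin_lin, TautSummand.normalLin_lin]
      exact Prod.ext (add_zero _).symm (zero_add _).symm
    rw [h]
    exact Submodule.add_mem_sup ⟨_, rfl⟩ ⟨_, rfl⟩

/-- The last coordinate on the graph is `φ(b, ·)` on `W`, and `b` lies in `W`, where `φ` is
nondegenerate. -/
lemma edgeR_vanishesOn_graph {k : ℕ} {T : Over S} {W : Subbundle E k T} (h : φ.NondegOn W)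
    {a b : T ⟶ E.tot} (hb : b ∈ W.sec (𝟙 T)) :
    (edgeR E).VanishesOn (graph φ W a b) ↔ b = 0 := by
  constructor
  · intro hv
    refine h.eq_of_form_eq hb (Submodule.zero_mem _) fun g u hu => ?_
    rw [Category.comp_id] at hu
    have h1 := hv _ g _ (vec_mem_graph hu)
    refine (coordR_vec _ _ _).symm.trans (h1.trans ?_)
    rw [E.comp_zero, map_zero, LinearMap.zero_apply]
  · rintro rfl T' f y hy
    refine (mem_graph.mp hy).2.2.trans ?_
    rw [E.comp_zero, map_zero, LinearMap.zero_apply]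

lemma edgeL_vanishesOn_graph {k : ℕ} {T : Over S} {W : Subbundle E k T} (h : φ.NondegOn W)
    {a b : T ⟶ E.tot} (ha : a ∈ W.sec (𝟙 T)) :
    (edgeL E).VanishesOn (graph φ W a b) ↔ a = 0 := by
  constructor
  · intro hv
    refine h.eq_of_form_eq ha (Submodule.zero_mem _) fun g u hu => ?_
    rw [Category.comp_id] at hu
    have h1 := hv _ g _ (vec_mem_graph hu)
    refine (coordL_vec _ _ _).symm.trans (h1.trans ?_)
    rw [E.comp_zero, map_zero, LinearMap.zero_apply]
  · rintro rfl T' f y hy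
    refine (mem_graph.mp hy).2.1.trans ?_
    rw [E.comp_zero, map_zero, LinearMap.zero_apply]

variable {GP : Gr (oplus (trivialLine S) E) (2 * r)} {GM : Gr (oplus E (trivialLine S)) (2 * r)}
  {HF : HGr (extForm φ) r}

/-- Both sides say that the last coordinate vanishes on the graph of `x`, that is, that the
component `b` of `x = (a, b)` is zero. -/
lemma mem_subbundle_inl_iff_exists
    {k : HF.inter GF GP (inclPlus E) ⟶ toBase HE.scheme (normalBundle HE GF).tot}
    (hk : k ≫ normalEmb HE GF = HF.interι GF GP (inclPlus E) ≫ HF.toGr GF)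
    {T : Over HE.scheme.left} (x : T ⟶ (normalBundle HE GF).tot) :
    x ∈ ((TautSummand.inl HE).subbundle GF).sec (Over.mkIdTerminal.from T) ↔
      ∃ y : toBase HE.scheme T ⟶ HF.inter GF GP (inclPlus E), y ≫ k = toBaseMap HE.scheme x := by
  rw [exists_comp_eq_iff_vanishesOn (edgeR E) hk, taut_pull_normalEmb, mem_subbundle_inl,
    edgeR_vanishesOn_graph (HE.nondegOn_taut.pull _)
      (Subbundle.mem_pull_id.mpr (normalLin HE GF T x).2.2)]
  exact Subtype.ext_iff

lemma mem_subbundle_inr_iff_exists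
    {k : HF.inter GF GM (inclMinus E) ⟶ toBase HE.scheme (normalBundle HE GF).tot}
    (hk : k ≫ normalEmb HE GF = HF.interι GF GM (inclMinus E) ≫ HF.toGr GF)
    {T : Over HE.scheme.left} (x : T ⟶ (normalBundle HE GF).tot) :
    x ∈ ((TautSummand.inr HE).subbundle GF).sec (Over.mkIdTerminal.from T) ↔
      ∃ y : toBase HE.scheme T ⟶ HF.inter GF GM (inclMinus E), y ≫ k = toBaseMap HE.scheme x := by
  rw [exists_comp_eq_iff_vanishesOn (edgeL E) hk, taut_pull_normalEmb, mem_subbundle_inr,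
    edgeL_vanishesOn_graph (HE.nondegOn_taut.pull _)
      (Subbundle.mem_pull_id.mpr (normalLin HE GF T x).1.2)]
  exact Subtype.ext_iff

/-- The subbundle given by a sum of points of the two summands of the normal bundle. -/
lemma mem_taut_sum_iff (T : Over HE.scheme.left)
    (xp : ((TautSummand.inl HE).subbundle GF).sec (Over.mkIdTerminal.from T))
    (xm : ((TautSummand.inr HE).subbundle GF).sec (Over.mkIdTerminal.from T))
    (y : toBase HE.scheme T ⟶ (extBundle E).tot) :
    y ∈ GF.taut.sec (toBaseMap HE.scheme (xp.1 + xm.1) ≫ normalEmb HE GF) ↔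
      ∃ w ∈ HE.taut.sec (toBaseStr HE.scheme T),
        y = vec (φ.form _ (((TautSummand.inl HE).baseIso GF).equiv T xp).1 w) w
          (φ.form _ (((TautSummand.inr HE).baseIso GF).equiv T xm).1 w) := by
  have h : normalLin HE GF T (xp.1 + xm.1) = (((TautSummand.inl HE).baseIso GF).equiv T xp,
      ((TautSummand.inr HE).baseIso GF).equiv T xm) := by
    rw [map_add, ← TautSummand.lin_baseIso _ xp, ← TautSummand.lin_baseIso _ xm,
      TautSummand.normalLin_lin, TautSummand.normalLin_lin]
    exact Prod.ext (add_zero _) (zero_add _)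
  rw [← Subbundle.mem_pull_id (W := GF.taut), taut_pull_normalEmb, mem_graph_iff_exists, h]
  refine exists_congr fun w => ?_
  rw [Subbundle.mem_pull_id, Category.id_comp, Category.id_comp]

/-! ### The intersection of the summands -/

variable (HE GF GP GM HF)

lemma edgeR_vanishesOn_emb : (edgeR E).VanishesOn (HF.taut.pull (HE.emb HF)) := by
  rw [taut_pull_emb, edgeR_vanishesOn_graph HE.nondegOn_taut (Submodule.zero_mem _)]

lemma edgeL_vanishesOn_emb : (edgeL E).VanishesOn (HF.taut.pull (HE.emb HF)) := by
  rw [taut_pull_emb, edgeL_vanishesOn_graph HE.nondegOn_taut (Submodule.zero_mem _)]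

lemma mono_emb : Mono (HE.emb HF) := by
  refine ⟨fun a b h => HE.hom_ext (Subbundle.map_injective (inclE E) ?_)⟩
  have h1 : HF.taut.pull (HE.emb HF) = HE.taut.map (inclE E) := HF.taut_pull_lift _ _
  rw [← Subbundle.map_pull, ← Subbundle.map_pull, ← h1, Subbundle.pull_pull, Subbundle.pull_pull, h]

/-- Vanishing of one coordinate makes the subbundle a graph; vanishing of both then forces `a = b =
0`, so it is a symplectic subbundle of `E`. -/
lemma exists_comp_emb_eq {T : Over S} (f : T ⟶ HF.scheme)
    (hR : (edgeR E).VanishesOn (HF.taut.pull f)) (hL : (edgeL E).VanishesOn (HF.taut.pull f)) :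
    ∃ g, g ≫ HE.emb HF = f := by
  obtain ⟨W, hW, a, ha, b, hb, hg⟩ := exists_graph_eq (HF.taut.pull f)
    (hR.nondegOn_iff.mp (HF.nondegOn_taut.pull f))
  rw [← hg, edgeR_vanishesOn_graph hW hb] at hR
  rw [← hg, edgeL_vanishesOn_graph hW ha] at hL
  subst hR hL
  refine ⟨HE.lift W hW, HF.hom_ext ?_⟩
  rw [← Subbundle.pull_pull, taut_pull_emb, graph_pull, HE.taut_pull_lift, E.comp_zero, hg]

/-- `HGr(E)` is the intersection of `N⁺` and `N⁻`. -/
lemma exists_isPullback_emb : ∃ (lp : HE.scheme ⟶ HF.inter GF GP (inclPlus E))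
    (lm : HE.scheme ⟶ HF.inter GF GM (inclMinus E)),
    lp ≫ HF.interι GF GP (inclPlus E) = HE.emb HF ∧
    lm ≫ HF.interι GF GM (inclMinus E) = HE.emb HF ∧
    IsPullback lp lm (HF.interι GF GP (inclPlus E)) (HF.interι GF GM (inclMinus E)) := by
  obtain ⟨lp, hlp⟩ := (exists_comp_interι_eq_iff_vanishesOn (edgeR E) GF GP HF (HE.emb HF)).mpr
    (edgeR_vanishesOn_emb HE HF)
  obtain ⟨lm, hlm⟩ := (exists_comp_interι_eq_iff_vanishesOn (edgeL E) GF GM HF (HE.emb HF)).mpr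
    (edgeL_vanishesOn_emb HE HF)
  have := mono_emb HE HF
  have hex : ∀ c : PullbackCone (HF.interι GF GP (inclPlus E)) (HF.interι GF GM (inclMinus E)),
      ∃ g : c.pt ⟶ HE.scheme, g ≫ HE.emb HF = c.fst ≫ HF.interι GF GP (inclPlus E) := by
    intro c
    refine exists_comp_emb_eq HE HF _ ?_ ?_
    · exact (exists_comp_interι_eq_iff_vanishesOn (edgeR E) GF GP HF _).mp ⟨c.fst, rfl⟩
    · exact (exists_comp_interι_eq_iff_vanishesOn (edgeL E) GF GM HF _).mp
        ⟨c.snd, c.condition.symm⟩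
  choose g hg using hex
  refine ⟨lp, lm, hlp, hlm, ⟨hlp.trans hlm.symm⟩, ⟨PullbackCone.IsLimit.mk _ g
    (fun c => ?_) (fun c => ?_) fun c m hm _ => ?_⟩⟩
  · rw [← cancel_mono (HF.interι GF GP (inclPlus E)), Category.assoc, hlp, hg]
  · rw [← cancel_mono (HF.interι GF GM (inclMinus E)), Category.assoc, hlm, hg, c.condition]
  · rw [← cancel_mono (HE.emb HF), hg, ← hlp, ← hm, Category.assoc]

/-- Inside `N⁺`, `HGr(E)` is the scheme of zeros of the restriction of `s₋`, because it is the
intersection with `N⁻`. And `N⁺` is closed in `HGr(F)`, being the scheme of zeros of `s₊`. -/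
lemma isClosedImmersion_emb : IsClosedImmersion (HE.emb HF).left := by
  obtain ⟨GF⟩ := nonempty_gr (extBundle E) (2 * r)
  obtain ⟨GP⟩ := nonempty_gr (oplus (trivialLine S) E) (2 * r)
  obtain ⟨GM⟩ := nonempty_gr (oplus E (trivialLine S)) (2 * r)
  obtain ⟨lp, lm, hlp, hlm, h⟩ := exists_isPullback_emb HE GF GP GM HF
  obtain ⟨_, -, hp⟩ := exists_transversal_section (edgeR E) GF GP HF
  obtain ⟨s, -, hm⟩ := exists_transversal_section (edgeL E) GF GM HF
  have : Mono lp := by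
    have := mono_emb HE HF
    rw [← hlp] at this
    exact mono_of_mono lp (HF.interι GF GP (inclPlus E))
  have h1 : IsClosedImmersion lp.left := by
    refine isClosedImmersion_of_zeros (s := HF.interι GF GP (inclPlus E) ≫ s) fun f => ?_
    rw [← Category.assoc, hm.zero_iff]
    constructor
    · rintro ⟨g, hg⟩
      exact ⟨h.lift f g hg.symm, h.lift_fst _ _ _⟩
    · rintro ⟨g, rfl⟩
      exact ⟨g ≫ lm, by rw [Category.assoc, Category.assoc, hlp, hlm]⟩
  have := hp.isClosedImmersion
  rw [← hlp]
  exact inferInstanceAs (IsClosedImmersion (lp.left ≫ (HF.interι GF GP (inclPlus E)).left))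

end Summands

/-! ### Functions on `Spec A[ε]` -/

section DualNumbers

variable {S : Scheme.{u}} {A : CommRingCat.{u}}

lemma hom_pull_dualProj (σ : Spec A ⟶ S) (b : Fn (Over.mk σ)) :
    (Scheme.ΓSpecIso (dualRing A)).hom (Fn.pull (dualProj σ) b) =
      (TrivSqZeroExt.inl ((Scheme.ΓSpecIso A).hom b) : DualNumber A) :=
  ConcreteCategory.congr_hom (Scheme.ΓSpecIso_naturality
    (CommRingCat.ofHom (TrivSqZeroExt.inlHom A A) : A ⟶ dualRing A)) b

lemma hom_pull_dualZero (σ : Spec A ⟶ S) (c : Fn (dualOver σ)) :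
    (Scheme.ΓSpecIso A).hom (Fn.pull (dualZero σ) c) =
      TrivSqZeroExt.fst ((Scheme.ΓSpecIso (dualRing A)).hom c : DualNumber A) :=
  ConcreteCategory.congr_hom (Scheme.ΓSpecIso_naturality
    (CommRingCat.ofHom (TrivSqZeroExt.fstHom A A A).toRingHom : dualRing A ⟶ A)) c

lemma hom_dualEps (σ : Spec A ⟶ S) :
    (Scheme.ΓSpecIso (dualRing A)).hom (dualEps σ) = (DualNumber.eps : DualNumber A) :=
  ConcreteCategory.congr_hom (Scheme.ΓSpecIso (dualRing A)).inv_hom_id (DualNumber.eps : DualNumber A)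

lemma ΓSpecIso_hom_injective (B : CommRingCat.{u}) :
    Function.Injective (Scheme.ΓSpecIso B).hom :=
  (ConcreteCategory.bijective_of_isIso (Scheme.ΓSpecIso B).hom).1

lemma exists_eq_add_dualEps_mul (σ : Spec A ⟶ S) (c : Fn (dualOver σ)) : ∃ b : Fn (Over.mk σ),
    c = Fn.pull (dualProj σ) (Fn.pull (dualZero σ) c) + dualEps σ * Fn.pull (dualProj σ) b := by
  let d : DualNumber A := (Scheme.ΓSpecIso (dualRing A)).hom c
  have hd : d = TrivSqZeroExt.inl d.fst + DualNumber.eps * TrivSqZeroExt.inl d.snd := by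
    ext <;> simp
  refine ⟨(Scheme.ΓSpecIso A).inv d.snd, ΓSpecIso_hom_injective _ ?_⟩
  refine hd.trans (Eq.symm ?_)
  refine (map_add (Scheme.ΓSpecIso (dualRing A)).hom.hom _ _).trans ?_
  refine congrArg₂ (· + ·) ?_ ?_
  · refine (hom_pull_dualProj σ _).trans ?_
    rw [hom_pull_dualZero]
  · refine (map_mul (Scheme.ΓSpecIso (dualRing A)).hom.hom _ _).trans ?_
    refine congrArg₂ (· * ·) (hom_dualEps σ) ((hom_pull_dualProj σ _).trans ?_)
    exact congrArg TrivSqZeroExt.inl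
      (ConcreteCategory.congr_hom (Scheme.ΓSpecIso A).inv_hom_id d.snd)

/-- Multiplication by `ε` identifies functions on `Spec A` with `ε A`. Derivatives are defined and
compared through this injectivity. -/
lemma dualEps_mul_injective (σ : Spec A ⟶ S) {b b' : Fn (Over.mk σ)}
    (h : dualEps σ * Fn.pull (dualProj σ) b = dualEps σ * Fn.pull (dualProj σ) b') : b = b' := by
  have key : ∀ b : Fn (Over.mk σ), TrivSqZeroExt.snd ((Scheme.ΓSpecIso (dualRing A)).hom
      (dualEps σ * Fn.pull (dualProj σ) b) : DualNumber A) = (Scheme.ΓSpecIso A).hom b := by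
    intro b
    have h1 : ((Scheme.ΓSpecIso (dualRing A)).hom (dualEps σ * Fn.pull (dualProj σ) b)) =
        (DualNumber.eps * TrivSqZeroExt.inl ((Scheme.ΓSpecIso A).hom b) : DualNumber A) :=
      (map_mul (Scheme.ΓSpecIso (dualRing A)).hom.hom _ _).trans
        (congrArg₂ (· * ·) (hom_dualEps σ) (hom_pull_dualProj σ _))
    rw [h1]
    simp
  apply ΓSpecIso_hom_injective A
  rw [← key, ← key, h]

/-- The map of rings of dual numbers induced by a ring homomorphism. -/
def dualRingMap {A B : Type u} [CommRing A] [CommRing B] (f : A →+* B) :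
    DualNumber A →+* DualNumber B where
  toFun z := TrivSqZeroExt.inl (f z.fst) + TrivSqZeroExt.inr (f z.snd)
  map_one' := by ext <;> simp
  map_mul' x y := by ext <;> simp
  map_zero' := by ext <;> simp
  map_add' x y := by ext <;> simp

variable {A' : CommRingCat.{u}} {σ : Spec A ⟶ S} {σ' : Spec A' ⟶ S}

lemma inlHom_comp_dualRingMap {A B : CommRingCat.{u}} (f : A ⟶ B) :
    (CommRingCat.ofHom (TrivSqZeroExt.inlHom A A) : A ⟶ dualRing A) ≫
        (CommRingCat.ofHom (dualRingMap f.hom) : dualRing A ⟶ dualRing B) =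
      f ≫ (CommRingCat.ofHom (TrivSqZeroExt.inlHom B B) : B ⟶ dualRing B) := by
  refine CommRingCat.hom_ext (RingHom.ext fun a => ?_)
  change dualRingMap f.hom (TrivSqZeroExt.inl a) = TrivSqZeroExt.inl (f.hom a)
  refine TrivSqZeroExt.ext ?_ ?_ <;> simp [dualRingMap]

lemma map_dualRingMap_comp (f : Spec A' ⟶ Spec A) :
    Spec.map (CommRingCat.ofHom (dualRingMap (Spec.preimage f).hom) : dualRing A ⟶ dualRing A') ≫
        Spec.map (CommRingCat.ofHom (TrivSqZeroExt.inlHom A A) : A ⟶ dualRing A) =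
      Spec.map (CommRingCat.ofHom (TrivSqZeroExt.inlHom A' A') : A' ⟶ dualRing A') ≫ f := by
  refine (Spec.map_comp _ _).symm.trans ?_
  rw [inlHom_comp_dualRingMap, Spec.map_comp, Spec.map_preimage]

/-- The morphism `Spec A'[ε] ⟶ Spec A[ε]` induced by a morphism `Spec A' ⟶ Spec A`. -/
def dualMap (h : Over.mk σ' ⟶ Over.mk σ) : dualOver σ' ⟶ dualOver σ :=
  Over.homMk (Spec.map (CommRingCat.ofHom (dualRingMap (Spec.preimage h.left).hom) :
    dualRing A ⟶ dualRing A')) ((Category.assoc _ _ _).symm.trans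
      ((congrArg (· ≫ σ) (map_dualRingMap_comp h.left)).trans ((Category.assoc _ _ _).trans
        (congrArg (_ ≫ ·) (Over.w h)))))

lemma dualMap_dualProj (h : Over.mk σ' ⟶ Over.mk σ) :
    dualMap h ≫ dualProj σ = dualProj σ' ≫ h :=
  Over.OverMorphism.ext (map_dualRingMap_comp h.left)

lemma pull_dualMap_dualEps (h : Over.mk σ' ⟶ Over.mk σ) :
    Fn.pull (dualMap h) (dualEps σ) = dualEps σ' := by
  have h1 := ConcreteCategory.congr_hom (Scheme.ΓSpecIso_inv_naturality
    (CommRingCat.ofHom (dualRingMap (Spec.preimage h.left).hom) : dualRing A ⟶ dualRing A'))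
    (DualNumber.eps : DualNumber A)
  refine h1.symm.trans (congrArg (Scheme.ΓSpecIso (dualRing A')).inv.hom ?_)
  change dualRingMap _ (DualNumber.eps : DualNumber A) = (DualNumber.eps : DualNumber A')
  ext <;> simp [dualRingMap]

end DualNumbers

/-! ### Functions given by their values at points with values in affine schemes -/

section Points

variable {S : Scheme.{u}}

lemma exists_spec_nhd {T : Over S} {p : T.left} {U : T.left.Opens} (hp : p ∈ U) :
    ∃ V : T.left.Opens, p ∈ V ∧ V ≤ U ∧
      ∃ (A : CommRingCat.{u}) (g : Spec A ⟶ S), Nonempty (restr T V ≅ Over.mk g) := by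
  obtain ⟨V, hV, hpV, hVU⟩ := exists_isAffineOpen_mem_and_subset hp
  have : IsAffine V.toScheme := hV
  refine ⟨V, hpV, hVU, Γ(V.toScheme, ⊤), V.toScheme.isoSpec.inv ≫ V.ι ≫ T.hom,
    ⟨Over.isoMk V.toScheme.isoSpec ?_⟩⟩
  exact Iso.hom_inv_id_assoc _ _

lemma Fn.ext_of_points {T : Over S} {a b : Fn T}
    (h : ∀ (A : CommRingCat.{u}) (g : Spec A ⟶ S) (p : Over.mk g ⟶ T),
      Fn.pull p a = Fn.pull p b) : a = b := by
  refine Fn.ext_of_locally fun p => ?_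
  obtain ⟨V, hV, -, A, g, ⟨i⟩⟩ := exists_spec_nhd (T := T) (p := p) (U := ⊤) trivial
  refine ⟨V, hV, ?_⟩
  have h1 := congrArg (Fn.pull i.hom) (h A g (i.inv ≫ restrι T V))
  rwa [← Fn.pull_comp, ← Fn.pull_comp, Iso.hom_inv_id_assoc] at h1

/-- A function is a morphism to the affine line, so a natural family of values at points in affine
schemes glues. Affine test schemes suffice, and they are the ones over which dual numbers are
formed. -/
lemma exists_fn_of_points {T : Over S}
    (δ : ∀ (A : CommRingCat.{u}) (g : Spec A ⟶ S), (Over.mk g ⟶ T) → Fn (Over.mk g))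
    (hδ : ∀ (A : CommRingCat.{u}) (g : Spec A ⟶ S) (p : Over.mk g ⟶ T)
      (A' : CommRingCat.{u}) (g' : Spec A' ⟶ S) (h : Over.mk g' ⟶ Over.mk g),
      δ A' g' (h ≫ p) = Fn.pull h (δ A g p)) :
    ∃ b : Fn T, ∀ (A : CommRingCat.{u}) (g : Spec A ⟶ S) (p : Over.mk g ⟶ T),
      δ A g p = Fn.pull p b := by
  obtain ⟨b, hb⟩ := exists_of_locally (T := T) (X := Over.mk (𝔸(PUnit.{u+1}; S) ↘ S))
    (fun {T'} f x => ∀ (A : CommRingCat.{u}) (g : Spec A ⟶ S) (p : Over.mk g ⟶ T'),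
      δ A g (p ≫ f) = Fn.pull p (lineEquiv T' x))
    (fun g f x hx A σ p => by
      rw [← Category.assoc, hx, lineEquiv_comp, Fn.pull_comp])
    (fun f x y hx hy => (lineEquiv _).injective (Fn.ext_of_points fun A g p => by
      rw [← hx, ← hy]))
    (fun p => by
      obtain ⟨V, hV, -, A, g, ⟨i⟩⟩ := exists_spec_nhd (T := T) (p := p) (U := ⊤) trivial
      refine ⟨V, hV, (lineEquiv _).symm (Fn.pull i.hom (δ A g (i.inv ≫ restrι T V))), ?_⟩
      intro A' g' p
      rw [Equiv.apply_symm_apply, ← Fn.pull_comp, ← hδ, Category.assoc, Iso.hom_inv_id_assoc])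
  refine ⟨lineEquiv T b, fun A g p => Fn.ext_of_locally fun q => ?_⟩
  obtain ⟨U, hU, hP⟩ := hb (p.left q)
  obtain ⟨V, hV, hVU, A', g', ⟨i⟩⟩ := exists_spec_nhd (T := Over.mk g) (p := q)
    (U := p.left ⁻¹ᵁ U) hU
  refine ⟨V, hV, ?_⟩
  have hl : ∀ o, (restrι (Over.mk g) V ≫ p).left o ∈ U := fun o => hVU o.2
  have h1 := liftRestr_restrι _ U hl
  generalize liftRestr _ U hl = l at h1
  have h2 := hP A' g' (i.inv ≫ l)
  rw [Category.assoc, h1, lineEquiv_comp, ← Fn.pull_comp, Category.assoc, h1,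
    ← Category.assoc, hδ, Fn.pull_comp (i.inv ≫ _)] at h2
  have h3 := congrArg (Fn.pull i.hom) h2
  rwa [← Fn.pull_comp, ← Fn.pull_comp, Iso.hom_inv_id_assoc] at h3

end Points

/-! ### Sections of the normal sheaf given by their values at points -/

section NormalVectors

lemma appLE_congr_hom {X Y : Scheme.{u}} {f f' : X ⟶ Y} (e : f = f') {U : Y.Opens} {V : X.Opens}
    (h : V ≤ f ⁻¹ᵁ U) (h' : V ≤ f' ⁻¹ᵁ U) (a : Γ(Y, U)) : f.appLE U V h a = f'.appLE U V h' a := by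
  subst e
  rfl

lemma appLE_appLE {X Y Z : Scheme.{u}} (f : X ⟶ Y) (g : Y ⟶ Z) {U : Z.Opens} {V : Y.Opens}
    {W : X.Opens} (h₁ : V ≤ g ⁻¹ᵁ U) (h₂ : W ≤ f ⁻¹ᵁ V) (h : W ≤ (f ≫ g) ⁻¹ᵁ U) (a : Γ(Z, U)) :
    f.appLE V W h₂ (g.appLE U V h₁ a) = (f ≫ g).appLE U W h a :=
  ConcreteCategory.congr_hom (Scheme.Hom.appLE_comp_appLE f g U V W h₁ h₂) a

lemma appLE_map {X Y : Scheme.{u}} (f : X ⟶ Y) {U U' : Y.Opens} {V : X.Opens} (i : U' ≤ U)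
    (h : V ≤ f ⁻¹ᵁ U') (h' : V ≤ f ⁻¹ᵁ U) (a : Γ(Y, U)) :
    f.appLE U' V h (Y.presheaf.map (homOfLE i).op a) = f.appLE U V h' a :=
  ConcreteCategory.congr_hom (Scheme.Hom.map_appLE f h (homOfLE i).op) a

/-! ### Functions on an open subscheme, tested at points in affine schemes. -/

section Points

variable {S : Scheme.{u}}

lemma bijective_appLE_restrι (T : Over S) (W : T.left.Opens) (h : ⊤ ≤ (restrι T W).left ⁻¹ᵁ W) :
    Function.Bijective ((restrι T W).left.appLE W ⊤ h) := by
  have hW : ∀ h' : ⊤ ≤ W.ι ⁻¹ᵁ W, W.ι.appLE W ⊤ h' = W.topIso.inv := by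
    intro h'
    rw [Scheme.Opens.ι_appLE]
    rfl
  have := ConcreteCategory.bijective_of_isIso W.topIso.inv
  rw [← hW h] at this
  exact this

lemma pull_appLE {X : Scheme.{u}} {T' T : Over S} (f : T' ⟶ T) (y : T.left ⟶ X) {U : X.Opens}
    (h : ⊤ ≤ y ⁻¹ᵁ U) (h' : ⊤ ≤ (f.left ≫ y) ⁻¹ᵁ U) (a : Γ(X, U)) :
    Fn.pull f (y.appLE U ⊤ h a) = (f.left ≫ y).appLE U ⊤ h' a :=
  (ConcreteCategory.congr_hom (Scheme.Hom.app_eq_appLE f.left) _).trans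
    (appLE_appLE f.left y h le_top h' a)

lemma appLE_comp_left {T'' T' T : Over S} (g : T'' ⟶ T') (f : T' ⟶ T) {U : T.left.Opens}
    (h : ⊤ ≤ f.left ⁻¹ᵁ U) (h' : ⊤ ≤ (g ≫ f).left ⁻¹ᵁ U) (a : Γ(T.left, U)) :
    (g ≫ f).left.appLE U ⊤ h' a = Fn.pull g (f.left.appLE U ⊤ h a) :=
  (pull_appLE g f.left h h' a).symm

lemma section_ext_of_points {T : Over S} {W : T.left.Opens} {a b : Γ(T.left, W)}
    (h : ∀ (A : CommRingCat.{u}) (g : Spec A ⟶ S) (p : Over.mk g ⟶ T) (hp : ⊤ ≤ p.left ⁻¹ᵁ W),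
      p.left.appLE W ⊤ hp a = p.left.appLE W ⊤ hp b) : a = b := by
  have hW : ⊤ ≤ (restrι T W).left ⁻¹ᵁ W := fun x _ => x.2
  refine (bijective_appLE_restrι T W hW).1 (Fn.ext_of_points fun A g q => ?_)
  have hq : ⊤ ≤ (q ≫ restrι T W).left ⁻¹ᵁ W := fun x _ => hW trivial
  exact (appLE_comp_left q (restrι T W) hW hq a).symm.trans
    ((h A g _ hq).trans (appLE_comp_left q (restrι T W) hW hq b))

lemma exists_section_of_points {T : Over S} (W : T.left.Opens)
    (δ : ∀ (A : CommRingCat.{u}) (g : Spec A ⟶ S) (p : Over.mk g ⟶ T), ⊤ ≤ p.left ⁻¹ᵁ W →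
      Fn (Over.mk g))
    (hδ : ∀ (A : CommRingCat.{u}) (g : Spec A ⟶ S) (p : Over.mk g ⟶ T) (hp : ⊤ ≤ p.left ⁻¹ᵁ W)
      (A' : CommRingCat.{u}) (g' : Spec A' ⟶ S) (h : Over.mk g' ⟶ Over.mk g)
      (hp' : ⊤ ≤ (h ≫ p).left ⁻¹ᵁ W), δ A' g' (h ≫ p) hp' = Fn.pull h (δ A g p hp)) :
    ∃ b : Γ(T.left, W), ∀ (A : CommRingCat.{u}) (g : Spec A ⟶ S) (p : Over.mk g ⟶ T)
      (hp : ⊤ ≤ p.left ⁻¹ᵁ W), p.left.appLE W ⊤ hp b = δ A g p hp := by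
  have hW : ⊤ ≤ (restrι T W).left ⁻¹ᵁ W := fun x _ => x.2
  have hl : ∀ {A : CommRingCat.{u}} {g : Spec A ⟶ S} (q : Over.mk g ⟶ restr T W),
      ⊤ ≤ (q ≫ restrι T W).left ⁻¹ᵁ W := fun q x _ => hW trivial
  obtain ⟨b', hb'⟩ := exists_fn_of_points (T := restr T W)
    (fun A g q => δ A g (q ≫ restrι T W) (hl q)) (fun A g q A' g' h => by
      have hq := hl (h ≫ q)
      have := hδ A g _ (hl q) A' g' h (by rwa [Category.assoc] at hq)
      rw [← this]
      congr 1)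
  obtain ⟨b, rfl⟩ := (bijective_appLE_restrι T W hW).2 b'
  refine ⟨b, fun A g p hp => ?_⟩
  obtain ⟨l, rfl⟩ : ∃ l, l ≫ restrι T W = p :=
    ⟨liftRestr p W fun x => hp trivial, liftRestr_restrι _ _ _⟩
  exact (appLE_comp_left l (restrι T W) hW hp b).trans (hb' A g l).symm

end Points

variable {Z X : Scheme.{u}} {i : Z ⟶ X}

/-- The pullback to `T` of functions on `X` defined near its image. -/
def pullNear (i : Z ⟶ X) (T : Over Z) (U : X.Opens) (h : ⊤ ≤ (T.hom ≫ i) ⁻¹ᵁ U) :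
    Γ(X, U) →+* Fn T :=
  ((T.hom ≫ i).appLE U ⊤ h).hom

/-- The value of a section of the normal sheaf on a function defined near the image of a point. -/
def NormalVector.val {T' T : Over Z} (D : NormalVector i T) (f : T' ⟶ T) (U : X.affineOpens)
    (h : ⊤ ≤ (T'.hom ≫ i) ⁻¹ᵁ U.1) (a : i.ker.ideal U) : Fn T' :=
  f.left.appLE _ ⊤ (h.trans (preimage_le_of_over i f U.1)) (D.app U a)

lemma NormalVector.val_comp {T'' T' T : Over Z} (D : NormalVector i T) (g : T'' ⟶ T') (f : T' ⟶ T)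
    (U : X.affineOpens) (h : ⊤ ≤ (T'.hom ≫ i) ⁻¹ᵁ U.1) (h' : ⊤ ≤ (T''.hom ≫ i) ⁻¹ᵁ U.1)
    (a : i.ker.ideal U) : D.val (g ≫ f) U h' a = Fn.pull g (D.val f U h a) :=
  appLE_comp_left g f _ _ _

lemma NormalVector.val_add {T' T : Over Z} (D : NormalVector i T) (f : T' ⟶ T) (U : X.affineOpens)
    (h : ⊤ ≤ (T'.hom ≫ i) ⁻¹ᵁ U.1) (a b : i.ker.ideal U) :
    D.val f U h (a + b) = D.val f U h a + D.val f U h b := by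
  rw [val, D.map_add]
  exact _root_.map_add (f.left.appLE _ _ _).hom _ _

lemma pull_app_of_over {T' T : Over Z} (f : T' ⟶ T) (U : X.affineOpens)
    (h : ⊤ ≤ (T'.hom ≫ i) ⁻¹ᵁ U.1) (c : Γ(X, U.1)) :
    f.left.appLE _ ⊤ (h.trans (preimage_le_of_over i f U.1)) ((T.hom ≫ i).app U.1 c) =
      pullNear i T' U.1 h c := by
  have e : f.left ≫ T.hom ≫ i = T'.hom ≫ i := by rw [← Category.assoc, Over.w]
  rw [Scheme.Hom.app_eq_appLE]
  refine (appLE_appLE f.left (T.hom ≫ i) le_rfl (h.trans (preimage_le_of_over i f U.1)) ?_ c).trans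
    (appLE_congr_hom e _ h c)
  rw [e]
  exact h

lemma NormalVector.val_smul {T' T : Over Z} (D : NormalVector i T) (f : T' ⟶ T)
    (U : X.affineOpens) (h : ⊤ ≤ (T'.hom ≫ i) ⁻¹ᵁ U.1) (c : Γ(X, U.1)) (a : i.ker.ideal U) :
    D.val f U h (c • a) = pullNear i T' U.1 h c * D.val f U h a := by
  rw [val, D.map_smul]
  refine (map_mul (f.left.appLE _ _ _).hom _ _).trans (congrArg (· * _) ?_)
  exact pull_app_of_over f U h c

lemma NormalVector.val_res {T' T : Over Z} (D : NormalVector i T) (f : T' ⟶ T)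
    (U V : X.affineOpens) (hVU : V.1 ≤ U.1) (hU : ⊤ ≤ (T'.hom ≫ i) ⁻¹ᵁ U.1)
    (hV : ⊤ ≤ (T'.hom ≫ i) ⁻¹ᵁ V.1) (a : i.ker.ideal U) (b : i.ker.ideal V)
    (hab : X.presheaf.map (homOfLE hVU).op a.1 = b.1) : D.val f V hV b = D.val f U hU a := by
  rw [val, D.map_res U V hVU a b hab]
  exact appLE_map f.left ((T.hom ≫ i).preimage_mono hVU) _ _ _

lemma NormalVector.ext_of_points {T : Over Z} {D D' : NormalVector i T}
    (h : ∀ (A : CommRingCat.{u}) (g : Spec A ⟶ Z) (p : Over.mk g ⟶ T) (U : X.affineOpens)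
      (hp : ⊤ ≤ (g ≫ i) ⁻¹ᵁ U.1) (a : i.ker.ideal U), D.val p U hp a = D'.val p U hp a) :
    D = D' := by
  ext U a
  refine section_ext_of_points fun A g p hp => ?_
  refine h A g p U (hp.trans ?_) a
  change (p.left ≫ T.hom ≫ i) ⁻¹ᵁ U.1 ≤ _
  rw [← Category.assoc, Over.w p]
  exact le_rfl

/-- Each ideal element gets a function on the preimage of `U` by gluing its values at points; the
axioms of a normal vector are identities of functions and can be checked at points. -/
lemma exists_normalVector_of_points {T : Over Z}
    (δ : ∀ (A : CommRingCat.{u}) (g : Spec A ⟶ Z), (Over.mk g ⟶ T) → ∀ U : X.affineOpens,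
      ⊤ ≤ (g ≫ i) ⁻¹ᵁ U.1 → i.ker.ideal U → Fn (Over.mk g))
    (hcomp : ∀ (A : CommRingCat.{u}) (g : Spec A ⟶ Z) (p : Over.mk g ⟶ T) (A' : CommRingCat.{u})
      (g' : Spec A' ⟶ Z) (h : Over.mk g' ⟶ Over.mk g) (U : X.affineOpens)
      (hp : ⊤ ≤ (g ≫ i) ⁻¹ᵁ U.1) (hp' : ⊤ ≤ (g' ≫ i) ⁻¹ᵁ U.1) (a : i.ker.ideal U),
      δ A' g' (h ≫ p) U hp' a = Fn.pull h (δ A g p U hp a))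
    (hadd : ∀ (A : CommRingCat.{u}) (g : Spec A ⟶ Z) (p : Over.mk g ⟶ T) (U : X.affineOpens)
      (hp : ⊤ ≤ (g ≫ i) ⁻¹ᵁ U.1) (a b : i.ker.ideal U),
      δ A g p U hp (a + b) = δ A g p U hp a + δ A g p U hp b)
    (hsmul : ∀ (A : CommRingCat.{u}) (g : Spec A ⟶ Z) (p : Over.mk g ⟶ T) (U : X.affineOpens)
      (hp : ⊤ ≤ (g ≫ i) ⁻¹ᵁ U.1) (c : Γ(X, U.1)) (a : i.ker.ideal U),
      δ A g p U hp (c • a) = pullNear i (Over.mk g) U.1 hp c * δ A g p U hp a)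
    (hres : ∀ (A : CommRingCat.{u}) (g : Spec A ⟶ Z) (p : Over.mk g ⟶ T) (U V : X.affineOpens)
      (hVU : V.1 ≤ U.1) (hU : ⊤ ≤ (g ≫ i) ⁻¹ᵁ U.1) (hV : ⊤ ≤ (g ≫ i) ⁻¹ᵁ V.1)
      (a : i.ker.ideal U) (b : i.ker.ideal V), X.presheaf.map (homOfLE hVU).op a.1 = b.1 →
      δ A g p V hV b = δ A g p U hU a) :
    ∃ D : NormalVector i T, ∀ (A : CommRingCat.{u}) (g : Spec A ⟶ Z) (p : Over.mk g ⟶ T)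
      (U : X.affineOpens) (hp : ⊤ ≤ (g ≫ i) ⁻¹ᵁ U.1) (a : i.ker.ideal U),
      D.val p U hp a = δ A g p U hp a := by
  have hle : ∀ {A : CommRingCat.{u}} {g : Spec A ⟶ Z} (p : Over.mk g ⟶ T) {U : X.Opens},
      ⊤ ≤ p.left ⁻¹ᵁ ((T.hom ≫ i) ⁻¹ᵁ U) → ⊤ ≤ (g ≫ i) ⁻¹ᵁ U := by
    intro A g p U hp
    refine hp.trans ?_
    change (p.left ≫ T.hom ≫ i) ⁻¹ᵁ U ≤ _
    rw [← Category.assoc, Over.w p]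
    exact le_rfl
  have hex : ∀ (U : X.affineOpens) (a : i.ker.ideal U), ∃ b : Γ(T.left, (T.hom ≫ i) ⁻¹ᵁ U.1),
      ∀ (A : CommRingCat.{u}) (g : Spec A ⟶ Z) (p : Over.mk g ⟶ T)
        (hp : ⊤ ≤ p.left ⁻¹ᵁ ((T.hom ≫ i) ⁻¹ᵁ U.1)),
        p.left.appLE _ ⊤ hp b = δ A g p U (hle p hp) a := fun U a =>
    exists_section_of_points _ (fun A g p hp => δ A g p U (hle p hp) a)
      fun A g p hp A' g' h hp' => hcomp A g p A' g' h U _ _ a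
  choose b hb using hex
  refine ⟨⟨b, fun U x y => ?_, fun U c x => ?_, fun U V hVU x y hxy => ?_⟩,
    fun A g p U hp a => hb U a A g p _⟩
  · refine section_ext_of_points fun A g p hp => ?_
    refine (hb _ _ A g p hp).trans ((hadd _ _ _ _ _ _ _).trans (Eq.symm ?_))
    exact (_root_.map_add (p.left.appLE _ _ _).hom _ _).trans
      (congrArg₂ (· + ·) (hb _ _ A g p hp) (hb _ _ A g p hp))
  · refine section_ext_of_points fun A g p hp => ?_
    refine (hb _ _ A g p hp).trans ((hsmul _ _ _ _ _ _ _).trans (Eq.symm ?_))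
    exact (map_mul (p.left.appLE _ _ _).hom _ _).trans
      (congrArg₂ (· * ·) (pull_app_of_over p U (hle p hp) c) (hb _ _ A g p hp))
  · refine section_ext_of_points fun A g p hp => ?_
    have hU : ⊤ ≤ p.left ⁻¹ᵁ ((T.hom ≫ i) ⁻¹ᵁ U.1) := fun x hx => hVU (hp hx)
    refine (hb _ _ A g p hp).trans ((hres A g p U V hVU (hle p hU) _ x y hxy).trans ?_)
    exact ((hb U x A g p hU).symm.trans
      (appLE_map p.left ((T.hom ≫ i).preimage_mono hVU) hp hU _).symm)

/-- Linearity determines the values on the ideal over `O` from those on generators. The ideal over a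
smaller affine `V` is generated by restrictions of elements of the ideal over `O`. -/
lemma NormalVector.val_eq_of_generators_of_le {T T₁ T₂ : Over Z} {D₁ : NormalVector i T₁}
    {D₂ : NormalVector i T₂} {p₁ : T ⟶ T₁} {p₂ : T ⟶ T₂} {O : X.affineOpens}
    (hO : ⊤ ≤ (T.hom ≫ i) ⁻¹ᵁ O.1) {J : Type*} {s : J → i.ker.ideal O}
    (hs : Submodule.span Γ(X, O.1) (Set.range s) = ⊤)
    (h : ∀ j, D₁.val p₁ O hO (s j) = D₂.val p₂ O hO (s j)) (V : X.affineOpens)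
    (hV : ⊤ ≤ (T.hom ≫ i) ⁻¹ᵁ V.1) (hVO : V.1 ≤ O.1) (b : i.ker.ideal V) :
    D₁.val p₁ V hV b = D₂.val p₂ V hV b := by
  have zero_val : ∀ {T' : Over Z} (D : NormalVector i T') (p : T ⟶ T') (V : X.affineOpens)
      (hV : ⊤ ≤ (T.hom ≫ i) ⁻¹ᵁ V.1), D.val p V hV 0 = 0 := by
    intro T' D p V hV
    have := D.val_add p V hV 0 0
    rwa [add_zero, left_eq_add] at this
  have h1 : ∀ a : i.ker.ideal O, D₁.val p₁ O hO a = D₂.val p₂ O hO a := by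
    intro a
    have ha : a ∈ Submodule.span Γ(X, O.1) (Set.range s) := hs ▸ Submodule.mem_top
    induction ha using Submodule.span_induction with
    | mem x hx =>
      obtain ⟨j, rfl⟩ := hx
      exact h j
    | zero => rw [zero_val, zero_val]
    | add x y _ _ hx hy => rw [val_add, val_add, hx, hy]
    | smul c x _ hx => rw [val_smul, val_smul, hx]
  obtain ⟨b, hb⟩ := b
  have hmap := i.ker.map_ideal (U := V) (V := O) hVO
  have hmem : ∀ x ∈ (X.presheaf.map (homOfLE hVO).op).hom '' (i.ker.ideal O : Set Γ(X, O.1)),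
      x ∈ i.ker.ideal V := fun x hx => hmap ▸ Ideal.subset_span hx
  have hb' : b ∈ Ideal.span
      ((X.presheaf.map (homOfLE hVO).op).hom '' (i.ker.ideal O : Set Γ(X, O.1))) := hmap.ge hb
  have hle := Ideal.span_le.mpr hmem
  induction hb' using Submodule.span_induction with
  | mem x hx =>
    obtain ⟨y, hy, rfl⟩ := hx
    rw [D₁.val_res p₁ O V hVO hO hV ⟨y, hy⟩ _ rfl, D₂.val_res p₂ O V hVO hO hV ⟨y, hy⟩ _ rfl]
    exact h1 _
  | zero => exact (zero_val D₁ p₁ V hV).trans (zero_val D₂ p₂ V hV).symm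
  | add x y hx hy hx' hy' =>
    exact (D₁.val_add p₁ V hV ⟨x, hle hx⟩ ⟨y, hle hy⟩).trans
      ((congrArg₂ (· + ·) (hx' _) (hy' _)).trans (D₂.val_add p₂ V hV ⟨x, _⟩ ⟨y, _⟩).symm)
  | smul c x hx hx' =>
    exact (D₁.val_smul p₁ V hV c ⟨x, hle hx⟩).trans
      ((congrArg (_ * ·) (hx' _)).trans (D₂.val_smul p₂ V hV c ⟨x, _⟩).symm)
-- `U` need not be contained in `O`: around each point both values are compared over an affine open
-- subscheme of `O ∩ U`.
lemma NormalVector.val_eq_of_generators {T T₁ T₂ : Over Z} {D₁ : NormalVector i T₁}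
    {D₂ : NormalVector i T₂} {p₁ : T ⟶ T₁} {p₂ : T ⟶ T₂} {O : X.affineOpens}
    (hO : ⊤ ≤ (T.hom ≫ i) ⁻¹ᵁ O.1) {J : Type*} {s : J → i.ker.ideal O}
    (hs : Submodule.span Γ(X, O.1) (Set.range s) = ⊤)
    (h : ∀ j, D₁.val p₁ O hO (s j) = D₂.val p₂ O hO (s j)) (U : X.affineOpens)
    (hU : ⊤ ≤ (T.hom ≫ i) ⁻¹ᵁ U.1) (a : i.ker.ideal U) :
    D₁.val p₁ U hU a = D₂.val p₂ U hU a := by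
  refine Fn.ext_of_locally fun q => ?_
  have hq : i (T.hom q) ∈ O.1 ⊓ U.1 := ⟨hO trivial, hU trivial⟩
  obtain ⟨V, hV, hqV, hVle⟩ := exists_isAffineOpen_mem_and_subset hq
  have hW : ⊤ ≤ ((restr T ((T.hom ≫ i) ⁻¹ᵁ V)).hom ≫ i) ⁻¹ᵁ V := fun x _ => x.2
  refine ⟨(T.hom ≫ i) ⁻¹ᵁ V, hqV, ?_⟩
  have hWU : ⊤ ≤ ((restr T ((T.hom ≫ i) ⁻¹ᵁ V)).hom ≫ i) ⁻¹ᵁ U.1 := fun x hx => (hVle (hW hx)).2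
  have hWO : ⊤ ≤ ((restr T ((T.hom ≫ i) ⁻¹ᵁ V)).hom ≫ i) ⁻¹ᵁ O.1 := fun x hx => (hVle (hW hx)).1
  have ha : X.presheaf.map (homOfLE fun x hx => (hVle hx).2 : V ⟶ U.1).op a.1 ∈
      i.ker.ideal ⟨V, hV⟩ := by
    have hmap := i.ker.map_ideal (U := ⟨V, hV⟩) (V := U) fun x hx => (hVle hx).2
    exact hmap ▸ Ideal.mem_map_of_mem _ a.2
  rw [← D₁.val_comp _ p₁ U hU hWU, ← D₂.val_comp _ p₂ U hU hWU,
    ← D₁.val_res _ U ⟨V, hV⟩ (fun x hx => (hVle hx).2) hWU hW a ⟨_, ha⟩ rfl,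
    ← D₂.val_res _ U ⟨V, hV⟩ (fun x hx => (hVle hx).2) hWU hW a ⟨_, ha⟩ rfl]
  refine val_eq_of_generators_of_le hWO hs (fun j => ?_) ⟨V, hV⟩ hW (fun x hx => (hVle hx).1) _
  rw [D₁.val_comp _ p₁ O hO hWO, D₂.val_comp _ p₂ O hO hWO, h]


lemma appLE_eq_zero_of_mem_ker {Y : Scheme.{u}} (g : Y ⟶ Z) {U : X.affineOpens} {V : Y.Opens}
    (h : V ≤ (g ≫ i) ⁻¹ᵁ U.1) (a : i.ker.ideal U) : (g ≫ i).appLE U.1 V h a.1 = 0 := by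
  have h0 : i.app U.1 a.1 = 0 := i.ideal_ker_le U a.2
  refine (appLE_appLE g i le_rfl h h a.1).symm.trans ?_
  rw [← Scheme.Hom.app_eq_appLE, h0]
  exact map_zero (g.appLE _ _ _).hom

/-- Every prime of `A[ε]` contains the nilpotent ideal `ε A`. A deformation thus has the same image
as the undeformed point and stays in every open subscheme containing it. -/
lemma dualZero_surjective {S : Scheme.{u}} {A : CommRingCat.{u}} (σ : Spec A ⟶ S) :
    Function.Surjective (dualZero σ).left := by
  intro q
  let q' : PrimeSpectrum (DualNumber A) := q
  refine ⟨(dualProj σ).left q, ?_⟩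
  change PrimeSpectrum.comap (TrivSqZeroExt.fstHom A A A).toRingHom
    (PrimeSpectrum.comap (TrivSqZeroExt.inlHom A A) q') = q'
  ext z
  have hε : ∀ b : A, (TrivSqZeroExt.inr b : DualNumber A) ∈ q'.asIdeal := fun b =>
    q'.isPrime.mem_of_pow_mem 2 (by simp [pow_two])
  have hz := TrivSqZeroExt.inl_fst_add_inr_snd_eq z
  change TrivSqZeroExt.inl z.fst ∈ q'.asIdeal ↔ z ∈ q'.asIdeal
  conv_rhs => rw [← hz]
  exact (Ideal.add_mem_iff_left _ (hε z.snd)).symm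

lemma le_preimage_of_dualZero {A : CommRingCat.{u}} {g : Spec A ⟶ Z} {y : (dualOver g).left ⟶ X}
    (hy₀ : (dualZero g).left ≫ y = g ≫ i) {U : X.Opens} (hp : ⊤ ≤ (g ≫ i) ⁻¹ᵁ U) :
    ⊤ ≤ y ⁻¹ᵁ U := by
  intro q _
  obtain ⟨q, rfl⟩ := dualZero_surjective g q
  have := hp (trivial : q ∈ ⊤)
  rw [← hy₀] at this
  exact this

/-- First order deformations of the points of `Z` in `X` define a section of the normal sheaf. -/
theorem exists_normalVector_of_deformations {T : Over Z}
    (y : ∀ (A : CommRingCat.{u}) (g : Spec A ⟶ Z), (Over.mk g ⟶ T) → ((dualOver g).left ⟶ X))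
    (hy₀ : ∀ (A : CommRingCat.{u}) (g : Spec A ⟶ Z) (p : Over.mk g ⟶ T),
      (dualZero g).left ≫ y A g p = g ≫ i)
    (hy : ∀ (A : CommRingCat.{u}) (g : Spec A ⟶ Z) (p : Over.mk g ⟶ T) (A' : CommRingCat.{u})
      (g' : Spec A' ⟶ Z) (h : Over.mk g' ⟶ Over.mk g),
      y A' g' (h ≫ p) = (dualMap h).left ≫ y A g p) :
    ∃ D : NormalVector i T, ∀ (A : CommRingCat.{u}) (g : Spec A ⟶ Z) (p : Over.mk g ⟶ T)
      (U : X.affineOpens) (hp : ⊤ ≤ (g ≫ i) ⁻¹ᵁ U.1) (hyU : ⊤ ≤ (y A g p) ⁻¹ᵁ U.1)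
      (a : i.ker.ideal U), (y A g p).appLE U.1 ⊤ hyU a.1 =
        dualEps g * Fn.pull (dualProj g) (D.val p U hp a) := by
  have hU : ∀ (A : CommRingCat.{u}) (g : Spec A ⟶ Z) (p : Over.mk g ⟶ T) (U : X.Opens),
      ⊤ ≤ (g ≫ i) ⁻¹ᵁ U → ⊤ ≤ (y A g p) ⁻¹ᵁ U := fun A g p U hp =>
    le_preimage_of_dualZero (hy₀ A g p) hp
  have hzero : ∀ (A : CommRingCat.{u}) (g : Spec A ⟶ Z) (p : Over.mk g ⟶ T) (U : X.Opens)
      (hp : ⊤ ≤ (g ≫ i) ⁻¹ᵁ U) (hyU : ⊤ ≤ (y A g p) ⁻¹ᵁ U) (c : Γ(X, U)),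
      Fn.pull (dualZero g) ((y A g p).appLE U ⊤ hyU c) = pullNear i (Over.mk g) U hp c := by
    intro A g p U hp hyU c
    exact (pull_appLE (dualZero g) (y A g p) hyU (by rw [hy₀]; exact hp) c).trans
      (appLE_congr_hom (hy₀ A g p) _ hp c)
  -- An element of the ideal vanishes on `Z`, so its value on the deformation is zero modulo `ε` and
  -- has the form `ε b`; this `b` is the value of the normal vector.
  have hex : ∀ (A : CommRingCat.{u}) (g : Spec A ⟶ Z) (p : Over.mk g ⟶ T) (U : X.affineOpens)
      (hp : ⊤ ≤ (g ≫ i) ⁻¹ᵁ U.1) (a : i.ker.ideal U), ∃ b : Fn (Over.mk g),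
      (y A g p).appLE U.1 ⊤ (hU A g p U.1 hp) a.1 = dualEps g * Fn.pull (dualProj g) b := by
    intro A g p U hp a
    obtain ⟨b, hb⟩ := exists_eq_add_dualEps_mul g
      ((y A g p).appLE U.1 ⊤ (hU A g p U.1 hp) a.1)
    refine ⟨b, hb.trans ?_⟩
    have h0 : pullNear i (Over.mk g) U.1 hp a.1 = 0 := appLE_eq_zero_of_mem_ker g hp a
    rw [hzero A g p U.1 hp, h0, map_zero, zero_add]
  choose δ hδ using hex
  obtain ⟨D, hD⟩ := exists_normalVector_of_points δ
    (fun A g p A' g' h U hp hp' a => dualEps_mul_injective g' (by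
      rw [← hδ, ← Fn.pull_comp, ← dualMap_dualProj, Fn.pull_comp, ← pull_dualMap_dualEps h,
        ← map_mul, ← hδ]
      have hh := hU A' g' (h ≫ p) U.1 hp'
      exact (appLE_congr_hom (hy A g p A' g' h) _ (by rw [← hy]; exact hh) a.1).trans
        (pull_appLE (dualMap h) (y A g p) _ _ a.1).symm))
    (fun A g p U hp a b => dualEps_mul_injective g (by
      rw [map_add, mul_add, ← hδ, ← hδ, ← hδ]
      exact map_add ((y A g p).appLE U.1 ⊤ _).hom _ _))
    (fun A g p U hp c a => dualEps_mul_injective g (by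
      rw [← hδ, map_mul]
      refine (map_mul ((y A g p).appLE U.1 ⊤ (hU A g p U.1 hp)).hom c a.1).trans ?_
      refine (congrArg (_ * ·) (hδ A g p U hp a)).trans ?_
      -- The first order part of `c` meets a multiple of `ε` and is killed by `ε² = 0`, so `c` acts
      -- through its restriction to `Z`.
      obtain ⟨b, hb⟩ := exists_eq_add_dualEps_mul g
        ((y A g p).appLE U.1 ⊤ (hU A g p U.1 hp) c)
      rw [hzero A g p U.1 hp] at hb
      refine (congrArg (· * _) hb).trans ?_
      linear_combination (Fn.pull (dualProj g) b * Fn.pull (dualProj g) (δ A g p U hp a)) *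
        dualEps_mul_self g))
    (fun A g p U V hVU hU' hV a b hab => dualEps_mul_injective g (by
      rw [← hδ, ← hδ, ← hab]
      exact appLE_map _ hVU _ _ _))
  exact ⟨D, fun A g p U hp hyU a => by rw [hD, ← hδ]⟩

end NormalVectors

/-! ### Identification of a vector bundle with a normal bundle -/

section NormalCharts

variable {Z X : Scheme.{u}} {i : Z ⟶ X}

/-- The sum of two sections of the normal sheaf. -/
def NormalVector.add {T : Over Z} (D D' : NormalVector i T) : NormalVector i T where
  app U a := D.app U a + D'.app U a
  map_add U x y := by
    rw [D.map_add, D'.map_add]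
    exact add_add_add_comm _ _ _ _
  map_smul U a x := by
    rw [D.map_smul, D'.map_smul, mul_add]
  map_res U V h x y hxy := by
    rw [D.map_res U V h x y hxy, D'.map_res U V h x y hxy]
    exact (_root_.map_add (T.left.presheaf.map _).hom _ _).symm

/-- The product of a section of the normal sheaf with a function. -/
def NormalVector.smul {T : Over Z} (c : Fn T) (D : NormalVector i T) : NormalVector i T where
  app U a := T.left.presheaf.map (homOfLE le_top).op c * D.app U a
  map_add U x y := by rw [D.map_add, mul_add]
  map_smul U a x := by rw [D.map_smul, mul_left_comm]
  map_res U V h x y hxy := by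
    rw [D.map_res U V h x y hxy]
    refine Eq.trans (congrArg (· * _) ?_) (_root_.map_mul (T.left.presheaf.map _).hom _ _).symm
    refine Eq.trans ?_ (ConcreteCategory.congr_hom (T.left.presheaf.map_comp _ _) c)
    rfl

lemma NormalVector.val_add_left {T' T : Over Z} (D D' : NormalVector i T) (f : T' ⟶ T)
    (U : X.affineOpens) (h : ⊤ ≤ (T'.hom ≫ i) ⁻¹ᵁ U.1) (a : i.ker.ideal U) :
    (D.add D').val f U h a = D.val f U h a + D'.val f U h a :=
  _root_.map_add (f.left.appLE _ _ _).hom _ _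

lemma NormalVector.val_smul_left {T' T : Over Z} (c : Fn T) (D : NormalVector i T) (f : T' ⟶ T)
    (U : X.affineOpens) (h : ⊤ ≤ (T'.hom ≫ i) ⁻¹ᵁ U.1) (a : i.ker.ideal U) :
    (D.smul c).val f U h a = Fn.pull f c * D.val f U h a := by
  refine (_root_.map_mul (f.left.appLE _ _ _).hom _ _).trans (congrArg (· * _) ?_)
  refine (appLE_map f.left le_top _ le_top c).trans ?_
  exact ConcreteCategory.congr_hom (Scheme.Hom.app_eq_appLE f.left).symm c

lemma NormalVector.ext_of_locally {T : Over Z} {D D' : NormalVector i T}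
    (h : ∀ t : T.left, ∃ W : T.left.Opens, t ∈ W ∧ ∀ (T' : Over Z) (p : T' ⟶ restr T W)
      (U : X.affineOpens) (hU : ⊤ ≤ (T'.hom ≫ i) ⁻¹ᵁ U.1) (a : i.ker.ideal U),
      D.val (p ≫ restrι T W) U hU a = D'.val (p ≫ restrι T W) U hU a) : D = D' := by
  refine ext_of_points fun A g p U hp a => Fn.ext_of_locally fun q => ?_
  obtain ⟨W, hW, hD⟩ := h (p.left q)
  refine ⟨p.left ⁻¹ᵁ W, hW, ?_⟩
  have hl : ∀ o, (restrι (Over.mk g) (p.left ⁻¹ᵁ W) ≫ p).left o ∈ W := fun o => o.2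
  have hU : ⊤ ≤ ((restr (Over.mk g) (p.left ⁻¹ᵁ W)).hom ≫ i) ⁻¹ᵁ U.1 := fun x _ => hp trivial
  rw [← D.val_comp _ p U hp hU, ← D'.val_comp _ p U hp hU, ← liftRestr_restrι _ W hl]
  exact hD _ _ U hU a

lemma NormalVector.ext_of_generators {T : Over Z} {D D' : NormalVector i T}
    (h : ∀ t : T.left, ∃ (O : X.affineOpens) (J : Type) (s : J → i.ker.ideal O),
      i (T.hom t) ∈ O.1 ∧ Submodule.span Γ(X, O.1) (Set.range s) = ⊤ ∧
      ∀ (T' : Over Z) (p : T' ⟶ T) (hO : ⊤ ≤ (T'.hom ≫ i) ⁻¹ᵁ O.1) (j : J),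
        D.val p O hO (s j) = D'.val p O hO (s j)) : D = D' := by
  refine ext_of_locally fun t => ?_
  obtain ⟨O, J, s, ht, hs, hD⟩ := h t
  refine ⟨(T.hom ≫ i) ⁻¹ᵁ O.1, ht, fun T' p U hU a => ?_⟩
  have hO : ⊤ ≤ (T'.hom ≫ i) ⁻¹ᵁ O.1 := by
    have h1 : p.left ≫ (restr T ((T.hom ≫ i) ⁻¹ᵁ O.1)).hom = T'.hom := Over.w p
    rw [← h1]
    exact fun x _ => (p.left x).2
  exact val_eq_of_generators hO hs (fun j => hD T' _ hO j) U hU a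

/-- Normal vectors are determined by their values on local generators of the ideal. If on generators
the map is linear and reaches every system of values exactly once, then it is injective, and any
normal vector is matched locally by sections of `N`, which glue by uniqueness. Relations among the
generators need no separate treatment. -/
theorem exists_normalBundleIso_of_charts {k : ℕ} {N : VectorBundle Z k}
    (ν : ∀ T : Over Z, (T ⟶ N.tot) → NormalVector i T)
    (hν : ∀ {T' T : Over Z} (f : T' ⟶ T) (x : T ⟶ N.tot) (A : CommRingCat.{u}) (g : Spec A ⟶ Z)
      (p : Over.mk g ⟶ T') (U : X.affineOpens) (hp : ⊤ ≤ (g ≫ i) ⁻¹ᵁ U.1) (a : i.ker.ideal U),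
      (ν T' (f ≫ x)).val p U hp a = (ν T x).val (p ≫ f) U hp a)
    (hchart : ∀ z : Z, ∃ (O : X.affineOpens) (J : Type) (s : J → i.ker.ideal O), i z ∈ O.1 ∧
      Submodule.span Γ(X, O.1) (Set.range s) = ⊤ ∧
      ∀ (T : Over Z) (hO : ⊤ ≤ (T.hom ≫ i) ⁻¹ᵁ O.1),
        (∀ x y j, (ν T (x + y)).val (𝟙 T) O hO (s j) =
          (ν T x).val (𝟙 T) O hO (s j) + (ν T y).val (𝟙 T) O hO (s j)) ∧
        (∀ (c : Fn T) x j, (ν T (c • x)).val (𝟙 T) O hO (s j) =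
          c * (ν T x).val (𝟙 T) O hO (s j)) ∧
        Function.Bijective fun (x : T ⟶ N.tot) j => (ν T x).val (𝟙 T) O hO (s j)) :
    ∃ ν' : NormalBundleIso i N, ∀ T x, ν'.equiv T x = ν T x := by
  have hnat : ∀ {T' T : Over Z} (f : T' ⟶ T) (x : T ⟶ N.tot) (U : X.affineOpens)
      (a : i.ker.ideal U), (ν T' (f ≫ x)).app U a =
        f.left.appLE _ _ (preimage_le_of_over i f U.1) ((ν T x).app U a) := by
    intro T' T f x U a
    refine section_ext_of_points fun A g p hp => ?_
    have hp' : ⊤ ≤ (g ≫ i) ⁻¹ᵁ U.1 := by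
      have h1 : p.left ≫ T'.hom = g := Over.w p
      rw [← h1]
      exact fun x hx => hp hx
    refine (hν f x A g p U hp' a).trans ?_
    exact (appLE_appLE p.left f.left (preimage_le_of_over i f U.1) hp _ _).symm
  have hval : ∀ {T'' T' T : Over Z} (p : T'' ⟶ T') (f : T' ⟶ T) (x : T ⟶ N.tot)
      (U : X.affineOpens) (hp : ⊤ ≤ (T''.hom ≫ i) ⁻¹ᵁ U.1) (a : i.ker.ideal U),
      (ν T' (f ≫ x)).val p U hp a = (ν T x).val (p ≫ f) U hp a := by
    intro T'' T' T p f x U hp a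
    rw [NormalVector.val, hnat]
    exact appLE_appLE p.left f.left _ _ _ _
  have hval' : ∀ {T' T : Over Z} (p : T' ⟶ T) (x : T ⟶ N.tot)
      (U : X.affineOpens) (hp : ⊤ ≤ (T'.hom ≫ i) ⁻¹ᵁ U.1) (a : i.ker.ideal U),
      (ν T x).val p U hp a = (ν T' (p ≫ x)).val (𝟙 T') U hp a := by
    intro T' T p x U hp a
    rw [hval, Category.id_comp]
  choose O J s hz hs hL using hchart
  have hadd : ∀ (T : Over Z) (x y : T ⟶ N.tot), ν T (x + y) = (ν T x).add (ν T y) := by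
    intro T x y
    refine NormalVector.ext_of_generators fun t => ⟨O (T.hom t), _, s (T.hom t), hz _, hs _, ?_⟩
    intro T' p hO j
    rw [NormalVector.val_add_left, hval' p, hval' p, hval' p, N.comp_add, (hL _ T' hO).1]
  have hsmul : ∀ (T : Over Z) (c : Fn T) (x : T ⟶ N.tot), ν T (c • x) = (ν T x).smul c := by
    intro T c x
    refine NormalVector.ext_of_generators fun t => ⟨O (T.hom t), _, s (T.hom t), hz _, hs _, ?_⟩
    intro T' p hO j
    rw [NormalVector.val_smul_left, hval' p, hval' p, N.comp_smul, (hL _ T' hO).2.1]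
  have hinj : ∀ T : Over Z, Function.Injective (ν T) := by
    intro T x y hxy
    refine hom_ext_of_locally fun t => ⟨(T.hom ≫ i) ⁻¹ᵁ (O (T.hom t)).1, hz _, ?_⟩
    have hO : ⊤ ≤ ((restr T ((T.hom ≫ i) ⁻¹ᵁ (O (T.hom t)).1)).hom ≫ i) ⁻¹ᵁ (O (T.hom t)).1 :=
      fun x _ => x.2
    refine (hL (T.hom t) _ hO).2.2.1 (funext fun j => ?_)
    refine (hval' (restrι T _) x _ hO _).symm.trans (Eq.trans ?_ (hval' (restrι T _) y _ hO _))
    rw [hxy]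
  have hsurj : ∀ T : Over Z, Function.Surjective (ν T) := by
    intro T D
    -- The local sections of `N` are those with the values of `D` on the generators; injectivity
    -- makes them compatible.
    obtain ⟨x, hx⟩ := exists_of_locally (T := T) (X := N.tot)
      (fun {T'} f x => ∀ (T'' : Over Z) (p : T'' ⟶ T') (U : X.affineOpens)
        (hU : ⊤ ≤ (T''.hom ≫ i) ⁻¹ᵁ U.1) (a : i.ker.ideal U),
        (ν T' x).val p U hU a = D.val (p ≫ f) U hU a)
      (fun g f x hx T₁ p U hU a => by
        rw [hval, hx, Category.assoc])
      (fun f x y hx hy => hinj _ (NormalVector.ext_of_points fun A g p U hp a => by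
        rw [hx _ p U hp, hy _ p U hp]))
      (fun t => by
        have hO : ⊤ ≤ ((restr T ((T.hom ≫ i) ⁻¹ᵁ (O (T.hom t)).1)).hom ≫ i) ⁻¹ᵁ (O (T.hom t)).1 :=
          fun x _ => x.2
        obtain ⟨x, hx⟩ := (hL (T.hom t) _ hO).2.2.2 fun j => D.val (restrι T _) _ hO (s _ j)
        refine ⟨(T.hom ≫ i) ⁻¹ᵁ (O (T.hom t)).1, hz _, x, fun T'' p U hU a => ?_⟩
        have hO' : ⊤ ≤ (T''.hom ≫ i) ⁻¹ᵁ (O (T.hom t)).1 := by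
          have h1 : p.left ≫ (restr T ((T.hom ≫ i) ⁻¹ᵁ (O (T.hom t)).1)).hom = T''.hom := Over.w p
          rw [← h1]
          exact fun x _ => (p.left x).2
        refine NormalVector.val_eq_of_generators hO' (hs _) (fun j => ?_) U hU a
        have h1 := NormalVector.val_comp (ν _ x) p (𝟙 _) _ hO hO' (s _ j)
        rw [Category.comp_id] at h1
        rw [h1, NormalVector.val_comp D p _ _ hO hO']
        exact congrArg (Fn.pull p) (congrFun hx j))
    refine ⟨x, NormalVector.ext_of_locally fun t => ?_⟩
    obtain ⟨W, hW, hP⟩ := hx t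
    refine ⟨W, hW, fun T' p U hU a => ?_⟩
    rw [← hP, hval]
  exact ⟨{ equiv := fun T => Equiv.ofBijective (ν T) ⟨hinj T, hsurj T⟩
           map_add := fun T x y U a => congrArg (fun D => D.app U a) (hadd T x y)
           map_smul := fun T c x U a => congrArg (fun D => D.app U a) (hsmul T c x)
           naturality := fun f x U a => hnat f x U a }, fun _ _ => rfl⟩

end NormalCharts

/-! ### First order deformations of `HGr(E)` in `HGr(F)` -/

section Deformation

variable {S : Scheme.{u}} {n : ℕ} {E : VectorBundle S n} {φ : SymplecticForm E}

/-- If `a` and `b` vanish at field-valued points, the graph is there just `W ⊂ E`, on which `ψ` is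
`φ`. This applies to the nilpotent sections `ε a` and `ε b`. -/
lemma extForm_nondegOn_graph {k : ℕ} {T : Over S} {W : Subbundle E k T} (h : φ.NondegOn W)
    {a b : T ⟶ E.tot} (h0 : ∀ (K : Type u) [Field K] (σ : Spec (.of K) ⟶ S)
      (f : Over.mk σ ⟶ T), f ≫ a = 0 ∧ f ≫ b = 0) : (extForm φ).NondegOn (graph φ W a b) := by
  intro K _ σ f x hx hy
  obtain ⟨hE, hL, hR⟩ := mem_graph.mp hx
  rw [(h0 K σ f).1, map_zero, LinearMap.zero_apply] at hL
  rw [(h0 K σ f).2, map_zero, LinearMap.zero_apply] at hR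
  refine vec_ext (hL.trans (map_zero _).symm) ?_ (hR.trans (map_zero _).symm)
  rw [map_zero]
  refine h K σ f _ hE fun y hy' => ?_
  have := hy _ (vec_mem_graph hy')
  rwa [extForm_apply, hL, hR, zero_mul, zero_mul, zero_add, sub_zero, coordE_vec] at this

variable {r : ℕ} (HE : HGr φ r) (GF : Gr (extBundle E) (2 * r)) (HF : HGr (extForm φ) r)
  {A : CommRingCat.{u}} {g : Spec A ⟶ HE.scheme.left}

/-- The section `ε a` over `Spec A[ε]`, for a section `a` over `Spec A`. -/
def epsMul (a : toBase HE.scheme (Over.mk g) ⟶ E.tot) :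
    toBase HE.scheme (dualOver g) ⟶ E.tot :=
  letI ε : Fn (toBase HE.scheme (dualOver g)) := dualEps g
  ε • (toBaseMap HE.scheme (dualProj g) ≫ a)

lemma comp_epsMul_eq_zero {T : Over S} (f : T ⟶ toBase HE.scheme (dualOver g))
    (hf : Fn.pull f (dualEps g : Fn (toBase HE.scheme (dualOver g))) = 0)
    (a : toBase HE.scheme (Over.mk g) ⟶ E.tot) : f ≫ epsMul HE a = 0 := by
  rw [epsMul, E.comp_smul, hf, zero_smul]

lemma taut_pull_eps_normalEmb (x : Over.mk g ⟶ (normalBundle HE GF).tot) :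
    GF.taut.pull (toBaseMap HE.scheme (dualEps g • (dualProj g ≫ x) :
        dualOver g ⟶ (normalBundle HE GF).tot) ≫ normalEmb HE GF) =
      graph φ (HE.taut.pull (toBaseStr HE.scheme (dualOver g)))
        (epsMul HE (normalLin HE GF _ x).1.1) (epsMul HE (normalLin HE GF _ x).2.1) := by
  have h : normalLin HE GF (dualOver g) (dualEps g • (dualProj g ≫ x)) =
      dualEps g • (tautRes (dualProj g) (normalLin HE GF _ x).1,
        tautRes (dualProj g) (normalLin HE GF _ x).2) := by
    rw [map_smul, normalLin_comp]
  refine (taut_pull_normalEmb HE GF _).trans ?_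
  rw [h]
  rfl

/-- `j` maps all of `N` only to the Grassmannian of `F`; the point `j(ε x)` lands in `HGr(F)`
because it is a first order thickening of a point of `HGr(E)`. -/
lemma exists_deform (x : Over.mk g ⟶ (normalBundle HE GF).tot) :
    ∃ y : toBase HE.scheme (dualOver g) ⟶ HF.scheme, y ≫ HF.toGr GF =
      toBaseMap HE.scheme (dualEps g • (dualProj g ≫ x) :
        dualOver g ⟶ (normalBundle HE GF).tot) ≫ normalEmb HE GF := by
  have h := taut_pull_eps_normalEmb HE GF x
  have hnd : (extForm φ).NondegOn (graph φ (HE.taut.pull (toBaseStr HE.scheme (dualOver g)))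
      (epsMul HE (normalLin HE GF _ x).1.1) (epsMul HE (normalLin HE GF _ x).2.1)) := by
    refine extForm_nondegOn_graph (HE.nondegOn_taut.pull _) fun K _ σ f => ?_
    have hf : Fn.pull f (dualEps g : Fn (toBase HE.scheme (dualOver g))) = 0 :=
      pull_dualEps_eq_zero g (Over.homMk f.left rfl :
        Over.mk (f.left ≫ (dualOver g).hom) ⟶ dualOver g)
    exact ⟨comp_epsMul_eq_zero HE f hf _, comp_epsMul_eq_zero HE f hf _⟩
  refine ⟨HF.lift _ hnd, GF.hom_ext ?_⟩
  rw [h, ← Subbundle.pull_pull, HF.taut_pull_toGr, HF.taut_pull_lift]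

/-- The first order deformation in `HGr(F)` with a given normal vector. -/
def deform (x : Over.mk g ⟶ (normalBundle HE GF).tot) :
    toBase HE.scheme (dualOver g) ⟶ HF.scheme :=
  (exists_deform HE GF HF x).choose

lemma deform_toGr (x : Over.mk g ⟶ (normalBundle HE GF).tot) :
    deform HE GF HF x ≫ HF.toGr GF = toBaseMap HE.scheme (dualEps g • (dualProj g ≫ x) :
        dualOver g ⟶ (normalBundle HE GF).tot) ≫ normalEmb HE GF :=
  (exists_deform HE GF HF x).choose_spec

lemma eq_deform {x : Over.mk g ⟶ (normalBundle HE GF).tot}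
    {y : toBase HE.scheme (dualOver g) ⟶ HF.scheme}
    (hy : y ≫ HF.toGr GF = toBaseMap HE.scheme (dualEps g • (dualProj g ≫ x) :
        dualOver g ⟶ (normalBundle HE GF).tot) ≫ normalEmb HE GF) : y = deform HE GF HF x := by
  have := HF.mono_toGr GF
  rw [← cancel_mono (HF.toGr GF), hy, deform_toGr]

lemma taut_pull_deform (x : Over.mk g ⟶ (normalBundle HE GF).tot) :
    HF.taut.pull (deform HE GF HF x) =
      graph φ (HE.taut.pull (toBaseStr HE.scheme (dualOver g)))
        (epsMul HE (normalLin HE GF _ x).1.1) (epsMul HE (normalLin HE GF _ x).2.1) := by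
  rw [← taut_pull_eps_normalEmb, ← deform_toGr HE GF HF, ← Subbundle.pull_pull, HF.taut_pull_toGr]

lemma dualZero_deform (x : Over.mk g ⟶ (normalBundle HE GF).tot) :
    toBaseMap HE.scheme (dualZero g) ≫ deform HE GF HF x =
      toBaseStr HE.scheme (Over.mk g) ≫ HE.emb HF := by
  have h0 : Fn.pull (toBaseMap HE.scheme (dualZero g))
      (dualEps g : Fn (toBase HE.scheme (dualOver g))) = 0 := pull_dualZero_dualEps g
  refine HF.hom_ext ?_
  rw [← Subbundle.pull_pull, ← Subbundle.pull_pull, taut_pull_deform, taut_pull_emb, graph_pull,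
    graph_pull, comp_epsMul_eq_zero HE _ h0, comp_epsMul_eq_zero HE _ h0, E.comp_zero,
    Subbundle.pull_pull]
  congr 2
  ext1
  exact Over.w (dualZero g)

lemma deform_comp (x : Over.mk g ⟶ (normalBundle HE GF).tot) {A' : CommRingCat.{u}}
    {g' : Spec A' ⟶ HE.scheme.left} (h : Over.mk g' ⟶ Over.mk g) :
    deform HE GF HF (h ≫ x) = toBaseMap HE.scheme (dualMap h) ≫ deform HE GF HF x := by
  symm
  refine eq_deform HE GF HF ?_
  rw [Category.assoc, deform_toGr, ← Category.assoc]
  refine congrArg (· ≫ normalEmb HE GF) ?_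
  have h1 : dualMap h ≫ (dualEps g • (dualProj g ≫ x) :
        dualOver g ⟶ (normalBundle HE GF).tot) = dualEps g' • (dualProj g' ≫ h ≫ x) := by
    rw [VectorBundle.comp_smul, pull_dualMap_dualEps, ← Category.assoc, dualMap_dualProj,
      Category.assoc]
  rw [← h1]
  ext1
  rfl

/-- The deformations `j(ε x)` restrict to the points of `HGr(E)` modulo `ε` and are natural in the
test ring, so they define a section of the normal sheaf. -/
theorem exists_normalVector (T : Over HE.scheme.left) (x : T ⟶ (normalBundle HE GF).tot) :
    ∃ D : NormalVector (HE.emb HF).left T, ∀ (A : CommRingCat.{u}) (g : Spec A ⟶ HE.scheme.left)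
      (p : Over.mk g ⟶ T) (U : HF.scheme.left.affineOpens)
      (hp : ⊤ ≤ (g ≫ (HE.emb HF).left) ⁻¹ᵁ U.1)
      (hyU : ⊤ ≤ (deform HE GF HF (p ≫ x)).left ⁻¹ᵁ U.1) (a : (HE.emb HF).left.ker.ideal U),
      (deform HE GF HF (p ≫ x)).left.appLE U.1 ⊤ hyU a.1 =
        dualEps g * Fn.pull (dualProj g) (D.val p U hp a) := by
  refine exists_normalVector_of_deformations
    (fun A g p => (deform HE GF HF (p ≫ x)).left) (fun A g p => ?_) fun A g p A' g' h => ?_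
  · exact congrArg (fun f => f.left) (dualZero_deform HE GF HF (p ≫ x))
  · rw [Category.assoc, deform_comp]
    rfl

/-- The section of the normal sheaf of `HGr(E)` in `HGr(F)` given by a section of the normal
bundle. -/
def toNormalVector (T : Over HE.scheme.left) (x : T ⟶ (normalBundle HE GF).tot) :
    NormalVector (HE.emb HF).left T :=
  (exists_normalVector HE GF HF T x).choose

lemma deform_le_preimage (x : Over.mk g ⟶ (normalBundle HE GF).tot) {U : HF.scheme.left.Opens}
    (hp : ⊤ ≤ (g ≫ (HE.emb HF).left) ⁻¹ᵁ U) : ⊤ ≤ (deform HE GF HF x).left ⁻¹ᵁ U :=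
  le_preimage_of_dualZero (congrArg (fun f => f.left) (dualZero_deform HE GF HF x)) hp

lemma deform_appLE {T : Over HE.scheme.left} (x : T ⟶ (normalBundle HE GF).tot)
    (p : Over.mk g ⟶ T) {x' : Over.mk g ⟶ (normalBundle HE GF).tot} (hx' : p ≫ x = x')
    (U : HF.scheme.left.affineOpens) (hp : ⊤ ≤ (g ≫ (HE.emb HF).left) ⁻¹ᵁ U.1)
    (a : (HE.emb HF).left.ker.ideal U) :
    (deform HE GF HF x').left.appLE U.1 ⊤ (deform_le_preimage HE GF HF x' hp) a.1 =
      dualEps g * Fn.pull (dualProj g) ((toNormalVector HE GF HF T x).val p U hp a) := by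
  subst hx'
  exact (exists_normalVector HE GF HF T x).choose_spec A g p U hp _ a

lemma toNormalVector_comp_val {T' T : Over HE.scheme.left} (f : T' ⟶ T)
    (x : T ⟶ (normalBundle HE GF).tot) (p : Over.mk g ⟶ T') (U : HF.scheme.left.affineOpens)
    (hp : ⊤ ≤ (g ≫ (HE.emb HF).left) ⁻¹ᵁ U.1) (a : (HE.emb HF).left.ker.ideal U) :
    (toNormalVector HE GF HF T' (f ≫ x)).val p U hp a =
      (toNormalVector HE GF HF T x).val (p ≫ f) U hp a := by
  apply dualEps_mul_injective
  rw [← deform_appLE HE GF HF (f ≫ x) p rfl U hp a,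
    ← deform_appLE HE GF HF x (p ≫ f) (Category.assoc _ _ _) U hp a]

theorem inducesIdOnNormal_of_toNormalVector
    {ν : NormalBundleIso (HE.emb HF).left (normalBundle HE GF)}
    (hν : ∀ T x, ν.equiv T x = toNormalVector HE GF HF T x) :
    InducesIdOnNormal ν (HF.toGr GF) (normalEmb HE GF) := by
  intro A g x y hy U hyU hg a
  obtain rfl := eq_deform HE GF HF hy
  refine (deform_appLE HE GF HF x (𝟙 _) (Category.id_comp x) U hg a).trans ?_
  rw [hν]
  refine congrArg (fun b => dualEps g * Fn.pull (dualProj g) b) ?_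
  rfl

end Deformation

/-! ### The conormal sheaf of `HGr(E)` in `HGr(F)` -/

section Charts

variable {S : Scheme.{u}} {n : ℕ} {E : VectorBundle S n} {φ : SymplecticForm E}

variable (E) in
/-- The last and the first coordinate of the sections of `F = 𝒪 ⊕ E ⊕ 𝒪`. -/
def outerCoord : Bool → ∀ T : Over S, (T ⟶ (extBundle E).tot) →ₗ[Fn T] Fn T
  | true, T => coordR E T
  | false, T => coordL E T

lemma outerCoord_comp (b : Bool) {T' T : Over S} (f : T' ⟶ T) (y : T ⟶ (extBundle E).tot) :
    outerCoord E b T' (f ≫ y) = Fn.pull f (outerCoord E b T y) := by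
  cases b
  · exact coordL_comp E f y
  · exact coordR_comp E f y

lemma outerCoord_of_mem_graph (b : Bool) {k : ℕ} {T T' : Over S} {W : Subbundle E k T}
    {a : Bool → (T ⟶ E.tot)} {f : T' ⟶ T} {y : T' ⟶ (extBundle E).tot}
    (hy : y ∈ (graph φ W (a false) (a true)).sec f) :
    outerCoord E b T' y = φ.form T' (f ≫ a b) (coordE E T' y) := by
  cases b
  · exact (mem_graph.mp hy).2.1
  · exact (mem_graph.mp hy).2.2

variable {r : ℕ} (HE : HGr φ r) (GF : Gr (extBundle E) (2 * r)) (HF : HGr (extForm φ) r)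

/-- An affine open subscheme of `HGr(F)` with a frame of the tautological bundle, and the functions
on it which are the last and first coordinates of the members of the frame. -/
structure OuterChart where
  opens : HF.scheme.left.affineOpens
  frame : Fin (2 * r) → (restr HF.scheme opens.1 ⟶ (extBundle E).tot)
  isFrame : HF.taut.IsFrame (restrι HF.scheme opens.1) frame
  fn : Bool × Fin (2 * r) → Γ(HF.scheme.left, opens.1)
  appLE_fn : ∀ (j : Bool × Fin (2 * r)) (h : ⊤ ≤ (restrι HF.scheme opens.1).left ⁻¹ᵁ opens.1),
    (restrι HF.scheme opens.1).left.appLE _ ⊤ h (fn j) = outerCoord E j.1 _ (frame j.2)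

lemma exists_outerChart (z : HF.scheme.left) : ∃ c : OuterChart HF, z ∈ c.opens.1 := by
  obtain ⟨U, hU, e, he⟩ := HF.taut.exists_isFrame z
  obtain ⟨V, hV, hzV, hVU⟩ := exists_isAffineOpen_mem_and_subset hU
  let l := liftRestr (restrι HF.scheme V) U fun x => hVU x.2
  have hl : l ≫ restrι HF.scheme U = restrι HF.scheme V := liftRestr_restrι _ _ _
  have h : ⊤ ≤ (restrι HF.scheme V).left ⁻¹ᵁ V := fun x _ => x.2
  choose s hs using fun j : Bool × Fin (2 * r) =>
    (bijective_appLE_restrι HF.scheme V h).2 (outerCoord E j.1 _ (l ≫ e j.2))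
  exact ⟨⟨⟨V, hV⟩, fun a => l ≫ e a, hl ▸ he.comp l, s, fun j _ => hs j⟩, hzV⟩

variable {HF} (c : OuterChart HF)

lemma OuterChart.appLE_comp_fn {T : Over S} (l : T ⟶ restr HF.scheme c.opens.1)
    {f : T ⟶ HF.scheme} (hl : l ≫ restrι HF.scheme c.opens.1 = f)
    (h : ⊤ ≤ f.left ⁻¹ᵁ c.opens.1) (j : Bool × Fin (2 * r)) :
    f.left.appLE _ ⊤ h (c.fn j) = outerCoord E j.1 T (l ≫ c.frame j.2) := by
  subst hl
  have h1 : ⊤ ≤ (restrι HF.scheme c.opens.1).left ⁻¹ᵁ c.opens.1 := fun x _ => x.2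
  refine (appLE_comp_left l _ h1 h _).trans ?_
  rw [c.appLE_fn, outerCoord_comp]

lemma OuterChart.isBasisOf {T : Over S} (l : T ⟶ restr HF.scheme c.opens.1)
    {f : T ⟶ HF.scheme} (hl : l ≫ restrι HF.scheme c.opens.1 = f) :
    IsBasisOf (fun k => l ≫ c.frame k) (HF.taut.sec f) := by
  subst hl
  exact c.isFrame l

lemma OuterChart.exists_lift {T : Over S} (f : T ⟶ HF.scheme) (h : ⊤ ≤ f.left ⁻¹ᵁ c.opens.1) :
    ∃ l : T ⟶ restr HF.scheme c.opens.1, l ≫ restrι HF.scheme c.opens.1 = f :=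
  ⟨liftRestr f _ fun _ => h trivial, liftRestr_restrι _ _ _⟩

/-- Over `HGr(E)` the tautological subbundle lies in `E`, so its outer coordinates are zero. -/
lemma OuterChart.fn_mem (j : Bool × Fin (2 * r)) :
    c.fn j ∈ (HE.emb HF).left.ker.ideal c.opens := by
  have := isClosedImmersion_emb HE HF
  rw [Scheme.Hom.ker_apply]
  let W := (HE.emb HF).left ⁻¹ᵁ c.opens.1
  have hW : ⊤ ≤ (restrι HE.scheme W).left ⁻¹ᵁ W := fun x _ => x.2
  have hO : ⊤ ≤ (restrι HE.scheme W ≫ HE.emb HF).left ⁻¹ᵁ c.opens.1 := hW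
  refine (bijective_appLE_restrι HE.scheme W hW).1 (Eq.trans ?_
    (map_zero ((restrι HE.scheme W).left.appLE W ⊤ hW).hom).symm)
  change (restrι HE.scheme W).left.appLE W ⊤ hW ((HE.emb HF).left.app _ _) = 0
  rw [Scheme.Hom.app_eq_appLE]
  refine (appLE_appLE _ _ le_rfl hW hO _).trans ?_
  obtain ⟨l, hl⟩ := c.exists_lift (restrι HE.scheme W ≫ HE.emb HF) hO
  refine (c.appLE_comp_fn l hl hO j).trans ?_
  have hmem := (c.isBasisOf l hl).mem j.2
  rcases j with ⟨_ | _, k⟩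
  · exact edgeL_vanishesOn_emb HE HF _ _ _ hmem
  · exact edgeR_vanishesOn_emb HE HF _ _ _ hmem

lemma fromSpec_appLE {X : Scheme.{u}} {U : X.Opens} (hU : IsAffineOpen U) {B : CommRingCat.{u}}
    (f : Γ(X, U) ⟶ B) (h : ⊤ ≤ (Spec.map f ≫ hU.fromSpec) ⁻¹ᵁ U) (a : Γ(X, U)) :
    (Spec.map f ≫ hU.fromSpec).appLE U ⊤ h a = (Scheme.ΓSpecIso B).inv (f a) := by
  have h1 : ⊤ ≤ hU.fromSpec ⁻¹ᵁ U := hU.fromSpec_preimage_self.ge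
  have h2 : hU.fromSpec.appLE U ⊤ h1 a = (Scheme.ΓSpecIso Γ(X, U)).inv a := by
    rw [Scheme.Hom.appLE, hU.fromSpec_app_self, Category.assoc, ← Functor.map_comp]
    exact congrArg (fun f => f.hom ((Scheme.ΓSpecIso Γ(X, U)).inv a))
      ((Spec Γ(X, U)).presheaf.map_id _)
  refine (appLE_appLE _ _ h1 le_top h a).symm.trans ?_
  rw [h2]
  refine (ConcreteCategory.congr_hom (Scheme.Hom.app_eq_appLE (Spec.map f)).symm _).trans ?_
  exact (ConcreteCategory.congr_hom (Scheme.ΓSpecIso_inv_naturality f) a).symm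

/-- For the reverse inclusion, consider the closed subscheme `Spec B` cut out by the outer
coordinates of the frame. Both coordinates vanish on the tautological subbundle over it, so its
inclusion factors through `HGr(E)`; hence every function vanishing on `HGr(E)` is zero in `B`. -/
lemma OuterChart.span_fn : Ideal.span (Set.range c.fn) = (HE.emb HF).left.ker.ideal c.opens := by
  refine le_antisymm (Ideal.span_le.mpr ?_) fun a ha => ?_
  · rintro _ ⟨j, rfl⟩
    exact c.fn_mem HE j
  let B : CommRingCat.{u} := .of (Γ(HF.scheme.left, c.opens.1) ⧸ Ideal.span (Set.range c.fn))
  let q : Γ(HF.scheme.left, c.opens.1) ⟶ B :=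
    CommRingCat.ofHom (Ideal.Quotient.mk (Ideal.span (Set.range c.fn)))
  let f₀ : Spec B ⟶ HF.scheme.left := Spec.map q ≫ c.opens.2.fromSpec
  let f : Over.mk (f₀ ≫ HF.scheme.hom) ⟶ HF.scheme := Over.homMk f₀ rfl
  have hf : ⊤ ≤ f.left ⁻¹ᵁ c.opens.1 := by
    change ⊤ ≤ Spec.map q ⁻¹ᵁ c.opens.2.fromSpec ⁻¹ᵁ c.opens.1
    rw [c.opens.2.fromSpec_preimage_self]
    exact le_rfl
  obtain ⟨l, hl⟩ := c.exists_lift f hf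
  have h0 : ∀ j : Bool × Fin (2 * r), outerCoord E j.1 _ (l ≫ c.frame j.2) = 0 := by
    intro j
    refine (c.appLE_comp_fn l hl hf j).symm.trans ((fromSpec_appLE c.opens.2 q hf _).trans ?_)
    have : q (c.fn j) = 0 := Ideal.Quotient.eq_zero_iff_mem.mpr (Ideal.subset_span ⟨j, rfl⟩)
    rw [this]
    exact map_zero (Scheme.ΓSpecIso B).inv.hom
  have hvan : ∀ (b : Bool) (T' : Over S) (g : T' ⟶ Over.mk (f₀ ≫ HF.scheme.hom)),
      ∀ u ∈ (HF.taut.pull f).sec g, outerCoord E b T' u = 0 := by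
    intro b T' g u hu
    obtain ⟨z, rfl⟩ := (c.isBasisOf (g ≫ l)
      ((Category.assoc _ _ _).trans (congrArg (g ≫ ·) hl))).exists_eq_sum hu
    rw [map_sum]
    refine Finset.sum_eq_zero fun k _ => ?_
    rw [map_smul, Category.assoc, outerCoord_comp, h0 (b, k), map_zero, smul_zero]
  obtain ⟨g, hg⟩ := exists_comp_emb_eq HE HF f (hvan true) (hvan false)
  have hgl : g.left ≫ (HE.emb HF).left = f₀ := congrArg (fun f => f.left) hg
  have h1 : f₀.appLE _ ⊤ hf a = 0 :=
    (appLE_congr_hom hgl (by rw [hgl]; exact hf) hf a).symm.trans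
      (appLE_eq_zero_of_mem_ker g.left _ ⟨a, ha⟩)
  have h2 : (Scheme.ΓSpecIso B).inv (q a) = (Scheme.ΓSpecIso B).inv 0 :=
    ((fromSpec_appLE c.opens.2 q hf a).symm.trans h1).trans
      (map_zero (Scheme.ΓSpecIso B).inv.hom).symm
  exact Ideal.Quotient.eq_zero_iff_mem.mp
    ((ConcreteCategory.bijective_of_isIso (Scheme.ΓSpecIso B).inv).1 h2)

/-- The generators of the ideal of `HGr(E)` given by the outer coordinates. -/
def OuterChart.gen (j : Bool × Fin (2 * r)) : (HE.emb HF).left.ker.ideal c.opens :=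
  ⟨c.fn j, c.fn_mem HE j⟩

lemma OuterChart.span_gen :
    Submodule.span Γ(HF.scheme.left, c.opens.1) (Set.range (c.gen HE)) = ⊤ :=
  (Submodule.span_range_subtype_eq_top_iff _ (c.fn_mem HE)).mpr (c.span_fn HE)

/-- The components of a section of the normal bundle. -/
def normalPart {T : Over HE.scheme.left} (x : T ⟶ (normalBundle HE GF).tot) (b : Bool) :
    toBase HE.scheme T ⟶ E.tot :=
  bif b then (normalLin HE GF T x).2.1 else (normalLin HE GF T x).1.1

lemma normalPart_comp {T' T : Over HE.scheme.left} (f : T' ⟶ T)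
    (x : T ⟶ (normalBundle HE GF).tot) (b : Bool) :
    normalPart HE GF (f ≫ x) b = toBaseMap HE.scheme f ≫ normalPart HE GF x b := by
  cases b <;> rw [normalPart, normalLin_comp] <;> rfl

lemma dualEps_mul_eq {A : CommRingCat.{u}} (σ : Spec A ⟶ S) (c : Fn (dualOver σ)) :
    dualEps σ * c = dualEps σ * Fn.pull (dualProj σ) (Fn.pull (dualZero σ) c) := by
  obtain ⟨b, hb⟩ := exists_eq_add_dualEps_mul σ c
  linear_combination (dualEps σ) * hb + Fn.pull (dualProj σ) b * dualEps_mul_self σ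

/-- The deformation is the graph with components `ε a` and `ε b`, so the outer coordinates of its
`k`-th frame vector are `ε φ(a, e_k)` and `ε φ(b, e_k)`, where `e_k` denotes the component in `E`.
Because of the factor `ε`, only `e_k` over `HGr(E)` matters. -/
lemma OuterChart.val_toNormalVector {T : Over HE.scheme.left}
    (x : T ⟶ (normalBundle HE GF).tot) (l : toBase HE.scheme T ⟶ restr HF.scheme c.opens.1)
    (hl : l ≫ restrι HF.scheme c.opens.1 = toBaseStr HE.scheme T ≫ HE.emb HF)
    (hO : ⊤ ≤ (T.hom ≫ (HE.emb HF).left) ⁻¹ᵁ c.opens.1) (j : Bool × Fin (2 * r)) :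
    (toNormalVector HE GF HF T x).val (𝟙 T) c.opens hO (c.gen HE j) =
      φ.form (toBase HE.scheme T) (normalPart HE GF x j.1) (coordE E _ (l ≫ c.frame j.2)) := by
  refine Fn.ext_of_points fun A g p => dualEps_mul_injective g ?_
  have hp : ⊤ ≤ (g ≫ (HE.emb HF).left) ⁻¹ᵁ c.opens.1 := by
    have h1 : p.left ≫ T.hom = g := Over.w p
    rw [← h1]
    exact fun x _ => hO trivial
  rw [← NormalVector.val_comp _ p (𝟙 T) c.opens hO hp, Category.comp_id,
    ← deform_appLE HE GF HF x p rfl c.opens hp]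
  obtain ⟨l', hl'⟩ := c.exists_lift _ (deform_le_preimage HE GF HF (p ≫ x) hp)
  refine (c.appLE_comp_fn l' hl' _ j).trans ?_
  have hmem := (c.isBasisOf l' hl').mem j.2
  rw [← Subbundle.mem_pull_id, taut_pull_deform] at hmem
  -- Modulo `ε` the frame along the deformation is the frame along `HGr(E)`.
  have h0 : toBaseMap HE.scheme (dualZero g) ≫ l' = toBaseMap HE.scheme p ≫ l := by
    refine restrι_cancel ?_
    rw [Category.assoc, Category.assoc, hl', hl, dualZero_deform, ← Category.assoc]
    congr 1
    ext1
    exact (Over.w p).symm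
  rw [outerCoord_of_mem_graph j.1 (a := fun b => epsMul HE (normalPart HE GF (p ≫ x) b)) hmem,
    Category.id_comp, epsMul]
  rw [map_smul, LinearMap.smul_apply]
  -- A multiple of `ε` depends only on the other factor modulo `ε`, so both sides can be compared
  -- over `Spec A`.
  refine (dualEps_mul_eq g _).trans ?_
  refine congrArg (fun b => dualEps g * Fn.pull (dualProj g) b) ?_
  change Fn.pull (toBaseMap HE.scheme (dualZero g)) _ = Fn.pull (toBaseMap HE.scheme p) _
  rw [← φ.form_comp, ← φ.form_comp]
  have h1 : toBaseMap HE.scheme (dualZero g) ≫ toBaseMap HE.scheme (dualProj g) = 𝟙 _ := by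
    ext1
    exact congrArg (fun f => f.left) (dualZero_dualProj g)
  have h2 : toBaseMap HE.scheme (dualZero g) ≫ toBaseMap HE.scheme (dualProj g) ≫
      normalPart HE GF (p ≫ x) j.1 = toBaseMap HE.scheme p ≫ normalPart HE GF x j.1 := by
    rw [← Category.assoc, h1, Category.id_comp, normalPart_comp]
  have h3 : toBaseMap HE.scheme (dualZero g) ≫ coordE E _ (l' ≫ c.frame j.2) =
      toBaseMap HE.scheme p ≫ coordE E _ (l ≫ c.frame j.2) := by
    rw [← coordE_comp, ← coordE_comp, ← Category.assoc, h0, Category.assoc]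
  exact congrArg₂ (fun a b => φ.form _ a b) h2 h3

/-- Along `HGr(E)` the components in `E` of the frame of `𝒰_F` form a frame of `𝒰_E`, and `φ` is a
perfect pairing there. The computation takes place in `F`, where `𝒰_F` is the graph with `a = b = 0`
and `midForm` is nondegenerate. -/
lemma OuterChart.existsUnique_section {T : Over S} (s : T ⟶ HE.scheme)
    (l : T ⟶ restr HF.scheme c.opens.1)
    (hl : l ≫ restrι HF.scheme c.opens.1 = s ≫ HE.emb HF) (y : Fin (2 * r) → Fn T) :
    ∃! v : HE.taut.sec s, ∀ k, φ.form T v.1 (coordE E T (l ≫ c.frame k)) = y k := by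
  have htaut : HF.taut.pull (s ≫ HE.emb HF) = graph φ (HE.taut.pull s) 0 0 := by
    rw [← Subbundle.pull_pull, taut_pull_emb, graph_pull, E.comp_zero]
  have hinj : PointwiseInjective (HF.taut.pull (s ≫ HE.emb HF))
      (fun k => (midForm φ).right (l ≫ c.frame k)) := by
    have hnd : (midForm φ).NondegOn (HF.taut.pull (s ≫ HE.emb HF)) := by
      rw [htaut]
      exact midForm_nondegOn_graph (HE.nondegOn_taut.pull s)
    have hfr : (HF.taut.pull (s ≫ HE.emb HF)).IsFrame (𝟙 T) (fun k => l ≫ c.frame k) := by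
      intro T' g
      have h1 := c.isBasisOf (g ≫ l) ((Category.assoc _ _ _).trans (congrArg (g ≫ ·) hl))
      have h2 : (fun k => (g ≫ l) ≫ c.frame k) = fun k => g ≫ l ≫ c.frame k :=
        funext fun k => Category.assoc _ _ _
      rw [h2] at h1
      rwa [Category.comp_id]
    have h2 := (midForm φ).pointwiseInjective_of_isFrame hnd hfr
    rwa [Subbundle.pull_id] at h2
  have hmem : ∀ v : T ⟶ E.tot, v ∈ HE.taut.sec s →
      vec 0 v 0 ∈ (HF.taut.pull (s ≫ HE.emb HF)).sec (𝟙 T) := by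
    intro v hv
    rw [htaut, mem_graph, coordE_vec, coordL_vec, coordR_vec, E.comp_zero, map_zero]
    exact ⟨Subbundle.mem_pull_id.mpr hv, rfl, rfl⟩
  have happ : ∀ (u : T ⟶ (extBundle E).tot) (k : Fin (2 * r)),
      ((midForm φ).right (l ≫ c.frame k)).app (𝟙 T) u =
        φ.form T (coordE E T u) (coordE E T (l ≫ c.frame k)) := by
    intro u k
    refine (midForm_apply u _).trans ?_
    rw [Category.id_comp]
  obtain ⟨u, hu, huy⟩ := hinj.exists_section y
  have huE : coordE E T u ∈ HE.taut.sec s := by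
    rw [htaut, mem_graph] at hu
    exact Subbundle.mem_pull_id.mp hu.1
  refine ⟨⟨_, huE⟩, fun k => (happ u k).symm.trans (huy k), fun v hv => Subtype.ext ?_⟩
  have h := hinj.eq_of_app_eq (hmem _ v.2) hu fun k => by
    rw [happ, happ, coordE_vec, hv, ← huy, happ]
  change v.1 = coordE E T u
  rw [← h, coordE_vec]

end Charts

/-- The bundle of pairs of sections of the tautological bundle is the normal bundle of `HGr(E)` in
`HGr(F)`. -/
theorem exists_normalBundleIso {S : Scheme.{u}} {n : ℕ} {E : VectorBundle S n}
    {φ : SymplecticForm E} {r : ℕ} (HE : HGr φ r) (GF : Gr (extBundle E) (2 * r))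
    (HF : HGr (extForm φ) r) : ∃ ν : NormalBundleIso (HE.emb HF).left (normalBundle HE GF),
      InducesIdOnNormal ν (HF.toGr GF) (normalEmb HE GF) := by
  obtain ⟨ν, hν⟩ := exists_normalBundleIso_of_charts (toNormalVector HE GF HF)
    (fun f x A g p => toNormalVector_comp_val HE GF HF f x p) fun z => by
      obtain ⟨c, hc⟩ := exists_outerChart HF ((HE.emb HF).left z)
      refine ⟨c.opens, _, c.gen HE, hc, c.span_gen HE, fun T hO => ?_⟩
      obtain ⟨l, hl⟩ := c.exists_lift (toBaseStr HE.scheme T ≫ HE.emb HF) hO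
      have hval := fun x j => c.val_toNormalVector HE GF x l hl hO j
      have hadd : ∀ x y b, normalPart HE GF (x + y : T ⟶ _) b =
          normalPart HE GF x b + normalPart HE GF y b := by
        intro x y b
        cases b <;> rw [normalPart, map_add] <;> rfl
      have hsmul : ∀ (a : Fn (toBase HE.scheme T)) (x : T ⟶ (normalBundle HE GF).tot) b,
          normalPart HE GF ((show Fn T from a) • x) b = a • normalPart HE GF x b := by
        intro a x b
        cases b <;> rw [normalPart, map_smul] <;> rfl
      have hex := fun y => c.existsUnique_section HE (toBaseStr HE.scheme T) l hl y
      -- The generators indexed by `false` see only the first component of a pair, those indexed by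
      -- `true` only the second; bijectivity is the perfect pairing `φ` applied to each component.
      refine ⟨fun x y j => ?_, fun a x j => ?_, fun x y hxy => ?_, fun y => ?_⟩
      · rw [hval, hval, hval, hadd, map_add, LinearMap.add_apply]
      · rw [hval, hval]
        refine (congrArg (fun v => φ.form _ v _) (hsmul a x j.1)).trans ?_
        rw [map_smul, LinearMap.smul_apply]
        rfl
      · have h1 : ∀ j, _ := fun j => ((hval x j).symm.trans (congrFun hxy j)).trans (hval y j)
        apply (normalLin HE GF T).injective
        refine Prod.ext ((hex _).unique (fun k => h1 (false, k)) fun k => rfl)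
          ((hex _).unique (fun k => h1 (true, k)) fun k => rfl)
      · obtain ⟨a, ha, -⟩ := hex fun k => y (false, k)
        obtain ⟨b, hb, -⟩ := hex fun k => y (true, k)
        refine ⟨(normalLin HE GF T).symm (a, b), funext fun j => (hval _ j).trans ?_⟩
        rcases j with ⟨_ | _, k⟩
        · rw [normalPart, LinearEquiv.apply_symm_apply]
          exact ha k
        · rw [normalPart, LinearEquiv.apply_symm_apply]
          exact hb k
  exact ⟨ν, inducesIdOnNormal_of_toNormalVector HE GF HF hν⟩

end SymplecticGrassmannian

end

theorem theoremT {S : Scheme.{u}} {n : ℕ} (E : VectorBundle S (2 * n)) (φ : SymplecticForm E)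
    (r : ℕ) :
    -- the Grassmannian bundles in question exist
    (Nonempty (Gr (extBundle E) (2 * r)) ∧ Nonempty (Gr (oplus (trivialLine S) E) (2 * r)) ∧
      Nonempty (Gr (oplus E (trivialLine S)) (2 * r)) ∧ Nonempty (HGr φ r) ∧
      Nonempty (HGr (extForm φ) r)) ∧
    ∀ (GF : Gr (extBundle E) (2 * r)) (GP : Gr (oplus (trivialLine S) E) (2 * r))
      (GM : Gr (oplus E (trivialLine S)) (2 * r)) (HE : HGr φ r) (HF : HGr (extForm φ) r),
      IsOpenImmersion (HF.toGr GF).left ∧ QuasiCompact (HF.toGr GF).left ∧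
      IsClosedImmersion (HE.emb HF).left ∧
      ∃ (N : VectorBundle HE.scheme.left (4 * r)) (ν : NormalBundleIso (HE.emb HF).left N)
        (j : toBase HE.scheme N.tot ⟶ GF.scheme),
        -- (a)
        (IsOpenImmersion j.left ∧ QuasiCompact j.left ∧
          (0 : Over.mk (𝟙 HE.scheme.left) ⟶ N.tot).left ≫ j.left =
            (HE.emb HF).left ≫ (HF.toGr GF).left ∧
          InducesIdOnNormal ν (HF.toGr GF) j) ∧
        -- (b)
        ∃ (kp : HF.inter GF GP (inclPlus E) ⟶ toBase HE.scheme N.tot)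
          (km : HF.inter GF GM (inclMinus E) ⟶ toBase HE.scheme N.tot)
          (P M : Subbundle N (2 * r) (Over.mk (𝟙 HE.scheme.left))),
          (IsClosedImmersion (HF.interι GF GP (inclPlus E)).left ∧
            IsRetrocompact (Set.range (HF.interι GF GP (inclPlus E)).left)ᶜ ∧
            IsClosedImmersion (HF.interι GF GM (inclMinus E)).left ∧
            IsRetrocompact (Set.range (HF.interι GF GM (inclMinus E)).left)ᶜ ∧
            kp ≫ j = HF.interι GF GP (inclPlus E) ≫ HF.toGr GF ∧
            km ≫ j = HF.interι GF GM (inclMinus E) ≫ HF.toGr GF ∧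
            (∀ (T : Over HE.scheme.left) (x : T ⟶ N.tot),
              (x ∈ P.sec (Over.mkIdTerminal.from T) ↔
                ∃ y : toBase HE.scheme T ⟶ HF.inter GF GP (inclPlus E),
                  y ≫ kp = toBaseMap HE.scheme x) ∧
              (x ∈ M.sec (Over.mkIdTerminal.from T) ↔
                ∃ y : toBase HE.scheme T ⟶ HF.inter GF GM (inclMinus E),
                  y ≫ km = toBaseMap HE.scheme x)) ∧
            (∀ T : Over HE.scheme.left,
              IsCompl (P.sec (Over.mkIdTerminal.from T)) (M.sec (Over.mkIdTerminal.from T))) ∧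
            ∃ (lp : HE.scheme ⟶ HF.inter GF GP (inclPlus E))
              (lm : HE.scheme ⟶ HF.inter GF GM (inclMinus E)),
              lp ≫ HF.interι GF GP (inclPlus E) = HE.emb HF ∧
              lm ≫ HF.interι GF GM (inclMinus E) = HE.emb HF ∧
              IsPullback lp lm (HF.interι GF GP (inclPlus E)) (HF.interι GF GM (inclMinus E))) ∧
          -- (c)
          (∃ (cp : BaseIso P HE.taut) (cm : BaseIso M HE.taut),
            ∀ (T : Over HE.scheme.left) (xp : P.sec (Over.mkIdTerminal.from T))
              (xm : M.sec (Over.mkIdTerminal.from T))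
              (y : toBase HE.scheme T ⟶ (extBundle E).tot),
              y ∈ GF.taut.sec (toBaseMap HE.scheme (xp.1 + xm.1) ≫ j) ↔
                ∃ w ∈ HE.taut.sec (toBaseStr HE.scheme T),
                  y = vec (φ.form _ (cp.equiv T xp).1 w) w (φ.form _ (cm.equiv T xm).1 w)) ∧
          -- (d)
          (∃ s : HF.scheme ⟶ (extBundle E).tot,
            (∀ (T : Over S) (f : T ⟶ HF.scheme), ∀ u ∈ HF.taut.sec f,
              (extForm φ).form T (f ≫ s) u = coordR E T u) ∧
            MeetsZeroTransversally HF.taut s (HF.interι GF GP (inclPlus E))) ∧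
          (∃ s : HF.scheme ⟶ (extBundle E).tot,
            (∀ (T : Over S) (f : T ⟶ HF.scheme), ∀ u ∈ HF.taut.sec f,
              (extForm φ).form T (f ≫ s) u = coordL E T u) ∧
            MeetsZeroTransversally HF.taut s (HF.interι GF GM (inclMinus E))) ∧
          -- (e)
          (∃ e : SubbundleIso (HE.taut.pull (kp ≫ toBaseStr HE.scheme N.tot))
              (HF.taut.pull (HF.interι GF GP (inclPlus E))),
            ∀ (T : Over S) (f : T ⟶ HF.inter GF GP (inclPlus E)) (x y),
              (extForm φ).form T (e.equiv f x).1 (e.equiv f y).1 = φ.form T x.1 y.1) ∧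
          (∃ e : SubbundleIso (HE.taut.pull (km ≫ toBaseStr HE.scheme N.tot))
              (HF.taut.pull (HF.interι GF GM (inclMinus E))),
            ∀ (T : Over S) (f : T ⟶ HF.inter GF GM (inclMinus E)) (x y),
              (extForm φ).form T (e.equiv f x).1 (e.equiv f y).1 = φ.form T x.1 y.1) := by
  refine ⟨⟨nonempty_gr _ _, nonempty_gr _ _, nonempty_gr _ _, nonempty_hgr _ _, nonempty_hgr _ _⟩,
    fun GF GP GM HE HF => ⟨HF.isOpenImmersion_toGr GF, HF.quasiCompact_toGr GF,
      isClosedImmersion_emb HE HF, ?_⟩⟩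
  obtain ⟨ν, hν⟩ := exists_normalBundleIso HE GF HF
  obtain ⟨kp, hkp⟩ := exists_inter_normalEmb GF GP HE HF (edgeR E)
  obtain ⟨km, hkm⟩ := exists_inter_normalEmb GF GM HE HF (edgeL E)
  obtain ⟨sp, hsp, hp⟩ := exists_transversal_section (edgeR E) GF GP HF
  obtain ⟨sm, hsm, hm⟩ := exists_transversal_section (edgeL E) GF GM HF
  -- `N` is the bundle of pairs `(a, b)` and `j` the inclusion of the graph locus. The last
  -- coordinate `edgeR` cuts out `b = 0`, so `N⁺` is the first copy of `𝒰_E`; the first coordinate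
  -- `edgeL` makes `N⁻` the second.
  exact ⟨normalBundle HE GF, ν, normalEmb HE GF,
    ⟨isOpenImmersion_normalEmb HE GF, quasiCompact_normalEmb HE GF, zero_left_normalEmb HE GF HF, hν⟩,
    kp, km, (TautSummand.inl HE).subbundle GF, (TautSummand.inr HE).subbundle GF,
    ⟨hp.isClosedImmersion, isRetrocompact_compl_zeros hp.zero_iff, hm.isClosedImmersion,
      isRetrocompact_compl_zeros hm.zero_iff, hkp, hkm,
      fun T x => ⟨mem_subbundle_inl_iff_exists hkp x, mem_subbundle_inr_iff_exists hkm x⟩,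
      isCompl_summands HE GF, exists_isPullback_emb HE GF GP GM HF⟩,
    ⟨(TautSummand.inl HE).baseIso GF, (TautSummand.inr HE).baseIso GF, mem_taut_sum_iff⟩,
    ⟨sp, hsp, hp⟩, ⟨sm, hsm, hm⟩, exists_isometry (edgeR E) hkp, exists_isometry (edgeL E) hkm⟩
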